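/- **Theorem.** Let $G$ be a compact Lie group with simple Lie algebra, let $T\subset G$ be a maximal torus and fix an identification $T\cong (S^1)^n$. Let $X_1,\dots,X_n$ be the corresponding basis of the cocharacter lattice $\Lambda$ in the Lie algebra $\mathfrak t$ of $T$. Let $\langle\cdot,\cdot\rangle$ be a Euclidean scalar product on $\mathfrak t$, and let $p>0$ be a real number and $q$ an integer $n\times n$-matrix with $\langle X_i,X_j\rangle=p\,(q_{ij}+q_{ji})$; that is, $\langle\lambda,\lambda\rangle\in 2p\mathbb Z$ for all $\lambda\in\Lambda$. (This is the condition for the circle extension below to exist. Such $p$ and $q$ exist for the restriction of every $\mathrm{Ad}(G)$-invariant scalar product on the Lie algebra of $G$; for the negative of the Killing form one can take $p=1$.) *The space $\widehat{MT}$.* Let $MT$ be the group of all holomorphic loops $f:\mathbb C^*\to T_{\mathbb C}=(\mathbb C^*)^n$ with $f(S^1)\subset T$. Every such $f$ is uniquely $f(z)=t\,z^{\lambda}\exp(i\eta(z))$ with $t\in T$, $\lambda\in\Lambda=\mathbb Z^n$ and $\eta:\mathbb C^*\to\mathbb C^n$ holomorphic, real on $S^1$, with mean value $0$ on $S^1$.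 Write $(x,y)=x^{T}(q+q^{T})y$ and $\omega(\eta,\zeta)=\frac1{2\pi}\int_0^{2\pi}(\eta,\partial_\theta\zeta)\,d\theta$. Let $\widetilde{MT}$ be $MT\times S^1$ with the product $$(\lambda,t,\eta,u)(\mu,s,\zeta,v)=\bigl(\lambda+\mu,\;ts,\;\eta+\zeta,\;uv\,s^{-(\lambda,\cdot)}(-1)^{\lambda^{T}q\mu}e^{i\omega(\eta,\zeta)/2}\bigr),$$ and let $\widehat{MT}=\widetilde{MT}\rtimes S^1$, where $w\in S^1$ acts by $(\mu,s,\zeta,v)\mapsto(\mu,\,s\,w^{\mu},\,\zeta(w\,\cdot),\,v\,w^{-(\mu,\mu)/2})$, which is the rotation $f\mapsto f(w\,\cdot)$ of loops. $\widehat{MT}$ is given the product manifold structure of $\mathbb Z^n\times T\times V\times S^1\times S^1$, where $V$ is the space of the loops $\eta$, graded by the seminorms $\|\eta\|_m=\sup_{e^{-m}\le|z|\le e^m}|\eta(z)|$. Tangent vectors at the identity are $k+\eta+a\,c+b\,d$, with $k\in\mathfrak t$ a constant loop, $\eta\in V$ and $a,b\in\mathbb R$ the coefficients of the angular directions in the central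 circle and the rotation circle. The metric of $\widehat{MT}$ is the left translate of the scalar product $\frac1{2\pi}\int_0^{2\pi}\langle k+\eta,k'+\eta'\rangle\,d\theta-p\,(ab'+a'b)$. *Claim.* 1. $\widehat{MT}$ is a central extension of $MT\rtimes S^1$ by $S^1$. Its Lie algebra is the real form $\{f\in L(\mathbb C^n): f(S^1)\subset i\mathbb R^n\}\oplus i\mathbb R c\oplus\mathbb R d$ of the complex geometric affine Kac-Moody algebra $\widehat L(\mathbb C^n)=L(\mathbb C^n)\oplus\mathbb Cc\oplus\mathbb Cd$ of the Abelian Lie algebra $\mathbb C^n$ ($L(\mathbb C^n)$ being the holomorphic maps $\mathbb C^*\to\mathbb C^n$), whose bracket is $[d,f]=izf'$, $[f,g]=\mathrm{Res}\langle f,g'\rangle\,c$, with $c$ central; the tangent vector $(k,\eta,a,b)$ corresponds to $i(k+\eta)+ipa\,c+b\,d$. So $\widehat{MT}$ is an affine geometric Kac-Moody group of Euclidean type. 2. $\widehat{MT}$ is a tame Fréchet Lorentz symmetric space: it is a manifold with charts in a tame Fréchet space (a tame direct summand of a space $\Sigma(B)$ of exponentially decreasing sequences in a Banach space $B$) and smooth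 tame chart transition functions; the metric is a smooth, weakly nondegenerate metric of index $1$ which has a Levi-Civita connection; and every point is an isolated fixed point of an involutive isometry. 3. All left translations are isometries, and $\widehat{MT}$ is a Kac-Moody symmetric space of Euclidean type: its isometry group contains a subgroup, acting continuously and transitively, which is isomorphic to a Euclidean affine geometric Kac-Moody group (that is, a group constructed as above from some torus and some integral form $q$ with $q+q^T$ positive definite), and the isotropy group of every point in this subgroup is trivial. -/

import Mathlib

open scoped Manifold ContDiff Topology

universe u

namespace KacMoody

noncomputable section

/-! ## Graded and tame Fréchet spaces -/

/-- A sequence of seminorms on a real vector space. -/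
class Graded (F : Type*) [AddCommGroup F] [Module ℝ F] where
  gr : ℕ → Seminorm ℝ F

/-- The `n`-th seminorm of a graded space. -/
abbrev gr {F : Type*} [AddCommGroup F] [Module ℝ F] [Graded F] (n : ℕ) : Seminorm ℝ F :=
  Graded.gr n

instance : Graded ℝ := ⟨fun _ => normSeminorm ℝ ℝ⟩

instance (n : ℕ) : Graded (Fin n → ℝ) := ⟨fun _ => normSeminorm ℝ (Fin n → ℝ)⟩

instance {F G : Type*} [AddCommGroup F] [Module ℝ F] [Graded F] [AddCommGroup G] [Module ℝ G]
    [Graded G] : Graded (F × G) :=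
  ⟨fun n => (gr n : Seminorm ℝ F).comp (LinearMap.fst ℝ F G) ⊔
    (gr n : Seminorm ℝ G).comp (LinearMap.snd ℝ F G)⟩

/-- A graded Fréchet space: an increasing sequence of seminorms defines the topology, which is
Hausdorff and complete (being metrizable, it is enough to test completeness on sequences). -/
structure IsGradedFrechet (F : Type*) [AddCommGroup F] [Module ℝ F] [TopologicalSpace F]
    [Graded F] : Prop where
  mono : ∀ (n : ℕ) (f : F), gr n f ≤ gr (n + 1) f
  withSeminorms : WithSeminorms (Graded.gr : SeminormFamily ℝ F ℕ)
  hausdorff : T2Space F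
  complete : ∀ u : ℕ → F,
    (∀ (n : ℕ) (ε : ℝ), 0 < ε → ∃ N, ∀ i ≥ N, ∀ j ≥ N, gr n (u i - u j) < ε) →
      ∃ x : F, Filter.Tendsto u Filter.atTop (𝓝 x)

/-- The space `Σ(B)` of exponentially decreasing sequences in a normed space `B`. -/
def expSeq (B : Type*) [NormedAddCommGroup B] [NormedSpace ℝ B] : Submodule ℝ (ℕ → B) where
  carrier := {f | ∀ n : ℕ, Summable fun k : ℕ => Real.exp (n * k) * ‖f k‖}
  zero_mem' := fun n => by simp
  add_mem' := by
    intro f g hf hg n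
    refine Summable.of_nonneg_of_le (fun k => by positivity) (fun k => ?_) ((hf n).add (hg n))
    rw [← mul_add]
    exact mul_le_mul_of_nonneg_left (norm_add_le _ _) (Real.exp_pos _).le
  smul_mem' := by
    intro c f hf n
    refine ((hf n).mul_left ‖c‖).congr (fun k => ?_)
    simp only [Pi.smul_apply, norm_smul]
    ring

/-- The grading `‖f‖ₙ = ∑ₖ e^{nk} ‖fₖ‖` of `Σ(B)`. -/
instance (B : Type*) [NormedAddCommGroup B] [NormedSpace ℝ B] : Graded (expSeq B) where
  gr n := Seminorm.of (fun f => ∑' k : ℕ, Real.exp (n * k) * ‖f.1 k‖)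
    (by
      intro f g
      rw [← (f.2 n).tsum_add (g.2 n)]
      refine Summable.tsum_le_tsum (fun k => ?_) ((f + g).2 n) ((f.2 n).add (g.2 n))
      rw [← mul_add]
      exact mul_le_mul_of_nonneg_left (norm_add_le _ _) (Real.exp_pos _).le)
    (by
      intro c f
      rw [← tsum_mul_left]
      refine tsum_congr (fun k => ?_)
      simp only [Submodule.coe_smul, Pi.smul_apply, norm_smul]
      ring)

/-- A tame linear map between graded spaces. -/
def IsTameLinear {F G : Type*} [AddCommGroup F] [Module ℝ F] [Graded F] [AddCommGroup G]
    [Module ℝ G] [Graded G] (φ : F →ₗ[ℝ] G) : Prop :=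
  ∃ (r b : ℕ) (C : ℕ → ℝ), ∀ n ≥ b, ∀ f : F, gr n (φ f) ≤ C n * gr (n + r) f

/-- A tame Fréchet space: a graded Fréchet space which is a tame direct summand of `Σ(B)` for
some Banach space `B`. -/
def IsTameFrechet (F : Type u) [AddCommGroup F] [Module ℝ F] [TopologicalSpace F] [Graded F] :
    Prop :=
  IsGradedFrechet F ∧
    ∃ (B : Type u) (_ : NormedAddCommGroup B) (_ : NormedSpace ℝ B) (_ : CompleteSpace B)
      (φ : F →ₗ[ℝ] expSeq B) (ψ : expSeq B →ₗ[ℝ] F),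
      IsTameLinear φ ∧ IsTameLinear ψ ∧ ψ ∘ₗ φ = LinearMap.id

/-! ## Smooth and smooth tame maps -/

section Calculus

variable {F G : Type*} [AddCommGroup F] [Module ℝ F] [TopologicalSpace F]
  [AddCommGroup G] [Module ℝ G] [TopologicalSpace G]

/-- `y` is the derivative of `f` at `x` in the direction `h`. -/
def HasDirDeriv (f : F → G) (x h : F) (y : G) : Prop :=
  Filter.Tendsto (fun t : ℝ => t⁻¹ • (f (x + t • h) - f x)) (𝓝[≠] 0) (𝓝 y)

/-- `D` is the tower of iterated directional derivatives of `f` on the open set `U`: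
`D k x ![h₁, …, hₖ] = Dᵏf(x){h₁, …, hₖ}`, and each `Dᵏf` is jointly continuous. -/
structure IsDerivTower (f : F → G) (U : Set F) (D : ∀ k : ℕ, F → (Fin k → F) → G) : Prop where
  zero : ∀ x ∈ U, ∀ v, D 0 x v = f x
  succ : ∀ (k : ℕ), ∀ x ∈ U, ∀ (v : Fin k → F) (h : F),
    HasDirDeriv (fun y => D k y v) x h (D (k + 1) x (Fin.snoc (α := fun _ => F) v h))
  cont : ∀ k : ℕ, ContinuousOn (fun z : F × (Fin k → F) => D k z.1 z.2) (U ×ˢ Set.univ)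

/-- `f` is smooth on the open set `U`: all iterated directional derivatives exist and are
jointly continuous. -/
def SmoothOn (f : F → G) (U : Set F) : Prop := ∃ D, IsDerivTower f U D

/-- `f` is smooth tame on the open set `U`: it is smooth, and each `Dᵏf` satisfies, near every
point, a tame estimate `‖Dᵏf(x){h}‖ₙ ≤ C(n) (1 + ‖x‖ₙ₊ᵣ + ∑ ‖hᵢ‖ₙ₊ᵣ)` for all `n ≥ b`. -/
def SmoothTameOn [Graded F] [Graded G] (f : F → G) (U : Set F) : Prop :=
  ∃ D, IsDerivTower f U D ∧
    ∀ (k : ℕ), ∀ x₀ ∈ U, ∀ v₀ : Fin k → F, ∃ N ∈ 𝓝 (x₀, v₀), ∃ (r b : ℕ) (C : ℕ → ℝ),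
      ∀ n ≥ b, ∀ z ∈ N, z.1 ∈ U →
        gr n (D k z.1 z.2) ≤ C n * (1 + gr (n + r) z.1 + ∑ i, gr (n + r) (z.2 i))

end Calculus

/-! ## Tame Fréchet manifolds, metrics, connections and symmetric spaces -/

section Manifolds

variable (F M : Type*) [AddCommGroup F] [Module ℝ F] [TopologicalSpace F] [Graded F]
  [TopologicalSpace M] [ChartedSpace F M]

/-- A tame Fréchet manifold: Hausdorff, with charts in a tame Fréchet space and smooth tame
chart transition functions. -/
structure IsTameFrechetManifold : Prop where
  model : IsTameFrechet F
  hausdorff : T2Space M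
  transition : ∀ e ∈ atlas F M, ∀ e' ∈ atlas F M,
    SmoothTameOn (e.symm ≫ₕ e') (e.symm ≫ₕ e').source

variable {F M}

/-- The domain of the representative of `φ` in the charts `e`, `e'`. -/
def localDomain (e e' : OpenPartialHomeomorph M F) (φ : M → M) : Set F :=
  e.target ∩ e.symm ⁻¹' (φ ⁻¹' e'.source)

/-- The representative of `φ` in the charts `e`, `e'`. -/
def localRep (e e' : OpenPartialHomeomorph M F) (φ : M → M) : F → F :=
  fun x => e' (φ (e.symm x))

variable (F) in
/-- A smooth tame self-map of `M`. -/
def IsSmoothTame (φ : M → M) : Prop :=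
  Continuous φ ∧ ∀ e ∈ atlas F M, ∀ e' ∈ atlas F M,
    SmoothTameOn (localRep e e' φ) (localDomain e e' φ)

/-- A (weak, pseudo-Riemannian) metric `g`, given by its coordinate functions: `g e x h k` is the
value at the point with coordinates `x ∈ e.target` on the tangent vectors with coordinates
`h`, `k` in the chart `e`. -/
structure IsMetric (g : OpenPartialHomeomorph M F → F → F → F → ℝ) : Prop where
  bilinear : ∀ e ∈ atlas F M, ∀ x ∈ e.target, ∃ L : F →ₗ[ℝ] F →ₗ[ℝ] ℝ, ∀ h k, g e x h k = L h k
  symm : ∀ e ∈ atlas F M, ∀ x ∈ e.target, ∀ h k, g e x h k = g e x k h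
  nondegenerate : ∀ e ∈ atlas F M, ∀ x ∈ e.target, ∀ h, (∀ k, g e x h k = 0) → h = 0
  smooth : ∀ e ∈ atlas F M,
    SmoothOn (fun z : F × F × F => g e z.1 z.2.1 z.2.2) (e.target ×ˢ Set.univ)
  transition : ∀ e ∈ atlas F M, ∀ e' ∈ atlas F M, ∀ D,
    IsDerivTower (e.symm ≫ₕ e') (e.symm ≫ₕ e').source D →
      ∀ x ∈ (e.symm ≫ₕ e').source, ∀ h k,
        g e' ((e.symm ≫ₕ e') x) (D 1 x ![h]) (D 1 x ![k]) = g e x h k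

/-- A metric has Lorentzian signature if its index, the dimension of a maximal subspace on which
it is negative definite, is one at every point. -/
def IsLorentzian (g : OpenPartialHomeomorph M F → F → F → F → ℝ) : Prop :=
  ∀ e ∈ atlas F M, ∀ x ∈ e.target, (∃ h, g e x h h < 0) ∧
    ∀ W : Submodule ℝ F, (∀ h ∈ W, h ≠ 0 → g e x h h < 0) → Module.rank ℝ W ≤ 1

/-- `Γ` is a Levi-Civita connection of `g`: a symmetric connection on the tangent bundle, with
covariant derivative `DV/dt = V' - Γ(c){V, c'}` along curves `c`, compatible with `g`. -/
structure IsLeviCivita (g : OpenPartialHomeomorph M F → F → F → F → ℝ)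
    (Γ : OpenPartialHomeomorph M F → F → F → F → F) : Prop where
  bilinear : ∀ e ∈ atlas F M, ∀ x ∈ e.target, ∃ L : F →ₗ[ℝ] F →ₗ[ℝ] F, ∀ h k, Γ e x h k = L h k
  smooth : ∀ e ∈ atlas F M,
    SmoothTameOn (fun z : F × F × F => Γ e z.1 z.2.1 z.2.2) (e.target ×ˢ Set.univ)
  transition : ∀ e ∈ atlas F M, ∀ e' ∈ atlas F M, ∀ D,
    IsDerivTower (e.symm ≫ₕ e') (e.symm ≫ₕ e').source D →
      ∀ x ∈ (e.symm ≫ₕ e').source, ∀ h k,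
        Γ e' ((e.symm ≫ₕ e') x) (D 1 x ![h]) (D 1 x ![k]) = D 1 x ![Γ e x h k] + D 2 x ![h, k]
  symm : ∀ e ∈ atlas F M, ∀ x ∈ e.target, ∀ h k, Γ e x h k = Γ e x k h
  compatible : ∀ e ∈ atlas F M, ∀ (c V W : ℝ → F) (t : ℝ) (c' V' W' : F), c t ∈ e.target →
    HasDirDeriv c t 1 c' → HasDirDeriv V t 1 V' → HasDirDeriv W t 1 W' →
      HasDerivAt (fun s => g e (c s) (V s) (W s))
        (g e (c t) (V' - Γ e (c t) (V t) c') (W t) +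
          g e (c t) (V t) (W' - Γ e (c t) (W t) c')) t

/-- An isometry: a smooth tame diffeomorphism preserving the metric. -/
structure IsIsometry (g : OpenPartialHomeomorph M F → F → F → F → ℝ) (φ : Equiv.Perm M) :
    Prop where
  smooth : IsSmoothTame F φ
  smooth_symm : IsSmoothTame F φ.symm
  preserves : ∀ e ∈ atlas F M, ∀ e' ∈ atlas F M, ∀ D,
    IsDerivTower (localRep e e' φ) (localDomain e e' φ) D →
      ∀ x ∈ localDomain e e' φ, ∀ h k,
        g e' (localRep e e' φ x) (D 1 x ![h]) (D 1 x ![k]) = g e x h k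

/-- A tame Fréchet Lorentz symmetric space: a tame Fréchet manifold with a weak metric of
Lorentzian signature which has a Levi-Civita connection, such that every point is an isolated
fixed point of an involutive isometry. -/
structure IsLorentzSymmetricSpace (g : OpenPartialHomeomorph M F → F → F → F → ℝ) : Prop where
  manifold : IsTameFrechetManifold F M
  metric : IsMetric g
  lorentzian : IsLorentzian g
  leviCivita : ∃ Γ, IsLeviCivita g Γ
  symmetry : ∀ p : M, ∃ ρ : Equiv.Perm M, IsIsometry g ρ ∧ ρ * ρ = 1 ∧ ρ p = p ∧
    ∀ᶠ x in 𝓝 p, ρ x = x → x = p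

end Manifolds

/-! ## Holomorphic loops -/

/-- The annulus `e^{-m} ≤ |z| ≤ e^m`. -/
def annulus (m : ℕ) : Set ℂ := {z | Real.exp (-m) ≤ ‖z‖ ∧ ‖z‖ ≤ Real.exp m}

/-- The group `MT` of holomorphic loops `f : ℂ^* → T_ℂ = (ℂ^*)ⁿ` with `f(S¹) ⊆ T = (S¹)ⁿ`.
A map on `ℂ^*` is represented by its extension with the value `1` at the point `0`. -/
def MT (n : ℕ) : Set (ℂ → Fin n → ℂ) :=
  {f | f 0 = 1 ∧ DifferentiableOn ℂ f {0}ᶜ ∧ (∀ z j, f z j ≠ 0) ∧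
    ∀ z : ℂ, ‖z‖ = 1 → ∀ j, ‖f z j‖ = 1}

/-- The real vector space of holomorphic maps `η : ℂ^* → ℂⁿ` with `η(S¹) ⊆ ℝⁿ` and mean value
zero on `S¹`. A map on `ℂ^*` is represented by its extension with the value `0` at `0`. -/
def loopSubmodule (n : ℕ) : Submodule ℝ (ℂ → Fin n → ℂ) where
  carrier := {η | η 0 = 0 ∧ DifferentiableOn ℂ η {0}ᶜ ∧ (∀ z : ℂ, ‖z‖ = 1 → ∀ j, (η z j).im = 0) ∧
    ∫ θ in (0 : ℝ)..2 * Real.pi, η (Circle.exp θ) = 0}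
  zero_mem' := by
    refine ⟨rfl, differentiableOn_const 0, fun _ _ _ => rfl, by simp⟩
  add_mem' := by
    rintro f g ⟨f0, fd, fr, fm⟩ ⟨g0, gd, gr, gm⟩
    have key : ∀ h : ℂ → Fin n → ℂ, DifferentiableOn ℂ h {0}ᶜ →
        Continuous fun θ : ℝ => h (Circle.exp θ) := fun h hd =>
      hd.continuousOn.comp_continuous (continuous_subtype_val.comp Circle.exp.continuous)
        (fun θ => Circle.coe_ne_zero _)
    refine ⟨by simp [f0, g0], fd.add gd, fun z hz j => by simp [fr z hz j, gr z hz j], ?_⟩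
    simp only [Pi.add_apply]
    rw [intervalIntegral.integral_add ((key f fd).intervalIntegrable _ _)
      ((key g gd).intervalIntegrable _ _), fm, gm, add_zero]
  smul_mem' := by
    rintro c f ⟨f0, fd, fr, fm⟩
    refine ⟨by simp [f0], fd.const_smul c, fun z hz j => by simp [fr z hz j], ?_⟩
    simp only [Pi.smul_apply]
    rw [intervalIntegral.integral_smul, fm, smul_zero]

/-- The Fréchet space of real holomorphic loops in `ℂⁿ` with mean value zero. -/
def LoopSpace (n : ℕ) : Type := loopSubmodule n

namespace LoopSpace

variable {n : ℕ}

instance : AddCommGroup (LoopSpace n) := inferInstanceAs (AddCommGroup (loopSubmodule n))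

instance : Module ℝ (LoopSpace n) := inferInstanceAs (Module ℝ (loopSubmodule n))

instance : CoeFun (LoopSpace n) (fun _ => ℂ → Fin n → ℂ) := ⟨fun η => η.1⟩

@[ext] theorem ext {η ζ : LoopSpace n} (h : ∀ z, η z = ζ z) : η = ζ := Subtype.ext (funext h)

@[simp] theorem add_apply (η ζ : LoopSpace n) (z : ℂ) : (η + ζ) z = η z + ζ z := rfl

@[simp] theorem smul_apply (c : ℝ) (η : LoopSpace n) (z : ℂ) : (c • η) z = c • η z := rfl

@[simp] theorem zero_apply (z : ℂ) : (0 : LoopSpace n) z = 0 := rfl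

@[simp] theorem neg_apply (η : LoopSpace n) (z : ℂ) : (-η) z = -η z := rfl

theorem differentiableOn (η : LoopSpace n) : DifferentiableOn ℂ η {0}ᶜ := η.2.2.1

theorem isCompact_annulus (m : ℕ) : IsCompact (annulus m) := by
  refine (isCompact_closedBall (0 : ℂ) (Real.exp m)).of_isClosed_subset ?_ ?_
  · exact (isClosed_le continuous_const continuous_norm).inter
      (isClosed_le continuous_norm continuous_const)
  · intro z hz
    simpa using hz.2

theorem annulus_subset (m : ℕ) : annulus m ⊆ {0}ᶜ := by
  intro z hz h0
  have h1 := hz.1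
  rw [Set.mem_singleton_iff.1 h0, norm_zero] at h1
  exact absurd h1 (not_le.2 (Real.exp_pos _))

theorem bddAbove (η : LoopSpace n) (m : ℕ) :
    BddAbove (Set.range fun z : annulus m => ‖η z‖) := by
  have h := ((isCompact_annulus m).image_of_continuousOn
    ((η.differentiableOn.continuousOn.mono (annulus_subset m)).norm)).bddAbove
  rwa [Set.image_eq_range] at h

instance (m : ℕ) : Nonempty (annulus m) :=
  ⟨⟨1, by simp [annulus]⟩⟩

/-- The grading `‖η‖ₘ = sup {|η(z)| : e^{-m} ≤ |z| ≤ e^m}`. -/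
instance : Graded (LoopSpace n) where
  gr m := Seminorm.of (fun η => ⨆ z : annulus m, ‖η z‖)
    (fun η ζ => ciSup_le fun z => (norm_add_le (η z) (ζ z)).trans
      (add_le_add (le_ciSup (η.bddAbove m) z) (le_ciSup (ζ.bddAbove m) z)))
    (fun c η => by
      simp only [smul_apply, norm_smul]
      exact (Real.mul_iSup_of_nonneg (norm_nonneg c) _).symm)

/-- The Fréchet topology, defined by the grading. -/
instance : TopologicalSpace (LoopSpace n) :=
  SeminormFamily.moduleFilterBasis (Graded.gr : SeminormFamily ℝ (LoopSpace n) ℕ) |>.topology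

/-- The rotation `η ↦ η(w ·)`. -/
def rotate (w : Circle) (η : LoopSpace n) : LoopSpace n :=
  ⟨fun z => η (w * z), by
    obtain ⟨h0, hd, hr, hm⟩ := η.2
    refine ⟨by simpa using h0, ?_, fun z hz j => hr _ (by rw [norm_mul, hz, Circle.norm_coe, one_mul]) j, ?_⟩
    · refine hd.comp (differentiableOn_id.const_mul (w : ℂ)) ?_
      intro z hz
      simpa using hz
    · have hw : w = Circle.exp (Complex.arg w) := (Circle.exp_arg w).symm
      have h1 : ∀ θ : ℝ, η.1 (w * Circle.exp θ) =
          (fun θ : ℝ => η.1 (Circle.exp θ)) (θ + Complex.arg w) := by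
        intro θ
        simp only [Circle.exp_add, Circle.coe_mul]
        rw [Circle.exp_arg, mul_comm]
      have hper : Function.Periodic (fun θ : ℝ => η.1 (Circle.exp θ)) (2 * Real.pi) := by
        intro θ
        simp only [Circle.periodic_exp θ]
      simp only [h1]
      rw [intervalIntegral.integral_comp_add_right (fun θ : ℝ => η.1 (Circle.exp θ))]
      have h2 := hper.intervalIntegral_add_eq (Complex.arg w) 0
      rw [zero_add] at h2
      rw [zero_add, add_comm (2 * Real.pi), h2]
      exact hm⟩

@[simp] theorem rotate_apply (w : Circle) (η : LoopSpace n) (z : ℂ) : rotate w η z = η (w * z) :=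
  rfl

theorem rotate_add (w : Circle) (η ζ : LoopSpace n) :
    rotate w (η + ζ) = rotate w η + rotate w ζ := rfl

theorem rotate_rotate (w w' : Circle) (η : LoopSpace n) :
    rotate w (rotate w' η) = rotate (w * w') η := by
  ext z : 1
  simp only [rotate_apply, Circle.coe_mul]
  rw [mul_assoc, mul_left_comm]

theorem rotate_one (η : LoopSpace n) : rotate 1 η = η := by
  ext z : 1
  simp

end LoopSpace

/-! ## The group `\widehat{MT}` -/

section Group

variable {n : ℕ}

/-- The bilinear form `λᵀ q μ`. -/
def bil (q : Matrix (Fin n) (Fin n) ℤ) (l m : Fin n → ℤ) : ℤ := l ⬝ᵥ q.mulVec m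

/-- The product `∏ᵢ tᵢ ^ mᵢ`, i.e. the value at `t ∈ T` of the character of `T` with weight `m`. -/
def torusPow (t : Fin n → Circle) (m : Fin n → ℤ) : Circle := ∏ i, t i ^ m i

/-- The weight `⟨λ, ·⟩` in terms of the integral form `⟨λ, μ⟩ = λᵀ (q + qᵀ) μ`. -/
def weight (q : Matrix (Fin n) (Fin n) ℤ) (l : Fin n → ℤ) : Fin n → ℤ := (q + q.transpose).mulVec l

/-- The derivative `∂_θ η = i z η'(z)` at the point `z = e^{iθ}` of the unit circle. -/
def angularDeriv (η : LoopSpace n) (θ : ℝ) (j : Fin n) : ℝ :=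
  (Complex.I * Circle.exp θ * deriv (fun z => η z j) (Circle.exp θ)).re

/-- The cocycle `ω(η, ζ) = 1/2π ∫ ⟨η, ∂_θ ζ⟩ dθ`, where `⟨x, y⟩ = xᵀ (q + qᵀ) y`. -/
def omega (q : Matrix (Fin n) (Fin n) ℤ) (η ζ : LoopSpace n) : ℝ :=
  (2 * Real.pi)⁻¹ * ∫ θ in (0 : ℝ)..2 * Real.pi,
    ∑ i, ∑ j, ((q i j + q j i : ℤ) : ℝ) * (η (Circle.exp θ) i).re * angularDeriv ζ θ j

theorem bil_add_left (q : Matrix (Fin n) (Fin n) ℤ) (l l' m : Fin n → ℤ) :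
    bil q (l + l') m = bil q l m + bil q l' m := add_dotProduct _ _ _

theorem bil_add_right (q : Matrix (Fin n) (Fin n) ℤ) (l m m' : Fin n → ℤ) :
    bil q l (m + m') = bil q l m + bil q l m' := by
  simp [bil, Matrix.mulVec_add, dotProduct_add]

theorem weight_add (q : Matrix (Fin n) (Fin n) ℤ) (l l' : Fin n → ℤ) :
    weight q (l + l') = weight q l + weight q l' := Matrix.mulVec_add _ _ _

theorem dotProduct_weight (q : Matrix (Fin n) (Fin n) ℤ) (l m : Fin n → ℤ) :
    m ⬝ᵥ weight q l = bil q m l + bil q l m := by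
  rw [weight, Matrix.add_mulVec, dotProduct_add, bil, bil, Matrix.mulVec_transpose,
    dotProduct_comm m (Matrix.vecMul l q), Matrix.dotProduct_mulVec l]

theorem torusPow_mul (t s : Fin n → Circle) (m : Fin n → ℤ) :
    torusPow (fun i => t i * s i) m = torusPow t m * torusPow s m := by
  simp [torusPow, mul_zpow, Finset.prod_mul_distrib]

theorem torusPow_add (t : Fin n → Circle) (m m' : Fin n → ℤ) :
    torusPow t (m + m') = torusPow t m * torusPow t m' := by
  simp [torusPow, zpow_add, Finset.prod_mul_distrib]

theorem torusPow_zpow (w : Circle) (l m : Fin n → ℤ) :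
    torusPow (fun i => w ^ l i) m = w ^ (l ⬝ᵥ m) := by
  have h : ∀ s : Finset (Fin n), ∏ i ∈ s, w ^ (l i * m i) = w ^ (∑ i ∈ s, l i * m i) := by
    intro s
    induction s using Finset.induction_on with
    | empty => simp
    | insert a s ha ih => rw [Finset.prod_insert ha, Finset.sum_insert ha, zpow_add, ih]
  simp only [torusPow, ← zpow_mul, dotProduct]
  exact h _

theorem differentiableAt_loop (η : LoopSpace n) (j : Fin n) {z : ℂ} (hz : z ≠ 0) :
    DifferentiableAt ℂ (fun z => η z j) z :=
  (differentiableAt_pi.1 ((η.differentiableOn z hz).differentiableAt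
    (isOpen_compl_singleton.mem_nhds hz))) j

theorem angularDeriv_add (η ζ : LoopSpace n) (θ : ℝ) (j : Fin n) :
    angularDeriv (η + ζ) θ j = angularDeriv η θ j + angularDeriv ζ θ j := by
  have h0 : ((Circle.exp θ : Circle) : ℂ) ≠ 0 := Circle.coe_ne_zero _
  have h : deriv (fun z => (η + ζ) z j) (Circle.exp θ) =
      deriv (fun z => η z j) (Circle.exp θ) + deriv (fun z => ζ z j) (Circle.exp θ) := by
    simpa using deriv_fun_add (differentiableAt_loop η j h0) (differentiableAt_loop ζ j h0)
  rw [angularDeriv, h, mul_add, Complex.add_re]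
  rfl

theorem angularDeriv_rotate (w : Circle) (η : LoopSpace n) (θ : ℝ) (j : Fin n) :
    angularDeriv (η.rotate w) θ j = angularDeriv η (θ + Complex.arg w) j := by
  have h : deriv (fun z => η.rotate w z j) (Circle.exp θ) =
      w * deriv (fun z => η z j) (w * Circle.exp θ) := by
    simpa using deriv_comp_mul_left (w : ℂ) (fun z => η z j) (Circle.exp θ : ℂ)
  have h1 : ((Circle.exp (θ + Complex.arg w) : Circle) : ℂ) = w * Circle.exp θ := by
    rw [Circle.exp_add, Circle.exp_arg, mul_comm, Circle.coe_mul]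
  rw [angularDeriv, angularDeriv, h, h1]
  congr 1
  ring

theorem continuous_loop (η : LoopSpace n) (i : Fin n) :
    Continuous fun θ : ℝ => (η (Circle.exp θ) i).re := by
  have h : Continuous fun θ : ℝ => η (Circle.exp θ) :=
    η.differentiableOn.continuousOn.comp_continuous
      (continuous_subtype_val.comp Circle.exp.continuous) (fun θ => Circle.coe_ne_zero _)
  exact Complex.continuous_re.comp ((continuous_apply i).comp h)

theorem continuous_angularDeriv (η : LoopSpace n) (j : Fin n) :
    Continuous fun θ : ℝ => angularDeriv η θ j := by
  have hd : DifferentiableOn ℂ (fun z => η z j) {0}ᶜ := fun z hz =>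
    (differentiableAt_loop η j hz).differentiableWithinAt
  have h1 : Continuous fun θ : ℝ => ((Circle.exp θ : Circle) : ℂ) :=
    continuous_subtype_val.comp Circle.exp.continuous
  have h : Continuous fun θ : ℝ => deriv (fun z => η z j) (Circle.exp θ) :=
    (hd.deriv isOpen_compl_singleton).continuousOn.comp_continuous h1
      (fun θ => Circle.coe_ne_zero _)
  exact Complex.continuous_re.comp ((continuous_const.mul h1).mul h)

theorem intervalIntegrable_omega (q : Matrix (Fin n) (Fin n) ℤ) (η ζ : LoopSpace n) (a b : ℝ) :
    IntervalIntegrable (fun θ => ∑ i, ∑ j, ((q i j + q j i : ℤ) : ℝ) *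
      (η (Circle.exp θ) i).re * angularDeriv ζ θ j) MeasureTheory.volume a b := by
  refine Continuous.intervalIntegrable ?_ _ _
  refine continuous_finsetSum _ fun i _ => continuous_finsetSum _ fun j _ => ?_
  exact (continuous_const.mul (continuous_loop η i)).mul (continuous_angularDeriv ζ j)

theorem omega_add_left (q : Matrix (Fin n) (Fin n) ℤ) (η η' ζ : LoopSpace n) :
    omega q (η + η') ζ = omega q η ζ + omega q η' ζ := by
  rw [omega, omega, omega, ← mul_add, ← intervalIntegral.integral_add
    (intervalIntegrable_omega q η ζ _ _) (intervalIntegrable_omega q η' ζ _ _)]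
  simp only [LoopSpace.add_apply, Pi.add_apply, Complex.add_re, mul_add, add_mul,
    Finset.sum_add_distrib]

theorem omega_add_right (q : Matrix (Fin n) (Fin n) ℤ) (η ζ ζ' : LoopSpace n) :
    omega q η (ζ + ζ') = omega q η ζ + omega q η ζ' := by
  rw [omega, omega, omega, ← mul_add, ← intervalIntegral.integral_add
    (intervalIntegrable_omega q η ζ _ _) (intervalIntegrable_omega q η ζ' _ _)]
  simp only [angularDeriv_add, mul_add, Finset.sum_add_distrib]

theorem omega_rotate (q : Matrix (Fin n) (Fin n) ℤ) (w : Circle) (η ζ : LoopSpace n) :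
    omega q (η.rotate w) (ζ.rotate w) = omega q η ζ := by
  set f : ℝ → ℝ := fun θ => ∑ i, ∑ j, ((q i j + q j i : ℤ) : ℝ) *
      (η (Circle.exp θ) i).re * angularDeriv ζ θ j with hf
  have h1 : ∀ θ : ℝ, ((Circle.exp (θ + Complex.arg w) : Circle) : ℂ) = w * Circle.exp θ := by
    intro θ
    rw [Circle.exp_add, Circle.exp_arg, mul_comm, Circle.coe_mul]
  have h2 : omega q (η.rotate w) (ζ.rotate w) = (2 * Real.pi)⁻¹ *
      ∫ θ in (0 : ℝ)..2 * Real.pi, f (θ + Complex.arg w) := by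
    simp only [omega, hf, angularDeriv_rotate, LoopSpace.rotate_apply, h1]
  have hper : Function.Periodic f (2 * Real.pi) := by
    intro θ
    simp only [hf, angularDeriv, Circle.periodic_exp θ]
  have h3 := hper.intervalIntegral_add_eq (Complex.arg w) 0
  rw [zero_add] at h3
  rw [h2, intervalIntegral.integral_comp_add_right f, zero_add, add_comm (2 * Real.pi), h3]
  rfl

theorem omega_zero_left (q : Matrix (Fin n) (Fin n) ℤ) (ζ : LoopSpace n) : omega q 0 ζ = 0 := by
  simpa using omega_add_left q 0 0 ζ

theorem omega_zero_right (q : Matrix (Fin n) (Fin n) ℤ) (η : LoopSpace n) : omega q η 0 = 0 := by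
  simpa using omega_add_right q η 0 0

/-- The Kac-Moody group `\widehat{MT}` of the torus `T = (S¹)ⁿ`, for the scalar product
`xᵀ (q + qᵀ) y` on its Lie algebra `ℝⁿ`. The element `(λ, t, η, u, w)` consists of the loop
`f(z) = t z^λ exp(i η(z))` in `MT`, the coordinate `u` in the central circle and the coordinate `w`
in the circle of rotations. -/
@[ext] structure HatMT (q : Matrix (Fin n) (Fin n) ℤ) : Type where
  wind : Fin n → ℤ
  tor : Fin n → Circle
  loop : LoopSpace n
  cen : Circle
  rot : Circle

variable {q : Matrix (Fin n) (Fin n) ℤ}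

/-- The cocycle of the central extension on `MT`, evaluated on two elements given by
`(λ, t, η)` and `(μ, s, ζ)`:
`s ^ {-⟨λ, ·⟩} · (-1)^{λᵀ q μ} · exp(i ω(η, ζ) / 2)`. -/
def cocycle (q : Matrix (Fin n) (Fin n) ℤ) (l : Fin n → ℤ) (η : LoopSpace n) (m : Fin n → ℤ)
    (s : Fin n → Circle) (ζ : LoopSpace n) : Circle :=
  torusPow s (-weight q l) * Circle.exp Real.pi ^ bil q l m * Circle.exp (omega q η ζ / 2)

namespace HatMT

/-- The product of the semidirect product of the central extension of `MT` by `S¹`, with the circle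
`S¹` acting by rotations `f ↦ f(w ·)`. A rotation takes `(μ, s, ζ, v)` to
`(μ, s w^μ, ζ(w ·), v w^{-⟨μ, μ⟩/2})`. -/
instance : Mul (HatMT q) where
  mul x y :=
    { wind := x.wind + y.wind
      tor := fun i => x.tor i * (y.tor i * x.rot ^ y.wind i)
      loop := x.loop + y.loop.rotate x.rot
      cen := x.cen * (y.cen * x.rot ^ (-bil q y.wind y.wind)) *
        cocycle q x.wind x.loop y.wind (fun i => y.tor i * x.rot ^ y.wind i) (y.loop.rotate x.rot)
      rot := x.rot * y.rot }

instance : One (HatMT q) := ⟨⟨0, 1, 0, 1, 1⟩⟩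

instance : Inv (HatMT q) where
  inv x :=
    { wind := -x.wind
      tor := fun i => (x.tor i)⁻¹ * x.rot ^ x.wind i
      loop := -x.loop.rotate x.rot⁻¹
      cen := (x.cen * x.rot⁻¹ ^ (-bil q x.wind x.wind) *
        cocycle q (-x.wind) (-x.loop.rotate x.rot⁻¹) x.wind
          (fun i => x.tor i * x.rot⁻¹ ^ x.wind i) (x.loop.rotate x.rot⁻¹))⁻¹
      rot := x.rot⁻¹ }

theorem wind_mul (x y : HatMT q) : (x * y).wind = x.wind + y.wind := rfl

theorem tor_mul (x y : HatMT q) :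
    (x * y).tor = fun i => x.tor i * (y.tor i * x.rot ^ y.wind i) := rfl

theorem loop_mul (x y : HatMT q) : (x * y).loop = x.loop + y.loop.rotate x.rot := rfl

theorem cen_mul (x y : HatMT q) : (x * y).cen = x.cen * (y.cen * x.rot ^ (-bil q y.wind y.wind)) *
    cocycle q x.wind x.loop y.wind (fun i => y.tor i * x.rot ^ y.wind i) (y.loop.rotate x.rot) := rfl

theorem rot_mul (x y : HatMT q) : (x * y).rot = x.rot * y.rot := rfl

instance : Group (HatMT q) := Group.ofLeftAxioms
  (by
    intro x y z
    ext1
    · exact add_assoc _ _ _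
    · funext i
      simp only [tor_mul, rot_mul, wind_mul, Pi.add_apply, mul_zpow, zpow_add]
      apply Additive.ofMul.injective
      simp only [ofMul_mul]
      abel
    · simp only [loop_mul, rot_mul, LoopSpace.rotate_add, LoopSpace.rotate_rotate, add_assoc]
    · simp only [cen_mul, tor_mul, rot_mul, wind_mul, loop_mul, cocycle, LoopSpace.rotate_add,
        LoopSpace.rotate_rotate, torusPow_mul, torusPow_zpow, weight_add, neg_add, torusPow_add,
        dotProduct_neg, dotProduct_weight, bil_add_left, bil_add_right,
        omega_add_left, omega_add_right, add_dotProduct]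
      have h := omega_rotate q x.rot y.loop (z.loop.rotate y.rot)
      rw [LoopSpace.rotate_rotate] at h
      rw [h]
      simp only [add_div, Circle.exp_add]
      apply Additive.ofMul.injective
      simp only [ofMul_mul, ofMul_zpow]
      module
    · exact mul_assoc _ _ _)
  (by
    intro x
    have hw : weight q 0 = 0 := Matrix.mulVec_zero _
    have hb : bil q 0 x.wind = 0 := zero_dotProduct _
    ext1
    · exact zero_add _
    · funext i
      change (1 : Circle) * (x.tor i * 1 ^ x.wind i) = x.tor i
      simp
    · change (0 : LoopSpace n) + x.loop.rotate 1 = x.loop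
      rw [LoopSpace.rotate_one, zero_add]
    · change (1 : Circle) * (x.cen * 1 ^ (-bil q x.wind x.wind)) *
        cocycle q 0 0 x.wind (fun i => x.tor i * 1 ^ x.wind i) (x.loop.rotate 1) = x.cen
      simp [cocycle, hw, hb, omega_zero_left, torusPow]
    · exact one_mul _)
  (by
    intro x
    ext1
    · exact neg_add_cancel _
    · funext i
      change (x.tor i)⁻¹ * x.rot ^ x.wind i * (x.tor i * x.rot⁻¹ ^ x.wind i) = 1
      rw [inv_zpow]
      apply Additive.ofMul.injective
      simp only [ofMul_mul, ofMul_inv, ofMul_one]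
      abel
    · exact neg_add_cancel _
    · change (x.cen * x.rot⁻¹ ^ (-bil q x.wind x.wind) *
        cocycle q (-x.wind) (-x.loop.rotate x.rot⁻¹) x.wind
          (fun i => x.tor i * x.rot⁻¹ ^ x.wind i) (x.loop.rotate x.rot⁻¹))⁻¹ *
        (x.cen * x.rot⁻¹ ^ (-bil q x.wind x.wind)) *
        cocycle q (-x.wind) (-x.loop.rotate x.rot⁻¹) x.wind
          (fun i => x.tor i * x.rot⁻¹ ^ x.wind i) (x.loop.rotate x.rot⁻¹) = 1
      rw [mul_assoc, inv_mul_cancel]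
    · exact inv_mul_cancel _)

/-- The loop `f(z) = t z^λ exp(i η(z))` over which an element of `\widehat{MT}` lies. -/
def toLoop (x : HatMT q) : ℂ → Fin n → ℂ := fun z =>
  if z = 0 then 1 else fun j => x.tor j * z ^ x.wind j * Complex.exp (Complex.I * x.loop z j)

/-- The element of the central circle with coordinate `u`. -/
def central (u : Circle) : HatMT q := ⟨0, 1, 0, u, 1⟩

/-- `\widehat{MT}` as a product. -/
def equivProd : HatMT q ≃ (Fin n → ℤ) × (Fin n → Circle) × LoopSpace n × Circle × Circle where
  toFun x := (x.wind, x.tor, x.loop, x.cen, x.rot)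
  invFun y := ⟨y.1, y.2.1, y.2.2.1, y.2.2.2.1, y.2.2.2.2⟩
  left_inv _ := rfl
  right_inv _ := rfl

/-- The product topology. -/
instance : TopologicalSpace (HatMT q) := TopologicalSpace.induced equivProd inferInstance

/-- `\widehat{MT}` as a topological product. -/
def homeoProd : HatMT q ≃ₜ (Fin n → ℤ) × (Fin n → Circle) × LoopSpace n × Circle × Circle :=
  equivProd.toHomeomorphOfIsInducing ⟨rfl⟩

end HatMT

/-! ## The manifold structure of `\widehat{MT}` -/

/-- The model space of `\widehat{MT}`: a tangent vector `(k, η, a, b)` consists of the constant loop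
`k`, the loop `η` with mean value zero, and the coefficients of the central direction and of the
rotations. -/
abbrev Model (n : ℕ) : Type := (Fin n → ℝ) × LoopSpace n × ℝ × ℝ

/-- The angle coordinate on `S¹` centred at `c`. -/
def angleChart (c : Circle) : OpenPartialHomeomorph Circle ℝ where
  toFun z := Complex.arg ((z / c : Circle) : ℂ)
  invFun θ := c * Circle.exp θ
  source := {z | ((z / c : Circle) : ℂ) ∈ Complex.slitPlane}
  target := Set.Ioo (-Real.pi) Real.pi
  map_source' z hz := ⟨Complex.neg_pi_lt_arg _,
    lt_of_le_of_ne (Complex.arg_le_pi _) (Complex.slitPlane_arg_ne_pi hz)⟩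
  map_target' θ hθ := by
    have h : (c * Circle.exp θ) / c = Circle.exp θ := by rw [mul_comm, mul_div_cancel_right]
    rw [Set.mem_ofPred_eq, h, Complex.mem_slitPlane_iff_arg, Circle.arg_exp hθ.1 hθ.2.le]
    exact ⟨hθ.2.ne, Circle.coe_ne_zero _⟩
  left_inv' z _ := by rw [Circle.exp_arg, mul_div_cancel]
  right_inv' θ hθ := by
    have h : (c * Circle.exp θ) / c = Circle.exp θ := by rw [mul_comm, mul_div_cancel_right]
    rw [h, Circle.arg_exp hθ.1 hθ.2.le]
  open_source := Complex.isOpen_slitPlane.preimage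
    (continuous_subtype_val.comp (continuous_div_right' c))
  open_target := isOpen_Ioo
  continuousOn_toFun := Complex.continuousOn_arg.comp
    (continuous_subtype_val.comp (continuous_div_right' c)).continuousOn
    (fun _ hz => hz)
  continuousOn_invFun := (continuous_const.mul Circle.exp.continuous).continuousOn

/-- The projection of the open subset `{a} × X` of `A × X` to `X`, for a discrete space `A`. -/
def sliceChart {A X : Type*} [TopologicalSpace A] [DiscreteTopology A] [TopologicalSpace X]
    (a : A) : OpenPartialHomeomorph (A × X) X where
  toFun y := y.2
  invFun x := (a, x)
  source := {a} ×ˢ Set.univ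
  target := Set.univ
  map_source' _ _ := trivial
  map_target' _ _ := ⟨rfl, trivial⟩
  left_inv' _ hy := Prod.ext hy.1.symm rfl
  right_inv' _ _ := rfl
  open_source := (isOpen_discrete _).prod isOpen_univ
  open_target := isOpen_univ
  continuousOn_toFun := continuous_snd.continuousOn
  continuousOn_invFun := (continuous_const.prodMk continuous_id).continuousOn

/-- The chart `(λ, t, η, u, w) ↦ (angles of t, η, angle of u, angle of w)` centred at `x`, where the
angles are measured from the corresponding coordinates of `x` and `λ` is fixed. -/
def hatChart (x : HatMT q) : OpenPartialHomeomorph (HatMT q) (Model n) :=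
  (HatMT.homeoProd.toOpenPartialHomeomorph ≫ₕ sliceChart x.wind) ≫ₕ
    (OpenPartialHomeomorph.pi fun i => angleChart (x.tor i)).prod
      ((OpenPartialHomeomorph.refl (LoopSpace n)).prod
        ((angleChart x.cen).prod (angleChart x.rot)))

theorem mem_angleChart_source (c : Circle) : c ∈ (angleChart c).source := by
  simp [angleChart]

instance : ChartedSpace (Model n) (HatMT q) where
  atlas := Set.range hatChart
  chartAt := hatChart
  mem_chart_source x := by
    simp [hatChart, mem_angleChart_source, HatMT.homeoProd, HatMT.equivProd, sliceChart]
  chart_mem_atlas x := ⟨x, rfl⟩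

/-! ## The Kac-Moody algebra and the metric -/

/-- The loop algebra `L(ℂⁿ)` of the Abelian Lie algebra `ℂⁿ`: the holomorphic maps `ℂ^* → ℂⁿ`,
represented by their extensions with the value `0` at `0`. -/
def complexLoops (n : ℕ) : Submodule ℂ (ℂ → Fin n → ℂ) where
  carrier := {f | f 0 = 0 ∧ DifferentiableOn ℂ f {0}ᶜ}
  zero_mem' := ⟨rfl, differentiableOn_const 0⟩
  add_mem' := fun hf hg => ⟨by simp [hf.1, hg.1], hf.2.add hg.2⟩
  smul_mem' := fun c f hf => ⟨by simp [hf.1], hf.2.const_smul c⟩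

/-- The complex geometric affine Kac-Moody algebra `L(ℂⁿ) ⊕ ℂ c ⊕ ℂ d`. -/
abbrev KMAlgebra (n : ℕ) : Type := complexLoops n × ℂ × ℂ

/-- The derivation `f ↦ i z f'(z)` of the loop algebra. -/
def loopDerivation (f : complexLoops n) : complexLoops n :=
  ⟨fun z => (Complex.I * z) • deriv f.1 z, by simp,
    ((differentiableOn_id.const_mul Complex.I).smul (f.2.2.deriv isOpen_compl_singleton))⟩

/-- The cocycle `Res ⟨f, g'⟩`, for the complex bilinear form with matrix `B`. -/
def residueCocycle (B : Matrix (Fin n) (Fin n) ℝ) (f g : complexLoops n) : ℂ :=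
  (2 * Real.pi * Complex.I)⁻¹ *
    ∮ z in C(0, 1), ∑ i, ∑ j, (B i j : ℂ) * f.1 z i * deriv g.1 z j

/-- The Lie bracket of the Kac-Moody algebra: `[d, f] = i z f'`, `[f, g] = Res ⟨f, g'⟩ c`, and `c`
is central. -/
def kmBracket (B : Matrix (Fin n) (Fin n) ℝ) (X Y : KMAlgebra n) : KMAlgebra n :=
  (X.2.2 • loopDerivation Y.1 - Y.2.2 • loopDerivation X.1, residueCocycle B X.1 Y.1, 0)

/-- The matrix `p (q + qᵀ)`. -/
def gram (p : ℝ) (q : Matrix (Fin n) (Fin n) ℤ) : Matrix (Fin n) (Fin n) ℝ :=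
  fun i j => p * (q i j + q j i)

/-- The embedding `(k, η, a, b) ↦ i (k + η) + i p a c + b d` of the tangent space of `\widehat{MT}`
in the complex Kac-Moody algebra. Its image is the real form of compact type, consisting of the
loops with `f(S¹) ⊆ i ℝⁿ`, the imaginary multiples of `c` and the real multiples of `d`. -/
def toKMAlgebra (p : ℝ) (X : Model n) : KMAlgebra n :=
  (⟨fun z => if z = 0 then 0 else Complex.I • ((fun j => (X.1 j : ℂ)) + X.2.1 z), by simp, by
    have h : DifferentiableOn ℂ
        (fun z => Complex.I • ((fun j => (X.1 j : ℂ)) + X.2.1 z)) {0}ᶜ :=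
      ((differentiableOn_const _).add X.2.1.differentiableOn).const_smul Complex.I
    exact h.congr fun z hz => if_neg hz⟩,
    Complex.I * (p * X.2.2.1), X.2.2.2)

/-- The Lorentzian scalar product on the real form of the Kac-Moody algebra:
`⟨u, v⟩ = 1/2π ∫ ⟨u(t), v(t)⟩ dt` on loops, for the scalar product on `ℝⁿ` with matrix `p (q + qᵀ)`;
the real generator `c` (with coefficient `p a`) and `d` are isotropic, orthogonal to all loops, and
`⟨c, d⟩ = -1`. -/
def kmForm (p : ℝ) (q : Matrix (Fin n) (Fin n) ℤ) (X Y : Model n) : ℝ :=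
  (2 * Real.pi)⁻¹ * (∫ θ in (0 : ℝ)..2 * Real.pi, ∑ i, ∑ j, gram p q i j *
      (X.1 i + (X.2.1 (Circle.exp θ) i).re) * (Y.1 j + (Y.2.1 (Circle.exp θ) j).re)) -
    (p * X.2.2.1) * Y.2.2.2 - X.2.2.2 * (p * Y.2.2.1)

/-- The derivative at `x` of the left translation by `x⁻¹`, in the coordinates `(k, η, a, b)`. -/
def leftTrivialization (x : HatMT q) (X : Model n) : Model n :=
  (X.1, X.2.1.rotate x.rot⁻¹,
    X.2.2.1 + ∑ i, (weight q x.wind i : ℝ) * X.1 i - omega q x.loop X.2.1 / 2, X.2.2.2)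

/-- The metric of `\widehat{MT}`, obtained from the scalar product on the Kac-Moody algebra by left
translation. (The charts of the atlas differ by locally constant translations, so that the
coordinates of tangent vectors do not depend on the chart.) -/
def hatMetric (p : ℝ) (q : Matrix (Fin n) (Fin n) ℤ) (e : OpenPartialHomeomorph (HatMT q) (Model n))
    (x X Y : Model n) : ℝ :=
  kmForm p q (leftTrivialization (e.symm x) X) (leftTrivialization (e.symm x) Y)

/-- `\widehat{MT}` is a central extension by `S¹` of the semidirect product `MT ⋊ S¹` of the
full group of holomorphic loops with the group of rotations. -/
structure IsLoopGroupExtension (q : Matrix (Fin n) (Fin n) ℤ) : Prop where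
  mem : ∀ x : HatMT q, x.toLoop ∈ MT n
  mul_loop : ∀ (x y : HatMT q) (z : ℂ), (x * y).toLoop z = x.toLoop z * y.toLoop (x.rot * z)
  mul_rot : ∀ x y : HatMT q, (x * y).rot = x.rot * y.rot
  surjective : ∀ f ∈ MT n, ∀ w : Circle, ∃ x : HatMT q, x.toLoop = f ∧ x.rot = w
  kernel : ∀ x : HatMT q, (x.toLoop = 1 ∧ x.rot = 1) ↔ ∃ u, x = HatMT.central u
  central_mul : ∀ u v : Circle,
    (HatMT.central (u * v) : HatMT q) = HatMT.central u * HatMT.central v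
  central_comm : ∀ (u : Circle) (x : HatMT q), HatMT.central u * x = x * HatMT.central u

/-- The Lie algebra of `\widehat{MT}` is the real form of compact type of the geometric affine
Kac-Moody algebra of the Abelian Lie algebra `ℂⁿ`: the derivative of the adjoint representation is
the bracket. -/
def HasEuclideanKMAlgebra (p : ℝ) (q : Matrix (Fin n) (Fin n) ℤ) : Prop :=
  ∃ Ad : HatMT q → Model n → Model n,
    (∀ x Y, HasDirDeriv
      (fun s : ℝ => chartAt (Model n) (1 : HatMT q)
        (x * (chartAt (Model n) (1 : HatMT q)).symm (s • Y) * x⁻¹)) 0 1 (Ad x Y)) ∧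
    ∀ X Y, ∃ Z,
      HasDirDeriv (fun s : ℝ => Ad ((chartAt (Model n) (1 : HatMT q)).symm (s • X)) Y) 0 1 Z ∧
      toKMAlgebra p Z = kmBracket (gram p q) (toKMAlgebra p X) (toKMAlgebra p Y)

end Group

/-! ## Kac-Moody symmetric spaces of Euclidean type -/

/-- A Kac-Moody symmetric space of Euclidean type: a tame Fréchet Lorentz symmetric space whose
isometry group contains a transitive subgroup `K` isomorphic to an affine geometric Kac-Moody group
of Euclidean type, acting continuously, such that the isotropy groups of the points in `K` are
`0`-dimensional, namely trivial. -/
structure IsEuclideanKacMoodySymmetricSpace {F M : Type*} [AddCommGroup F] [Module ℝ F]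
    [TopologicalSpace F] [Graded F] [TopologicalSpace M] [ChartedSpace F M]
    (g : OpenPartialHomeomorph M F → F → F → F → ℝ) : Prop where
  symmetricSpace : IsLorentzSymmetricSpace g
  kacMoodyGroup : ∃ (n : ℕ) (q : Matrix (Fin n) (Fin n) ℤ) (K : Subgroup (Equiv.Perm M))
    (Φ : HatMT q ≃* K), (gram 1 q).PosDef ∧ (∀ φ ∈ K, IsIsometry g φ) ∧
      (Continuous fun z : HatMT q × M => (Φ z.1 : Equiv.Perm M) z.2) ∧
      (∀ x y : M, ∃ φ ∈ K, φ x = y) ∧ ∀ (x : M), ∀ φ ∈ K, φ x = x → φ = 1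

/-! ## Simple compact Lie groups and maximal tori -/

section LieGroups

variable (d : ℕ) (G : Type*) [TopologicalSpace G] [ChartedSpace (EuclideanSpace ℝ (Fin d)) G]
  [Group G] [LieGroup (𝓡 d) ∞ G]

instance : LieGroup (𝓡 d) (minSmoothness ℝ 3) G := by
  rw [minSmoothness_of_isRCLikeNormedField]
  infer_instance

/-- The Lie algebra of `G` is simple. -/
def IsSimpleLieGroup : Prop := LieAlgebra.IsSimple ℝ (GroupLieAlgebra (𝓡 d) G)

variable {G} {n : ℕ}

/-- `φ` identifies `(S¹)ⁿ` with a torus in `G`: it is an injective smooth homomorphism. -/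
structure IsTorusParam (φ : (Fin n → Circle) →* G) : Prop where
  injective : Function.Injective φ
  smooth : ContMDiff 𝓘(ℝ, Fin n → ℝ) (𝓡 d) ∞ fun x : Fin n → ℝ => φ fun i => Circle.exp (x i)

/-- `T` is a torus in `G`. -/
def IsTorus (T : Subgroup G) : Prop :=
  ∃ (n : ℕ) (φ : (Fin n → Circle) →* G), IsTorusParam d φ ∧ φ.range = T

/-- `T` is a maximal torus in `G`. -/
def IsMaximalTorus (T : Subgroup G) : Prop := Maximal (IsTorus d) T

/-- The velocity at the identity of the `j`-th circle of the torus parametrized by `φ`. -/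
def torusVector (φ : (Fin n → Circle) →* G) (j : Fin n) : GroupLieAlgebra (𝓡 d) G :=
  (mfderiv 𝓘(ℝ, ℝ) (𝓡 d) (fun s : ℝ => φ (Pi.mulSingle j (Circle.exp s))) 0 (1 : ℝ) :
    EuclideanSpace ℝ (Fin d))

/-- The Lie algebra of the torus parametrized by `φ`. -/
def torusLieAlgebra (φ : (Fin n → Circle) →* G) : Submodule ℝ (GroupLieAlgebra (𝓡 d) G) :=
  Submodule.span ℝ (Set.range (torusVector d φ))

/-- The basis of the lattice of cocharacters in the Lie algebra of the torus. -/
def cocharacter (φ : (Fin n → Circle) →* G) (j : Fin n) : torusLieAlgebra d φ :=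
  ⟨torusVector d φ j, Submodule.subset_span ⟨j, rfl⟩⟩

end LieGroups

end

end KacMoody

open scoped Manifold ContDiff Topology ComplexConjugate

set_option linter.unusedSectionVars false

namespace KacMoody

noncomputable section

/-! ### Calculus of iterated directional derivatives -/

section

/-! ## Directional derivatives -/

section DirDeriv

variable {F G H E : Type*} [AddCommGroup F] [Module ℝ F] [TopologicalSpace F]
  [AddCommGroup G] [Module ℝ G] [TopologicalSpace G]
  [AddCommGroup H] [Module ℝ H] [TopologicalSpace H]
  [AddCommGroup E] [Module ℝ E] [TopologicalSpace E]

/-! Every component of `HatMT q` is covered by the linear space `Model n` through `expLift`, and all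
inverse charts are translates of this covering map. Transition maps are therefore locally
translations, coordinates of tangent vectors do not depend on the chart, and a self-map can be
studied through its lift to `Model n` (`IsTameLift`, `isIsometry_of_lift`).

In these angle coordinates a left translation is affine, since the loop of the right factor is
rotated by a fixed angle (`mul_expLift`). The inversion is affine up to the term `(η, b) ↦
-η(e^{-ib} ·)`. Each derivative of this term costs one application of `∂_θ`; Cauchy's estimate
bounds `∂_θ` with the loss of one degree (`gr_deriv_le`), and rotations preserve all seminorms
(`gr_rotate`). So the rotation action, the only source of nonlinearity, is smooth tame
(`isTameTower_rotate`).

The metric is left invariant by construction (`hatForm_translation`). It is also invariant under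
inversion (`hatForm_inversion`), because the scalar product on the Lie algebra is invariant under
the adjoint action; in coordinates this comes down to integration by parts on the circle, that is,
to the antisymmetry of `ω`. Hence `x ↦ a x⁻¹ a` is an involutive isometry, and it fixes no point
near `a` except `a`, because near the identity `x² = 1` forces `x = 1`. The index is one: the form
is positive definite on the constant and mean-zero loops, and the directions `c`, `d` add a
hyperbolic plane. A weakly nondegenerate metric need not have a Levi-Civita connection, but here the
coefficients depend on the point only through the winding number and the linear expression `ω(η,
·)`, so Christoffel symbols can be written down and checked (`isLeviCivita_hatGamma`). The left
regular representation supplies the transitive group with trivial isotropy.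

The model space is tame because a loop is determined by its Laurent coefficients of positive index,
which decay exponentially: reality on the circle gives the negative ones and the mean value
condition kills the zeroth (`LoopSpace.isTameFrechet`).

That the group extends the full loop group rests on logarithms: a nowhere vanishing holomorphic
function on `ℂ^*` is pulled back by `exp` to `ℂ`, where it has a logarithm whose increment over one
period is the winding number (`exists_loop_coordinates`). The bracket is found by differentiating
the conjugation twice (`hasDirDeriv_conj`, `hasDirDeriv_adjoint`).

Positivity of `q + qᵀ` is inherited from the scalar product on the Lie algebra of the torus, once
the cocharacters are known to be linearly independent (`IsTorusParam.injective_torusDifferential`,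
`posDef_gram`). -/

theorem HasDirDeriv.unique [T2Space G] {f : F → G} {x h : F} {y z : G} (hy : HasDirDeriv f x h y)
    (hz : HasDirDeriv f x h z) : y = z :=
  tendsto_nhds_unique hy hz

theorem tendsto_add_smul [ContinuousAdd F] [ContinuousSMul ℝ F] (x h : F) :
    Filter.Tendsto (fun t : ℝ => x + t • h) (𝓝 0) (𝓝 x) := by
  have h1 : Continuous fun t : ℝ => x + t • h := by fun_prop
  simpa using h1.tendsto 0

theorem HasDirDeriv.congr_of_eventuallyEq [ContinuousAdd F] [ContinuousSMul ℝ F] {f g : F → G}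
    {x h : F} {y : G} (hf : HasDirDeriv f x h y) (hfg : f =ᶠ[𝓝 x] g) : HasDirDeriv g x h y := by
  refine Filter.Tendsto.congr' ?_ hf
  have h1 := (tendsto_add_smul x h).eventually hfg
  filter_upwards [h1.filter_mono nhdsWithin_le_nhds] with t ht
  rw [ht, hfg.eq_of_nhds]

theorem hasDirDeriv_const (c : G) (x h : F) : HasDirDeriv (fun _ => c) x h 0 := by
  simp [HasDirDeriv, tendsto_const_nhds]

theorem HasDirDeriv.add [ContinuousAdd G] {f g : F → G} {x h : F} {y z : G}
    (hf : HasDirDeriv f x h y) (hg : HasDirDeriv g x h z) :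
    HasDirDeriv (fun x => f x + g x) x h (y + z) := by
  refine (Filter.Tendsto.add hf hg).congr fun t => ?_
  dsimp only
  rw [← smul_add]
  congr 1
  abel

theorem HasDirDeriv.prodMk {f : F → G} {g : F → H} {x h : F} {y : G} {z : H}
    (hf : HasDirDeriv f x h y) (hg : HasDirDeriv g x h z) :
    HasDirDeriv (fun x => (f x, g x)) x h (y, z) :=
  Filter.Tendsto.prodMk_nhds hf hg

theorem HasDirDeriv.clm_comp (A : G →L[ℝ] H) {f : F → G} {x h : F} {y : G}
    (hf : HasDirDeriv f x h y) : HasDirDeriv (fun x => A (f x)) x h (A y) := by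
  refine ((A.continuous.tendsto y).comp hf).congr fun t => ?_
  simp

theorem hasDirDeriv_clm (A : F →L[ℝ] G) (x h : F) : HasDirDeriv (fun x => A x) x h (A h) := by
  refine Filter.Tendsto.congr' ?_ tendsto_const_nhds
  filter_upwards [self_mem_nhdsWithin] with t ht
  simp [smul_smul, inv_mul_cancel₀ (show t ≠ 0 from ht)]

theorem HasDirDeriv.comp_affine (A : F →ₗ[ℝ] G) (c : G) {f : G → H} {x h : F} {y : H}
    (hf : HasDirDeriv f (A x + c) (A h) y) : HasDirDeriv (fun x => f (A x + c)) x h y := by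
  refine Filter.Tendsto.congr (fun t => ?_) hf
  dsimp only
  rw [map_add, map_smul, add_right_comm]

theorem HasDirDeriv.tendsto [ContinuousAdd G] [ContinuousSMul ℝ G] {f : F → G} {x h : F} {y : G}
    (hf : HasDirDeriv f x h y) :
    Filter.Tendsto (fun t : ℝ => f (x + t • h)) (𝓝[≠] 0) (𝓝 (f x)) := by
  have h1 : Filter.Tendsto (fun t : ℝ => t) (𝓝[≠] 0) (𝓝 0) := nhdsWithin_le_nhds
  have h2 := (h1.smul hf).add_const (f x)
  rw [zero_smul, zero_add] at h2
  refine h2.congr' ?_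
  filter_upwards [self_mem_nhdsWithin] with t ht
  rw [smul_smul, mul_inv_cancel₀ (show t ≠ 0 from ht), one_smul, sub_add_cancel]

/-- Product rule, from the splitting `β(Δf, g) + β(f, Δg)` with the first `g` taken at the moving
point. In the absence of norms, joint continuity of `β` is what lets both terms pass to the limit.
-/
theorem HasDirDeriv.bilin [ContinuousAdd G] [ContinuousSMul ℝ G] [ContinuousAdd H]
    [ContinuousSMul ℝ H] [ContinuousAdd E] (β : G →ₗ[ℝ] H →ₗ[ℝ] E)
    (hβ : Continuous fun z : G × H => β z.1 z.2) {f : F → G} {g : F → H} {x h : F} {y : G} {z : H}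
    (hf : HasDirDeriv f x h y) (hg : HasDirDeriv g x h z) :
    HasDirDeriv (fun x => β (f x) (g x)) x h (β y (g x) + β (f x) z) := by
  have h1 := (hβ.tendsto (y, g x)).comp (hf.prodMk_nhds hg.tendsto)
  have h2 := (hβ.tendsto (f x, z)).comp
    ((tendsto_const_nhds (x := f x) (f := 𝓝[≠] (0 : ℝ))).prodMk_nhds hg)
  refine (h1.add h2).congr fun t => ?_
  simp only [Function.comp_apply, map_smul, LinearMap.smul_apply, map_sub, LinearMap.sub_apply]
  rw [← smul_add]
  congr 1
  abel

theorem hasDirDeriv_real_iff {f : ℝ → ℝ} {t y : ℝ} : HasDirDeriv f t 1 y ↔ HasDerivAt f y t := by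
  rw [hasDerivAt_iff_tendsto_slope_zero]
  simp [HasDirDeriv]

end DirDeriv

/-! ## Towers of derivatives -/

section Tower

variable {F G H E : Type*} [AddCommGroup F] [Module ℝ F] [TopologicalSpace F]
  [AddCommGroup G] [Module ℝ G] [TopologicalSpace G]
  [AddCommGroup H] [Module ℝ H] [TopologicalSpace H]
  [AddCommGroup E] [Module ℝ E] [TopologicalSpace E]

theorem IsDerivTower.hasDirDeriv_one [ContinuousAdd F] [ContinuousSMul ℝ F] {f : F → G} {U : Set F}
    {D : ∀ k : ℕ, F → (Fin k → F) → G} (hD : IsDerivTower f U D) (hU : IsOpen U) {x : F}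
    (hx : x ∈ U) (h : F) : HasDirDeriv f x h (D 1 x ![h]) := by
  have h1 := hD.succ 0 x hx ![] h
  have h2 : (Fin.snoc (α := fun _ => F) ![] h) = ![h] := by
    funext i; fin_cases i; rfl
  rw [h2] at h1
  refine h1.congr_of_eventuallyEq ?_
  filter_upwards [hU.mem_nhds hx] with y hy using hD.zero y hy _

theorem IsDerivTower.hasDirDeriv_two {f : F → G} {U : Set F}
    {D : ∀ k : ℕ, F → (Fin k → F) → G} (hD : IsDerivTower f U D) {x : F}
    (hx : x ∈ U) (h k : F) : HasDirDeriv (fun y => D 1 y ![h]) x k (D 2 x ![h, k]) := by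
  have h1 := hD.succ 1 x hx ![h] k
  have h2 : (Fin.snoc (α := fun _ => F) ![h] k) = ![h, k] := by
    funext i; fin_cases i <;> rfl
  rwa [h2] at h1

/-- The conditions on metrics, connections and isometries quantify over all towers of derivatives.
Uniqueness of limits in a Hausdorff target reduces them to any derivative that has been computed. -/
theorem IsDerivTower.one_eq [ContinuousAdd F] [ContinuousSMul ℝ F] [T2Space G] {f : F → G}
    {U : Set F} {D : ∀ k : ℕ, F → (Fin k → F) → G} (hD : IsDerivTower f U D)
    (hU : IsOpen U) {x : F} (hx : x ∈ U) {h : F} {y : G} (hy : HasDirDeriv f x h y) :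
    D 1 x ![h] = y :=
  (hD.hasDirDeriv_one hU hx h).unique hy

theorem IsDerivTower.mono {f : F → G} {U V : Set F} {D : ∀ k : ℕ, F → (Fin k → F) → G}
    (hD : IsDerivTower f U D) (hV : V ⊆ U) : IsDerivTower f V D where
  zero x hx := hD.zero x (hV hx)
  succ k x hx := hD.succ k x (hV hx)
  cont k := (hD.cont k).mono (Set.prod_mono hV subset_rfl)

/-- The derivatives of the affine map `x ↦ A x + c`. -/
def affineTower (A : F →L[ℝ] G) (c : G) : ∀ k : ℕ, F → (Fin k → F) → G
  | 0, x, _ => A x + c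
  | 1, _, v => A (v 0)
  | _ + 2, _, _ => 0

theorem isDerivTower_affine [ContinuousAdd G] (A : F →L[ℝ] G) (c : G) (U : Set F) :
    IsDerivTower (fun x => A x + c) U (affineTower A c) where
  zero _ _ _ := rfl
  succ
    | 0, x, _, v, h => by
      have h1 := (hasDirDeriv_clm A x h).add (hasDirDeriv_const c x h)
      rw [add_zero] at h1
      exact h1
    | 1, x, _, v, h => hasDirDeriv_const _ x h
    | k + 2, x, _, v, h => hasDirDeriv_const _ x h
  cont
    | 0 => by
      simp only [affineTower]
      fun_prop
    | 1 => by
      simp only [affineTower]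
      fun_prop
    | k + 2 => continuousOn_const

theorem IsDerivTower.add [ContinuousAdd G] {f g : F → G} {U : Set F}
    {D D' : ∀ k : ℕ, F → (Fin k → F) → G} (hD : IsDerivTower f U D) (hD' : IsDerivTower g U D') :
    IsDerivTower (fun x => f x + g x) U (fun k x v => D k x v + D' k x v) where
  zero x hx v := by rw [hD.zero x hx, hD'.zero x hx]
  succ k x hx v h := (hD.succ k x hx v h).add (hD'.succ k x hx v h)
  cont k := (hD.cont k).add (hD'.cont k)

theorem IsDerivTower.prodMk {f : F → G} {g : F → H} {U : Set F}
    {D : ∀ k : ℕ, F → (Fin k → F) → G} {D' : ∀ k : ℕ, F → (Fin k → F) → H}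
    (hD : IsDerivTower f U D) (hD' : IsDerivTower g U D') :
    IsDerivTower (fun x => (f x, g x)) U (fun k x v => (D k x v, D' k x v)) where
  zero x hx v := by rw [hD.zero x hx, hD'.zero x hx]
  succ k x hx v h := (hD.succ k x hx v h).prodMk (hD'.succ k x hx v h)
  cont k := (hD.cont k).prodMk (hD'.cont k)

theorem IsDerivTower.clm_comp (A : G →L[ℝ] H) {f : F → G} {U : Set F}
    {D : ∀ k : ℕ, F → (Fin k → F) → G} (hD : IsDerivTower f U D) :
    IsDerivTower (fun x => A (f x)) U (fun k x v => A (D k x v)) where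
  zero x hx v := by rw [hD.zero x hx]
  succ k x hx v h := (hD.succ k x hx v h).clm_comp A
  cont k := A.continuous.comp_continuousOn (hD.cont k)

theorem IsDerivTower.comp_affine [ContinuousAdd G] (A : F →L[ℝ] G) (c : G) {f : G → H} {U : Set G}
    {D : ∀ k : ℕ, G → (Fin k → G) → H} (hD : IsDerivTower f U D) :
    IsDerivTower (fun x => f (A x + c)) ((fun x => A x + c) ⁻¹' U)
      (fun k x v => D k (A x + c) (fun i => A (v i))) where
  zero x hx v := hD.zero _ hx _
  succ k x hx v h := by
    have h1 := hD.succ k (A x + c) hx (fun i => A (v i)) (A h)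
    have h2 : Fin.snoc (α := fun _ => G) (fun i => A (v i)) (A h) =
        fun i => A (Fin.snoc (α := fun _ => F) v h i) := by
      funext i
      refine Fin.lastCases ?_ (fun j => ?_) i <;> simp
    rw [h2] at h1
    exact h1.comp_affine (A : F →ₗ[ℝ] G) c
  cont k := by
    have h1 : Continuous fun z : F × (Fin k → F) =>
        ((A z.1 + c, fun i => A (z.2 i)) : G × (Fin k → G)) := by fun_prop
    exact (hD.cont k).comp h1.continuousOn fun z hz => ⟨hz.1, trivial⟩

/-- The derivatives of a map which differs from a map with derivatives `D` by a locally constant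
map. -/
def shiftTower (f : F → G) (D : ∀ k : ℕ, F → (Fin k → F) → G) : ∀ k : ℕ, F → (Fin k → F) → G
  | 0, x, _ => f x
  | k + 1, x, v => D (k + 1) x v

/-- A chart representative of a map and its lift to angle coordinates differ by a choice of angles,
which is locally constant. Only the zeroth entry of the tower has to be changed. -/
theorem IsDerivTower.of_locallyConst_sub [ContinuousAdd F] [ContinuousSMul ℝ F]
    [IsTopologicalAddGroup G] {f g : F → G} {U : Set F} (hU : IsOpen U)
    {D : ∀ k : ℕ, F → (Fin k → F) → G}
    (hD : IsDerivTower g U D) (hfg : ∀ x ∈ U, ∀ᶠ y in 𝓝 x, f y - g y = f x - g x) :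
    IsDerivTower f U (shiftTower f D) where
  zero _ _ _ := rfl
  succ
    | 0, x, hx, v, h => by
      have h1 : HasDirDeriv g x h (D 1 x (Fin.snoc v h)) :=
        (hD.succ 0 x hx v h).congr_of_eventuallyEq (by
          filter_upwards [hU.mem_nhds hx] with y hy using hD.zero y hy _)
      have h2 := (h1.add (hasDirDeriv_const (f x - g x) x h)).congr_of_eventuallyEq (g := f) (by
        filter_upwards [hfg x hx] with y hy
        rw [← hy]
        abel)
      rwa [add_zero] at h2
    | k + 1, x, hx, v, h => hD.succ (k + 1) x hx v h
  cont
    | 0 => by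
      have hg : ContinuousOn g U := by
        have h1 := (hD.cont 0).comp (s := U)
          (f := fun x => ((x, fun i => i.elim0) : F × (Fin 0 → F)))
          (by fun_prop) (fun x hx => ⟨hx, trivial⟩)
        exact h1.congr fun x hx => (hD.zero x hx _).symm
      have hf : ContinuousOn f U := by
        intro x hx
        refine ContinuousAt.continuousWithinAt ?_
        have h1 : ContinuousAt (fun y => g y + (f x - g x)) x :=
          ((hg x hx).continuousAt (hU.mem_nhds hx)).add continuousAt_const
        refine h1.congr ?_
        filter_upwards [hfg x hx] with y hy
        rw [← hy]
        abel
      exact hf.comp continuousOn_fst fun z hz => hz.1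
    | k + 1 => hD.cont (k + 1)

end Tower

/-! ## The Leibniz rule -/

section Leibniz

variable {F G H E : Type*} [AddCommGroup F] [Module ℝ F] [TopologicalSpace F]
  [AddCommGroup G] [Module ℝ G] [TopologicalSpace G]
  [AddCommGroup H] [Module ℝ H] [TopologicalSpace H]
  [AddCommGroup E] [Module ℝ E] [TopologicalSpace E]

/-- The derivative of `β (D a x u) (D' b x w)` in the directions `v`. -/
def leibniz (β : G →ₗ[ℝ] H →ₗ[ℝ] E) (D : ∀ k : ℕ, F → (Fin k → F) → G)
    (D' : ∀ k : ℕ, F → (Fin k → F) → H) (x : F) :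
    ∀ (k : ℕ) {a b : ℕ}, (Fin a → F) → (Fin b → F) → (Fin k → F) → E
  | 0, _, _, u, w, _ => β (D _ x u) (D' _ x w)
  | k + 1, _, _, u, w, v =>
    leibniz β D D' x k (Fin.snoc (α := fun _ => F) u (v 0)) w (Fin.tail v) +
      leibniz β D D' x k u (Fin.snoc (α := fun _ => F) w (v 0)) (Fin.tail v)

theorem tail_snoc {k : ℕ} (v : Fin (k + 1) → F) (h : F) :
    Fin.tail (Fin.snoc (α := fun _ => F) v h : Fin (k + 2) → F) =
      Fin.snoc (α := fun _ => F) (Fin.tail v) h := by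
  funext i
  refine Fin.lastCases ?_ (fun j => ?_) i
  · simp [Fin.tail, Fin.succ_last]
  · rw [Fin.tail, Fin.succ_castSucc, Fin.snoc_castSucc, Fin.snoc_castSucc]
    rfl

theorem snoc_zero' {k : ℕ} (v : Fin (k + 1) → F) (h : F) :
    (Fin.snoc (α := fun _ => F) v h : Fin (k + 2) → F) 0 = v 0 :=
  Fin.snoc_castSucc (α := fun _ => F) h v 0

variable [ContinuousAdd G] [ContinuousSMul ℝ G] [ContinuousAdd H] [ContinuousSMul ℝ H]
  [ContinuousAdd E]

/-- The tuples `u` and `w` hold the directions already assigned to the two factors. Since `leibniz`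
consumes `v` from the front, a direction appended at the end of `v` is distributed last, after the
induction has reached a plain product, where the product rule applies. -/
theorem hasDirDeriv_leibniz (β : G →ₗ[ℝ] H →ₗ[ℝ] E) (hβ : Continuous fun z : G × H => β z.1 z.2)
    {f : F → G} {g : F → H} {U : Set F} {D : ∀ k : ℕ, F → (Fin k → F) → G}
    {D' : ∀ k : ℕ, F → (Fin k → F) → H} (hD : IsDerivTower f U D) (hD' : IsDerivTower g U D')
    {x : F} (hx : x ∈ U) (h : F) (k : ℕ) : ∀ {a b : ℕ} (u : Fin a → F) (w : Fin b → F)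
    (v : Fin k → F), HasDirDeriv (fun y => leibniz β D D' y k u w v) x h
      (leibniz β D D' x (k + 1) u w (Fin.snoc (α := fun _ => F) v h)) := by
  induction k with
  | zero =>
    intro a b u w v
    exact (hD.succ a x hx u h).bilin β hβ (hD'.succ b x hx w h)
  | succ k ih =>
    intro a b u w v
    rw [leibniz, snoc_zero', tail_snoc]
    exact (ih _ _ _).add (ih _ _ _)

theorem continuousOn_leibniz (β : G →ₗ[ℝ] H →ₗ[ℝ] E) (hβ : Continuous fun z : G × H => β z.1 z.2)
    {f : F → G} {g : F → H} {U : Set F} {D : ∀ k : ℕ, F → (Fin k → F) → G}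
    {D' : ∀ k : ℕ, F → (Fin k → F) → H} (hD : IsDerivTower f U D) (hD' : IsDerivTower g U D')
    (k : ℕ) : ∀ {a b : ℕ}, ContinuousOn (fun z : F × (Fin a → F) × (Fin b → F) × (Fin k → F) =>
      leibniz β D D' z.1 k z.2.1 z.2.2.1 z.2.2.2) (U ×ˢ Set.univ) := by
  induction k with
  | zero =>
    intro a b
    have h1 := (hD.cont a).comp (s := U ×ˢ Set.univ)
      (f := fun z : F × (Fin a → F) × (Fin b → F) × (Fin 0 → F) => (z.1, z.2.1))
      (by fun_prop) (fun z hz => ⟨hz.1, trivial⟩)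
    have h2 := (hD'.cont b).comp (s := U ×ˢ Set.univ)
      (f := fun z : F × (Fin a → F) × (Fin b → F) × (Fin 0 → F) => (z.1, z.2.2.1))
      (by fun_prop) (fun z hz => ⟨hz.1, trivial⟩)
    exact hβ.comp_continuousOn (h1.prodMk h2)
  | succ k ih =>
    intro a b
    have ht : Continuous fun v : Fin (k + 1) → F => (Fin.tail v : Fin k → F) :=
      continuous_pi fun i => continuous_apply _
    have hs : ∀ c : ℕ, Continuous fun z : (Fin c → F) × F =>
        (Fin.snoc (α := fun _ => F) z.1 z.2 : Fin (c + 1) → F) := fun c => by fun_prop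
    refine ContinuousOn.add ?_ ?_
    · exact (ih (a := a + 1) (b := b)).comp (s := U ×ˢ Set.univ)
        (f := fun z : F × (Fin a → F) × (Fin b → F) × (Fin (k + 1) → F) =>
          (z.1, Fin.snoc (α := fun _ => F) z.2.1 (z.2.2.2 0), z.2.2.1, Fin.tail z.2.2.2))
        (Continuous.continuousOn (by
          refine continuous_fst.prodMk (((hs a).comp (by fun_prop :
            Continuous fun z : F × (Fin a → F) × (Fin b → F) × (Fin (k + 1) → F) =>
              (z.2.1, z.2.2.2 0))).prodMk ((by fun_prop : Continuous _).prodMk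
                (ht.comp (by fun_prop)))))) (fun z hz => ⟨hz.1, trivial⟩)
    · exact (ih (a := a) (b := b + 1)).comp (s := U ×ˢ Set.univ)
        (f := fun z : F × (Fin a → F) × (Fin b → F) × (Fin (k + 1) → F) =>
          (z.1, z.2.1, Fin.snoc (α := fun _ => F) z.2.2.1 (z.2.2.2 0), Fin.tail z.2.2.2))
        (Continuous.continuousOn (by
          refine continuous_fst.prodMk ((by fun_prop : Continuous _).prodMk
            (((hs b).comp (by fun_prop :
            Continuous fun z : F × (Fin a → F) × (Fin b → F) × (Fin (k + 1) → F) =>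
              (z.2.2.1, z.2.2.2 0))).prodMk (ht.comp (by fun_prop))))))
        (fun z hz => ⟨hz.1, trivial⟩)

theorem IsDerivTower.bilin (β : G →ₗ[ℝ] H →ₗ[ℝ] E) (hβ : Continuous fun z : G × H => β z.1 z.2)
    {f : F → G} {g : F → H} {U : Set F} {D : ∀ k : ℕ, F → (Fin k → F) → G}
    {D' : ∀ k : ℕ, F → (Fin k → F) → H} (hD : IsDerivTower f U D) (hD' : IsDerivTower g U D') :
    IsDerivTower (fun x => β (f x) (g x)) U (fun k x v => leibniz β D D' x k ![] ![] v) where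
  zero x hx v := by rw [leibniz, hD.zero x hx, hD'.zero x hx]
  succ k x hx v h := hasDirDeriv_leibniz β hβ hD hD' hx h k _ _ v
  cont k := (continuousOn_leibniz β hβ hD hD' k (a := 0) (b := 0)).comp
    (f := fun z : F × (Fin k → F) => (z.1, ![], ![], z.2)) (by fun_prop)
    (fun z hz => ⟨hz.1, trivial⟩)

end Leibniz

section SmoothOn

variable {F G H E : Type*} [AddCommGroup F] [Module ℝ F] [TopologicalSpace F]
  [AddCommGroup G] [Module ℝ G] [TopologicalSpace G]
  [AddCommGroup H] [Module ℝ H] [TopologicalSpace H]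
  [AddCommGroup E] [Module ℝ E] [TopologicalSpace E]

theorem smoothOn_clm [ContinuousAdd G] (A : F →L[ℝ] G) (U : Set F) :
    SmoothOn (fun x => A x) U := by
  have h : SmoothOn (fun x => A x + 0) U := ⟨_, isDerivTower_affine A 0 U⟩
  simpa only [add_zero] using h

theorem smoothOn_const [ContinuousAdd G] (c : G) (U : Set F) :
    SmoothOn (fun _ => c) U := by
  have h : SmoothOn (fun x : F => (0 : F →L[ℝ] G) x + c) U := ⟨_, isDerivTower_affine 0 c U⟩
  simpa only [zero_apply, zero_add] using h

theorem SmoothOn.add [ContinuousAdd G] {f g : F → G} {U : Set F} (hf : SmoothOn f U)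
    (hg : SmoothOn g U) : SmoothOn (fun x => f x + g x) U :=
  let ⟨_, hD⟩ := hf
  let ⟨_, hD'⟩ := hg
  ⟨_, hD.add hD'⟩

theorem SmoothOn.clm_comp (A : G →L[ℝ] H) {f : F → G} {U : Set F} (hf : SmoothOn f U) :
    SmoothOn (fun x => A (f x)) U :=
  let ⟨_, hD⟩ := hf
  ⟨_, hD.clm_comp A⟩

theorem SmoothOn.bilin [ContinuousAdd G] [ContinuousSMul ℝ G] [ContinuousAdd H]
    [ContinuousSMul ℝ H] [ContinuousAdd E] (β : G →ₗ[ℝ] H →ₗ[ℝ] E)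
    (hβ : Continuous fun z : G × H => β z.1 z.2) {f : F → G} {g : F → H} {U : Set F}
    (hf : SmoothOn f U) (hg : SmoothOn g U) : SmoothOn (fun x => β (f x) (g x)) U :=
  let ⟨_, hD⟩ := hf
  let ⟨_, hD'⟩ := hg
  ⟨_, hD.bilin β hβ hD'⟩

theorem SmoothOn.mul {f g : F → ℝ} {U : Set F} (hf : SmoothOn f U) (hg : SmoothOn g U) :
    SmoothOn (fun x => f x * g x) U :=
  hf.bilin (LinearMap.mul ℝ ℝ) (by simpa using continuous_mul) hg

end SmoothOn

end

/-! ### Tame estimates and towers of derivatives that satisfy them -/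

section

/-! ## Tame estimates -/

section TameEstimates

/-- The seminorms of the grading increase. -/
class MonoGraded (F : Type*) [AddCommGroup F] [Module ℝ F] [Graded F] : Prop where
  mono : ∀ (n : ℕ) (f : F), gr n f ≤ gr (n + 1) f

theorem gr_mono {F : Type*} [AddCommGroup F] [Module ℝ F] [Graded F] [MonoGraded F] {m n : ℕ}
    (h : m ≤ n) (f : F) : gr m f ≤ gr n f :=
  monotone_nat_of_le_succ (f := fun n => gr n f) (fun n => MonoGraded.mono n f) h

theorem gr_real (n : ℕ) (x : ℝ) : gr n x = |x| := rfl

theorem gr_pi {d : ℕ} (n : ℕ) (x : Fin d → ℝ) : gr n x = ‖x‖ := rfl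

theorem gr_nonneg {F : Type*} [AddCommGroup F] [Module ℝ F] [Graded F] (n : ℕ) (f : F) :
    0 ≤ gr n f := apply_nonneg _ _

instance : MonoGraded ℝ := ⟨fun _ _ => le_rfl⟩

instance (d : ℕ) : MonoGraded (Fin d → ℝ) := ⟨fun _ _ => le_rfl⟩

instance {F G : Type*} [AddCommGroup F] [Module ℝ F] [Graded F] [AddCommGroup G]
    [Module ℝ G] [Graded G] [MonoGraded F] [MonoGraded G] : MonoGraded (F × G) :=
  ⟨fun n x => max_le_max (MonoGraded.mono n x.1) (MonoGraded.mono n x.2)⟩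

theorem isTameLinear_of_forall {F G : Type*} [AddCommGroup F] [Module ℝ F] [Graded F]
    [AddCommGroup G] [Module ℝ G] [Graded G] {A : F →ₗ[ℝ] G} (r : ℕ) (C : ℕ → ℝ)
    (h : ∀ n f, gr n (A f) ≤ C n * gr (n + r) f) : IsTameLinear A :=
  ⟨r, 0, C, fun n _ f => h n f⟩

variable {F G H Z Z' : Type*} [AddCommGroup F] [Module ℝ F] [Graded F] [MonoGraded F]
  [AddCommGroup G] [Module ℝ G] [Graded G] [MonoGraded G]
  [AddCommGroup H] [Module ℝ H] [Graded H] [MonoGraded H]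

/-- Below the base degree `b` there is no estimate, but the seminorms increase, so the estimate at
`max n b` serves for `n`. -/
theorem IsTameLinear.exists_le {A : F →ₗ[ℝ] G} (hA : IsTameLinear A) (n : ℕ) :
    ∃ (m : ℕ) (C : ℝ), 0 ≤ C ∧ ∀ f, gr n (A f) ≤ C * gr m f := by
  obtain ⟨r, b, C, h⟩ := hA
  refine ⟨max n b + r, |C (max n b)|, abs_nonneg _, fun f => ?_⟩
  exact (gr_mono (le_max_left n b) _).trans ((h _ (le_max_right n b) f).trans
    (mul_le_mul_of_nonneg_right (le_abs_self _) (gr_nonneg _ _)))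

theorem IsTameLinear.exists_nonneg {A : F →ₗ[ℝ] G} (hA : IsTameLinear A) :
    ∃ (r b : ℕ) (C : ℕ → ℝ), (∀ n, 0 ≤ C n) ∧ ∀ n ≥ b, ∀ f, gr n (A f) ≤ C n * gr (n + r) f := by
  obtain ⟨r, b, C, h⟩ := hA
  exact ⟨r, b, fun n => |C n|, fun n => abs_nonneg _, fun n hn f => (h n hn f).trans
    (mul_le_mul_of_nonneg_right (le_abs_self _) (gr_nonneg _ _))⟩

theorem IsTameLinear.comp {B : G →ₗ[ℝ] H} {A : F →ₗ[ℝ] G} (hB : IsTameLinear B)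
    (hA : IsTameLinear A) : IsTameLinear (B ∘ₗ A) := by
  obtain ⟨r, b, C, hC, h⟩ := hA.exists_nonneg
  obtain ⟨r', b', C', hC', h'⟩ := hB.exists_nonneg
  refine ⟨r' + r, max b b', fun n => C' n * C (n + r'), fun n hn f => ?_⟩
  rw [mul_assoc, ← add_assoc]
  exact (h' n ((le_max_right _ _).trans hn) _).trans (mul_le_mul_of_nonneg_left
    (h _ (((le_max_left _ _).trans hn).trans (Nat.le_add_right _ _)) f) (hC' n))

theorem IsTameLinear.prod {A : F →ₗ[ℝ] G} {B : F →ₗ[ℝ] H} (hA : IsTameLinear A)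
    (hB : IsTameLinear B) : IsTameLinear (A.prod B) := by
  obtain ⟨r, b, C, hC, h⟩ := hA.exists_nonneg
  obtain ⟨r', b', C', hC', h'⟩ := hB.exists_nonneg
  refine ⟨max r r', max b b', fun n => max (C n) (C' n), fun n hn f => max_le ?_ ?_⟩
  · exact (h n ((le_max_left _ _).trans hn) f).trans (mul_le_mul (le_max_left _ _)
      (gr_mono (Nat.add_le_add_left (le_max_left _ _) n) f) (gr_nonneg _ _)
      ((hC n).trans (le_max_left _ _)))
  · exact (h' n ((le_max_right _ _).trans hn) f).trans (mul_le_mul (le_max_right _ _)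
      (gr_mono (Nat.add_le_add_left (le_max_right _ _) n) f) (gr_nonneg _ _)
      ((hC' n).trans (le_max_right _ _)))

theorem IsTameLinear.add {A B : F →ₗ[ℝ] G} (hA : IsTameLinear A)
    (hB : IsTameLinear B) : IsTameLinear (A + B) := by
  obtain ⟨r, b, C, hC, h⟩ := hA.exists_nonneg
  obtain ⟨r', b', C', hC', h'⟩ := hB.exists_nonneg
  refine ⟨max r r', max b b', fun n => C n + C' n, fun n hn f => ?_⟩
  rw [LinearMap.add_apply, add_mul]
  refine (map_add_le_add _ _ _).trans (add_le_add ?_ ?_)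
  · exact (h n ((le_max_left _ _).trans hn) f).trans (mul_le_mul_of_nonneg_left
      (gr_mono (Nat.add_le_add_left (le_max_left _ _) n) f) (hC n))
  · exact (h' n ((le_max_right _ _).trans hn) f).trans (mul_le_mul_of_nonneg_left
      (gr_mono (Nat.add_le_add_left (le_max_right _ _) n) f) (hC' n))

theorem isTameLinear_id : IsTameLinear (LinearMap.id : F →ₗ[ℝ] F) :=
  isTameLinear_of_forall 0 (fun _ => 1) fun n f => by simp

theorem isTameLinear_zero : IsTameLinear (0 : F →ₗ[ℝ] G) :=
  isTameLinear_of_forall 0 (fun _ => 0) fun n f => by simp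

theorem isTameLinear_fst : IsTameLinear (LinearMap.fst ℝ F G) :=
  isTameLinear_of_forall 0 (fun _ => 1) fun n f => by
    rw [one_mul]
    exact le_max_left (gr n f.1) (gr n f.2)

theorem isTameLinear_snd : IsTameLinear (LinearMap.snd ℝ F G) :=
  isTameLinear_of_forall 0 (fun _ => 1) fun n f => by
    rw [one_mul]
    exact le_max_right (gr n f.1) (gr n f.2)

/-- Near the filter `l`, the seminorms of `φ` are tamely bounded in terms of the sizes `s`. -/
def TameAt (l : Filter Z) (s : ℕ → Z → ℝ) (φ : Z → G) : Prop :=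
  ∃ (r b : ℕ) (C : ℕ → ℝ), (∀ n, 0 ≤ C n) ∧
    ∀ᶠ z in l, ∀ n ≥ b, gr n (φ z) ≤ C n * (1 + s (n + r) z)

/-- `s` is a nonnegative increasing sequence of functions. -/
structure IsSize (s : ℕ → Z → ℝ) : Prop where
  nonneg : ∀ n z, 0 ≤ s n z
  mono : ∀ z, Monotone fun n => s n z

theorem TameAt.add {l : Filter Z} {s : ℕ → Z → ℝ} (hs : IsSize s) {φ ψ : Z → G}
    (hφ : TameAt l s φ) (hψ : TameAt l s ψ) : TameAt l s (fun z => φ z + ψ z) := by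
  obtain ⟨r, b, C, hC, h⟩ := hφ
  obtain ⟨r', b', C', hC', h'⟩ := hψ
  refine ⟨max r r', max b b', fun n => C n + C' n, fun n => add_nonneg (hC n) (hC' n), ?_⟩
  filter_upwards [h, h'] with z hz hz' n hn
  rw [add_mul]
  refine (map_add_le_add _ _ _).trans (add_le_add ?_ ?_)
  · exact (hz n ((le_max_left _ _).trans hn)).trans (mul_le_mul_of_nonneg_left
      (add_le_add_right (hs.mono z (Nat.add_le_add_left (le_max_left _ _) n)) _) (hC n))
  · exact (hz' n ((le_max_right _ _).trans hn)).trans (mul_le_mul_of_nonneg_left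
      (add_le_add_right (hs.mono z (Nat.add_le_add_left (le_max_right _ _) n)) _) (hC' n))

theorem TameAt.prodMk {l : Filter Z} {s : ℕ → Z → ℝ} (hs : IsSize s) {φ : Z → G} {ψ : Z → H}
    (hφ : TameAt l s φ) (hψ : TameAt l s ψ) : TameAt l s (fun z => (φ z, ψ z)) := by
  obtain ⟨r, b, C, hC, h⟩ := hφ
  obtain ⟨r', b', C', hC', h'⟩ := hψ
  refine ⟨max r r', max b b', fun n => max (C n) (C' n), fun n => (hC n).trans (le_max_left _ _), ?_⟩
  filter_upwards [h, h'] with z hz hz' n hn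
  have hp : ∀ n, 0 ≤ 1 + s n z := fun n => add_nonneg zero_le_one (hs.nonneg n z)
  refine max_le ?_ ?_
  · exact (hz n ((le_max_left _ _).trans hn)).trans (mul_le_mul (le_max_left _ _)
      (add_le_add_right (hs.mono z (Nat.add_le_add_left (le_max_left _ _) n)) _) (hp _)
      ((hC n).trans (le_max_left _ _)))
  · exact (hz' n ((le_max_right _ _).trans hn)).trans (mul_le_mul (le_max_right _ _)
      (add_le_add_right (hs.mono z (Nat.add_le_add_left (le_max_right _ _) n)) _) (hp _)
      ((hC' n).trans (le_max_right _ _)))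

theorem TameAt.linear {l : Filter Z} {s : ℕ → Z → ℝ} {A : G →ₗ[ℝ] H}
    (hA : IsTameLinear A) {φ : Z → G} (hφ : TameAt l s φ) : TameAt l s (fun z => A (φ z)) := by
  obtain ⟨r, b, C, hC, h⟩ := hφ
  obtain ⟨r', b', C', hC', h'⟩ := hA.exists_nonneg
  refine ⟨r' + r, max b b', fun n => C' n * C (n + r'), fun n => mul_nonneg (hC' n) (hC _), ?_⟩
  filter_upwards [h] with z hz n hn
  rw [mul_assoc, ← add_assoc]
  exact (h' n ((le_max_right _ _).trans hn) _).trans (mul_le_mul_of_nonneg_left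
    (hz _ (((le_max_left _ _).trans hn).trans (Nat.le_add_right _ _))) (hC' n))

theorem TameAt.const {l : Filter Z} {s : ℕ → Z → ℝ} (hs : IsSize s) (c : G) :
    TameAt l s (fun _ => c) :=
  ⟨0, 0, fun n => gr n c, fun _ => gr_nonneg _ _, Filter.Eventually.of_forall fun _ _ _ =>
    le_mul_of_one_le_right (gr_nonneg _ _) (le_add_of_nonneg_right (hs.nonneg _ _))⟩

theorem TameAt.of_le {l : Filter Z} {s : ℕ → Z → ℝ} {φ : Z → G} (h : ∀ n z, gr n (φ z) ≤ s n z) :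
    TameAt l s φ :=
  ⟨0, 0, fun _ => 1, fun _ => zero_le_one, Filter.Eventually.of_forall fun z n _ => by
    rw [one_mul]; exact (h n z).trans (le_add_of_nonneg_left zero_le_one)⟩

/-- A locally bounded scalar factor affects only the constants, so products with real functions need
no interpolation between seminorms. -/
theorem TameAt.smul {l : Filter Z} {s : ℕ → Z → ℝ} {φ : Z → G} (hφ : TameAt l s φ) {c : Z → ℝ}
    {K : ℝ} (hc : ∀ᶠ z in l, |c z| ≤ K) : TameAt l s (fun z => c z • φ z) := by
  obtain ⟨r, b, C, hC, h⟩ := hφ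
  refine ⟨r, b, fun n => |K| * C n, fun n => mul_nonneg (abs_nonneg _) (hC n), ?_⟩
  filter_upwards [h, hc] with z hz hcz n hn
  rw [map_smul_eq_mul, mul_assoc]
  exact mul_le_mul (hcz.trans (le_abs_self _)) (hz n hn) (gr_nonneg _ _) (abs_nonneg _)

theorem TameAt.comp_tendsto {l : Filter Z} {l' : Filter Z'} {s : ℕ → Z → ℝ} {s' : ℕ → Z' → ℝ}
    (hs' : IsSize s') {φ : Z → G} (hφ : TameAt l s φ) {T : Z' → Z} (hT : Filter.Tendsto T l' l)
    {r b : ℕ} {K : ℕ → ℝ} (hK : ∀ n, 0 ≤ K n)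
    (hsT : ∀ n ≥ b, ∀ z, s n (T z) ≤ K n * (1 + s' (n + r) z)) :
    TameAt l' s' (fun z => φ (T z)) := by
  obtain ⟨r', b', C, hC, h⟩ := hφ
  refine ⟨r' + r, max b b', fun n => C n * (1 + K (n + r')),
    fun n => mul_nonneg (hC n) (add_nonneg zero_le_one (hK _)), ?_⟩
  filter_upwards [hT.eventually h] with z hz n hn
  refine (hz n ((le_max_right _ _).trans hn)).trans ?_
  rw [mul_assoc, ← add_assoc]
  refine mul_le_mul_of_nonneg_left ?_ (hC n)
  rw [add_mul, one_mul]
  exact add_le_add (le_add_of_nonneg_right (hs'.nonneg _ _))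
    (hsT _ (((le_max_left _ _).trans hn).trans (Nat.le_add_right _ _)) z)

end TameEstimates

/-! ## Tame towers -/

section TameTower

variable {F G H : Type*} [AddCommGroup F] [Module ℝ F] [TopologicalSpace F] [Graded F]
  [MonoGraded F] [AddCommGroup G] [Module ℝ G] [TopologicalSpace G] [Graded G] [MonoGraded G]
  [AddCommGroup H] [Module ℝ H] [TopologicalSpace H] [Graded H] [MonoGraded H]

/-- The size of a point and a tuple of directions. -/
def towerSize (k : ℕ) (n : ℕ) (z : F × (Fin k → F)) : ℝ := gr n z.1 + ∑ i, gr n (z.2 i)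

theorem isSize_towerSize (k : ℕ) : IsSize (towerSize k : ℕ → F × (Fin k → F) → ℝ) where
  nonneg _ _ := add_nonneg (gr_nonneg _ _) (Finset.sum_nonneg fun _ _ => gr_nonneg _ _)
  mono _ _ _ h := add_le_add (gr_mono h _) (Finset.sum_le_sum fun _ _ => gr_mono h _)

/-- The tame estimates for the tower `D` on `U`. -/
def IsTameTower (U : Set F) (D : ∀ k : ℕ, F → (Fin k → F) → G) : Prop :=
  ∀ (k : ℕ), ∀ x₀ ∈ U, ∀ v₀ : Fin k → F,
    TameAt (𝓝[U ×ˢ Set.univ] (x₀, v₀)) (towerSize k) (fun z => D k z.1 z.2)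

theorem smoothTameOn_of_tower {f : F → G} {U : Set F} {D : ∀ k : ℕ, F → (Fin k → F) → G}
    (hD : IsDerivTower f U D) (hD' : IsTameTower U D) : SmoothTameOn f U := by
  refine ⟨D, hD, fun k x₀ hx₀ v₀ => ?_⟩
  obtain ⟨r, b, C, hC, h⟩ := hD' k x₀ hx₀ v₀
  obtain ⟨N, hN, h'⟩ := mem_nhdsWithin_iff_exists_mem_nhds_inter.1 h
  refine ⟨N, hN, r, b, C, fun n hn z hz hzU => ?_⟩
  have := h' ⟨hz, hzU, trivial⟩ n hn
  rwa [towerSize, ← add_assoc] at this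

theorem IsTameTower.mono {U V : Set F} {D : ∀ k : ℕ, F → (Fin k → F) → G}
    (hD : IsTameTower U D) (hV : V ⊆ U) : IsTameTower V D := by
  intro k x₀ hx₀ v₀
  obtain ⟨r, b, C, hC, h⟩ := hD k x₀ (hV hx₀) v₀
  exact ⟨r, b, C, hC, h.filter_mono (nhdsWithin_mono _ (Set.prod_mono hV subset_rfl))⟩

theorem IsTameTower.add {U : Set F} {D D' : ∀ k : ℕ, F → (Fin k → F) → G}
    (hD : IsTameTower U D) (hD' : IsTameTower U D') :
    IsTameTower U (fun k x v => D k x v + D' k x v) := fun k x₀ hx₀ v₀ =>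
  (hD k x₀ hx₀ v₀).add (isSize_towerSize k) (hD' k x₀ hx₀ v₀)

theorem IsTameTower.prodMk {U : Set F} {D : ∀ k : ℕ, F → (Fin k → F) → G}
    {D' : ∀ k : ℕ, F → (Fin k → F) → H} (hD : IsTameTower U D) (hD' : IsTameTower U D') :
    IsTameTower U (fun k x v => (D k x v, D' k x v)) := fun k x₀ hx₀ v₀ =>
  (hD k x₀ hx₀ v₀).prodMk (isSize_towerSize k) (hD' k x₀ hx₀ v₀)

theorem IsTameTower.linear_comp {A : G →ₗ[ℝ] H} (hA : IsTameLinear A) {U : Set F}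
    {D : ∀ k : ℕ, F → (Fin k → F) → G} (hD : IsTameTower U D) :
    IsTameTower U (fun k x v => A (D k x v)) := fun k x₀ hx₀ v₀ =>
  (hD k x₀ hx₀ v₀).linear hA

theorem isTameTower_affine (A : F →L[ℝ] G) (hA : IsTameLinear (A : F →ₗ[ℝ] G)) (c : G) (U : Set F) :
    IsTameTower U (affineTower A c)
  | 0, x₀, hx₀, v₀ => by
    refine TameAt.add (isSize_towerSize _) (TameAt.linear hA (TameAt.of_le fun n z => ?_))
      (TameAt.const (isSize_towerSize _) c)
    exact le_add_of_nonneg_right (Finset.sum_nonneg fun _ _ => gr_nonneg _ _)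
  | 1, x₀, hx₀, v₀ => by
    refine TameAt.linear hA (TameAt.of_le fun n z => ?_)
    simp only [towerSize, Finset.univ_unique, Fin.default_eq_zero, Finset.sum_singleton]
    exact le_add_of_nonneg_left (gr_nonneg _ _)
  | k + 2, x₀, hx₀, v₀ => TameAt.const (isSize_towerSize _) 0

theorem IsTameTower.comp_affine [ContinuousAdd G] (A : F →L[ℝ] G)
    (hA : IsTameLinear (A : F →ₗ[ℝ] G)) (c : G)
    {U : Set G} {D : ∀ k : ℕ, G → (Fin k → G) → H} (hD : IsTameTower U D) :
    IsTameTower ((fun x => A x + c) ⁻¹' U) (fun k x v => D k (A x + c) (fun i => A (v i))) := by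
  intro k x₀ hx₀ v₀
  obtain ⟨r, b, C, hC, h⟩ := hA.exists_nonneg
  have h1 : Continuous fun z : F × (Fin k → F) =>
      ((A z.1 + c, fun i => A (z.2 i)) : G × (Fin k → G)) := by fun_prop
  have h2 : Filter.Tendsto (fun z : F × (Fin k → F) =>
      ((A z.1 + c, fun i => A (z.2 i)) : G × (Fin k → G)))
      (𝓝[((fun x => A x + c) ⁻¹' U) ×ˢ Set.univ] (x₀, v₀))
      (𝓝[U ×ˢ Set.univ] (A x₀ + c, fun i => A (v₀ i))) :=
    tendsto_nhdsWithin_of_tendsto_nhds_of_eventually_within _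
      (h1.continuousAt.tendsto.mono_left nhdsWithin_le_nhds)
      (by filter_upwards [self_mem_nhdsWithin] with z hz using ⟨hz.1, trivial⟩)
  refine (hD k _ hx₀ (fun i => A (v₀ i))).comp_tendsto (isSize_towerSize k) h2 (r := r) (b := b)
    (K := fun n => C n + gr n c) (fun n => add_nonneg (hC n) (gr_nonneg _ _)) fun n hn z => ?_
  have h3 := (isSize_towerSize k).nonneg (n + r) z
  have h4 : gr n (A z.1 + c) ≤ C n * gr (n + r) z.1 + gr n c :=
    (map_add_le_add _ _ _).trans (add_le_add_left (h n hn z.1) _)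
  have h5 : ∑ i, gr n (A (z.2 i)) ≤ C n * ∑ i, gr (n + r) (z.2 i) := by
    rw [Finset.mul_sum]
    exact Finset.sum_le_sum fun i _ => h n hn (z.2 i)
  have h6 : towerSize k n ((A z.1 + c, fun i => A (z.2 i)) : G × (Fin k → G)) ≤
      C n * towerSize k (n + r) z + gr n c := by
    simp only [towerSize, mul_add]
    linarith
  nlinarith [hC n, gr_nonneg n c]

theorem IsTameTower.shift {f g : F → G} {U : Set F} {D : ∀ k : ℕ, F → (Fin k → F) → G}
    (hD : IsTameTower U D) (hg : ∀ x ∈ U, ∀ v, D 0 x v = g x)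
    (hfg : ∀ x ∈ U, ∀ᶠ y in 𝓝 x, f y - g y = f x - g x) : IsTameTower U (shiftTower f D)
  | 0, x₀, hx₀, v₀ => by
    have h1 := (hD 0 x₀ hx₀ v₀).add (isSize_towerSize 0)
      (TameAt.const (isSize_towerSize 0) (f x₀ - g x₀))
    obtain ⟨r, b, C, hC, h⟩ := h1
    refine ⟨r, b, C, hC, ?_⟩
    have h2 : ∀ᶠ z in 𝓝[U ×ˢ Set.univ] (x₀, v₀), f z.1 - g z.1 = f x₀ - g x₀ :=
      ((continuous_fst.tendsto (x₀, v₀)).eventually (hfg x₀ hx₀)).filter_mono nhdsWithin_le_nhds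
    filter_upwards [h, h2, self_mem_nhdsWithin] with z hz hz2 hzU n hn
    have h3 := hz n hn
    rw [← hz2, hg _ hzU.1, add_sub_cancel] at h3
    exact h3
  | k + 1, x₀, hx₀, v₀ => hD (k + 1) x₀ hx₀ v₀

/-- All seminorms of the grading of `ℝ` coincide, so local boundedness, which follows from
continuity, is already a tame estimate with `r = b = 0`. -/
theorem IsDerivTower.isTameTower_real {f : F → ℝ} {U : Set F}
    {D : ∀ k : ℕ, F → (Fin k → F) → ℝ} (hD : IsDerivTower f U D) : IsTameTower U D := by
  intro k x₀ hx₀ v₀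
  refine ⟨0, 0, fun _ => |D k x₀ v₀| + 1, fun _ => by positivity, ?_⟩
  have h1 := (hD.cont k (x₀, v₀) ⟨hx₀, trivial⟩).abs.eventually
    (gt_mem_nhds (lt_add_one |D k x₀ v₀|))
  filter_upwards [h1] with z hz n _
  have h2 := (isSize_towerSize k).nonneg (n + 0) z
  rw [gr_real]
  exact hz.le.trans (le_mul_of_one_le_right (by positivity) (by linarith))

/-- The size of the arguments of the Leibniz rule. -/
def leibnizSize (a b k n : ℕ) (z : F × (Fin a → F) × (Fin b → F) × (Fin k → F)) : ℝ :=
  gr n z.1 + ∑ i, gr n (z.2.1 i) + ∑ i, gr n (z.2.2.1 i) + ∑ i, gr n (z.2.2.2 i)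

theorem isSize_leibnizSize (a b k : ℕ) :
    IsSize (leibnizSize a b k : ℕ → F × (Fin a → F) × (Fin b → F) × (Fin k → F) → ℝ) where
  nonneg n z := by
    have h := fun (c : ℕ) (v : Fin c → F) => Finset.sum_nonneg
      (s := Finset.univ) fun i _ => gr_nonneg n (v i)
    exact add_nonneg (add_nonneg (add_nonneg (gr_nonneg _ _) (h _ _)) (h _ _)) (h _ _)
  mono z m n h := by
    have h1 := fun (c : ℕ) (v : Fin c → F) => Finset.sum_le_sum
      (s := Finset.univ) fun i _ => gr_mono h (v i)
    exact add_le_add (add_le_add (add_le_add (gr_mono h _) (h1 _ _)) (h1 _ _)) (h1 _ _)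

/-- Each term of the Leibniz expansion is a derivative of `f`, locally bounded by continuity, times
a derivative of `g`, tamely bounded. -/
theorem IsTameTower.smul [ContinuousAdd H] [ContinuousSMul ℝ H] {f : F → ℝ} {g : F → H} {U : Set F}
    {D : ∀ k : ℕ, F → (Fin k → F) → ℝ}
    {D' : ∀ k : ℕ, F → (Fin k → F) → H} (hD : IsDerivTower f U D) (hT : IsTameTower U D') :
    IsTameTower U (fun k x v => leibniz (LinearMap.lsmul ℝ H) D D' x k ![] ![] v) := by
  -- The estimate is proved for arbitrary tuples `u`, `w` of directions already distributed, since
  -- the recursion of `leibniz` lengthens them.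
  have key : ∀ (k a b : ℕ), ∀ x₀ ∈ U, ∀ u₀ w₀ v₀,
      TameAt (𝓝[U ×ˢ Set.univ] (x₀, u₀, w₀, v₀)) (leibnizSize a b k)
        (fun z => leibniz (LinearMap.lsmul ℝ H) D D' z.1 k z.2.1 z.2.2.1 z.2.2.2) := by
    intro k
    induction k with
    | zero =>
      intro a b x₀ hx₀ u₀ w₀ v₀
      have hto : ∀ {c : ℕ} (T : (Fin a → F) × (Fin b → F) × (Fin 0 → F) → (Fin c → F)),
          Continuous T → Filter.Tendsto
            (fun z : F × (Fin a → F) × (Fin b → F) × (Fin 0 → F) => (z.1, T z.2))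
            (𝓝[U ×ˢ Set.univ] (x₀, u₀, w₀, v₀))
            (𝓝[U ×ˢ Set.univ] (x₀, T (u₀, w₀, v₀))) := fun T hT' =>
        tendsto_nhdsWithin_of_tendsto_nhds_of_eventually_within _
          (((by fun_prop : Continuous fun z : F × (Fin a → F) × (Fin b → F) × (Fin 0 → F) =>
            (z.1, T z.2)).tendsto _).mono_left nhdsWithin_le_nhds)
          (by filter_upwards [self_mem_nhdsWithin] with z hz using ⟨hz.1, trivial⟩)
      have h1 := (hT b x₀ hx₀ w₀).comp_tendsto (isSize_leibnizSize a b 0)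
        (hto (fun t => t.2.1) (by fun_prop)) (r := 0) (b := 0) (K := fun _ => 1)
        (fun _ => zero_le_one) (fun n _ z => by
          have h := fun (c : ℕ) (v : Fin c → F) => Finset.sum_nonneg
            (s := Finset.univ) fun i _ => gr_nonneg n (v i)
          have h1 := h a z.2.1
          simp only [towerSize, leibnizSize, add_zero, one_mul, Finset.univ_eq_empty,
            Finset.sum_empty]
          linarith)
      have h2 := ((hD.cont a (x₀, u₀) ⟨hx₀, trivial⟩).abs.tendsto.comp
        (hto (fun t => t.1) (by fun_prop))).eventually (gt_mem_nhds (lt_add_one |D a x₀ u₀|))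
      exact h1.smul (h2.mono fun z hz => le_of_lt hz)
    | succ k ih =>
      intro a b x₀ hx₀ u₀ w₀ v₀
      have ht : Continuous fun v : Fin (k + 1) → F => (Fin.tail v : Fin k → F) :=
        continuous_pi fun i => continuous_apply _
      have hs : ∀ c : ℕ, Continuous fun z : (Fin c → F) × F =>
          (Fin.snoc (α := fun _ => F) z.1 z.2 : Fin (c + 1) → F) := fun c => by fun_prop
      refine TameAt.add (isSize_leibnizSize a b (k + 1)) ?_ ?_
      · refine (ih (a + 1) b x₀ hx₀ (Fin.snoc (α := fun _ => F) u₀ (v₀ 0)) w₀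
          (Fin.tail v₀)).comp_tendsto (isSize_leibnizSize a b (k + 1))
          (T := fun z : F × (Fin a → F) × (Fin b → F) × (Fin (k + 1) → F) =>
            (z.1, Fin.snoc (α := fun _ => F) z.2.1 (z.2.2.2 0), z.2.2.1, Fin.tail z.2.2.2))
          (tendsto_nhdsWithin_of_tendsto_nhds_of_eventually_within _ ?_ ?_)
          (r := 0) (b := 0) (K := fun _ => 1) (fun _ => zero_le_one) (fun n _ z => ?_)
        · refine Filter.Tendsto.mono_left (Continuous.tendsto ?_ _) nhdsWithin_le_nhds
          refine continuous_fst.prodMk (((hs a).comp (by fun_prop :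
            Continuous fun z : F × (Fin a → F) × (Fin b → F) × (Fin (k + 1) → F) =>
              (z.2.1, z.2.2.2 0))).prodMk ((by fun_prop : Continuous _).prodMk
                (ht.comp (by fun_prop))))
        · filter_upwards [self_mem_nhdsWithin] with z hz using ⟨hz.1, trivial⟩
        · simp only [leibnizSize, Fin.sum_univ_castSucc (n := a), Fin.snoc_castSucc, Fin.snoc_last,
            Fin.sum_univ_succ (n := k), Fin.tail, one_mul, add_zero]
          linarith
      · refine (ih a (b + 1) x₀ hx₀ u₀ (Fin.snoc (α := fun _ => F) w₀ (v₀ 0))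
          (Fin.tail v₀)).comp_tendsto (isSize_leibnizSize a b (k + 1))
          (T := fun z : F × (Fin a → F) × (Fin b → F) × (Fin (k + 1) → F) =>
            (z.1, z.2.1, Fin.snoc (α := fun _ => F) z.2.2.1 (z.2.2.2 0), Fin.tail z.2.2.2))
          (tendsto_nhdsWithin_of_tendsto_nhds_of_eventually_within _ ?_ ?_)
          (r := 0) (b := 0) (K := fun _ => 1) (fun _ => zero_le_one) (fun n _ z => ?_)
        · refine Filter.Tendsto.mono_left (Continuous.tendsto ?_ _) nhdsWithin_le_nhds
          refine continuous_fst.prodMk ((by fun_prop : Continuous _).prodMk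
            (((hs b).comp (by fun_prop :
            Continuous fun z : F × (Fin a → F) × (Fin b → F) × (Fin (k + 1) → F) =>
              (z.2.2.1, z.2.2.2 0))).prodMk (ht.comp (by fun_prop))))
        · filter_upwards [self_mem_nhdsWithin] with z hz using ⟨hz.1, trivial⟩
        · simp only [leibnizSize, Fin.sum_univ_castSucc (n := b), Fin.snoc_castSucc, Fin.snoc_last,
            Fin.sum_univ_succ (n := k), Fin.tail, one_mul, add_zero]
          linarith
  intro k x₀ hx₀ v₀
  refine (key k 0 0 x₀ hx₀ ![] ![] v₀).comp_tendsto (isSize_towerSize k)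
    (T := fun z : F × (Fin k → F) => (z.1, ![], ![], z.2))
    (tendsto_nhdsWithin_of_tendsto_nhds_of_eventually_within _ ?_ ?_)
    (r := 0) (b := 0) (K := fun _ => 1) (fun _ => zero_le_one) (fun n _ z => ?_)
  · exact ((by fun_prop : Continuous fun z : F × (Fin k → F) =>
      ((z.1, ![], ![], z.2) : F × (Fin 0 → F) × (Fin 0 → F) × (Fin k → F))).tendsto _).mono_left
        nhdsWithin_le_nhds
  · filter_upwards [self_mem_nhdsWithin] with z hz using ⟨hz.1, trivial⟩
  · simp [leibnizSize, towerSize]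

end TameTower

end

/-! ### The Fréchet space of loops, its derivation and the rotation action -/

section

/-! ## The Fréchet space of loops -/

namespace LoopSpace

variable {n : ℕ}

@[simp] theorem sub_apply (η ζ : LoopSpace n) (z : ℂ) : (η - ζ) z = η z - ζ z := rfl

theorem norm_apply_le (η : LoopSpace n) {m : ℕ} {z : ℂ} (hz : z ∈ annulus m) :
    ‖η z‖ ≤ gr m η :=
  le_ciSup (f := fun z : annulus m => ‖η z‖) (η.bddAbove m) ⟨z, hz⟩

theorem gr_le (η : LoopSpace n) {m : ℕ} {C : ℝ} (h : ∀ z ∈ annulus m, ‖η z‖ ≤ C) : gr m η ≤ C :=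
  ciSup_le fun z => h z z.2

theorem annulus_mono {m m' : ℕ} (h : m ≤ m') : annulus m ⊆ annulus m' := fun _ hz =>
  ⟨(Real.exp_le_exp.2 (neg_le_neg (Nat.cast_le.2 h))).trans hz.1,
    hz.2.trans (Real.exp_le_exp.2 (Nat.cast_le.2 h))⟩

theorem mem_annulus_of_norm_eq_one {z : ℂ} (hz : ‖z‖ = 1) (m : ℕ) : z ∈ annulus m :=
  ⟨by rw [hz]; exact Real.exp_le_one_iff.2 (by simp), by rw [hz]; exact Real.one_le_exp (by simp)⟩

theorem exists_mem_annulus {z : ℂ} (hz : z ≠ 0) : ∃ m, z ∈ annulus m := by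
  obtain ⟨m, hm⟩ := exists_nat_ge |Real.log ‖z‖|
  have h1 := abs_le.1 hm
  exact ⟨m, (Real.le_log_iff_exp_le (norm_pos_iff.2 hz)).1 h1.1,
    (Real.log_le_iff_le_exp (norm_pos_iff.2 hz)).1 h1.2⟩

theorem mul_mem_annulus {w z : ℂ} (hw : ‖w‖ = 1) {m : ℕ} : w * z ∈ annulus m ↔ z ∈ annulus m := by
  simp [annulus, hw]

theorem apply_zero (η : LoopSpace n) : η 0 = 0 := η.2.1

theorem im_apply (η : LoopSpace n) {z : ℂ} (hz : ‖z‖ = 1) (j : Fin n) : (η z j).im = 0 :=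
  η.2.2.2.1 z hz j

theorem integral_eq_zero (η : LoopSpace n) :
    ∫ θ in (0 : ℝ)..2 * Real.pi, η (Circle.exp θ) = 0 := η.2.2.2.2

instance : MonoGraded (LoopSpace n) :=
  ⟨fun m η => η.gr_le fun _ hz => η.norm_apply_le (annulus_mono (Nat.le_succ m) hz)⟩

theorem withSeminorms : WithSeminorms (Graded.gr : SeminormFamily ℝ (LoopSpace n) ℕ) := ⟨rfl⟩

instance : IsTopologicalAddGroup (LoopSpace n) := withSeminorms.topologicalAddGroup

instance : ContinuousSMul ℝ (LoopSpace n) := withSeminorms.continuousSMul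

theorem eq_zero_of_gr (η : LoopSpace n) (h : ∀ m, gr m η = 0) : η = 0 := by
  ext z : 1
  by_cases hz : z = 0
  · rw [hz]; exact η.apply_zero
  · obtain ⟨m, hm⟩ := exists_mem_annulus hz
    have h1 := η.norm_apply_le hm
    rw [h m] at h1
    exact norm_le_zero_iff.1 h1

instance : T2Space (LoopSpace n) := by
  have : T1Space (LoopSpace n) := withSeminorms.T1_of_separating fun η hη => by
    by_contra h
    push Not at h
    exact hη (η.eq_zero_of_gr h)
  infer_instance

theorem tendsto_iff {ι : Type*} {l : Filter ι} {u : ι → LoopSpace n} {η : LoopSpace n} :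
    Filter.Tendsto u l (𝓝 η) ↔ ∀ m, Filter.Tendsto (fun i => gr m (u i - η)) l (𝓝 0) := by
  rw [withSeminorms.tendsto_nhds]
  refine forall_congr' fun m => ?_
  rw [Metric.tendsto_nhds]
  refine forall₂_congr fun ε hε => ?_
  simp [abs_of_nonneg]

theorem continuous_gr (m : ℕ) : Continuous fun η : LoopSpace n => gr m η :=
  withSeminorms.continuous_seminorm m

theorem continuous_comp_exp {f : ℂ → Fin n → ℂ} (hf : DifferentiableOn ℂ f {0}ᶜ) :
    Continuous fun θ : ℝ => f (Circle.exp θ) :=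
  hf.continuousOn.comp_continuous (continuous_subtype_val.comp Circle.exp.continuous)
    (fun _ => Circle.coe_ne_zero _)

theorem exists_annulus_mem_nhds {z : ℂ} (hz : z ≠ 0) : ∃ m, annulus m ∈ 𝓝 z := by
  obtain ⟨m, hm⟩ := exists_mem_annulus hz
  refine ⟨m + 1, ?_⟩
  have h1 : {w : ℂ | Real.exp (-(m + 1 : ℕ)) < ‖w‖ ∧ ‖w‖ < Real.exp (m + 1 : ℕ)} ∈ 𝓝 z := by
    refine IsOpen.mem_nhds ((isOpen_lt continuous_const continuous_norm).inter
      (isOpen_lt continuous_norm continuous_const)) ⟨lt_of_lt_of_le ?_ hm.1, hm.2.trans_lt ?_⟩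
    · exact Real.exp_lt_exp.2 (by push_cast; linarith)
    · exact Real.exp_lt_exp.2 (by push_cast; linarith)
  exact Filter.mem_of_superset h1 fun w hw => ⟨hw.1.le, hw.2.le⟩

/-- A Cauchy sequence for the grading is uniformly Cauchy on every annulus, and the annuli exhaust
`ℂ^*`. The limit is holomorphic by Weierstrass' theorem; reality and vanishing mean value pass to
the limit on the unit circle. -/
theorem complete (u : ℕ → LoopSpace n)
    (hu : ∀ (m : ℕ) (ε : ℝ), 0 < ε → ∃ N, ∀ i ≥ N, ∀ j ≥ N, gr m (u i - u j) < ε) :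
    ∃ η : LoopSpace n, Filter.Tendsto u Filter.atTop (𝓝 η) := by
  have hc : ∀ z : ℂ, CauchySeq fun i => u i z := by
    intro z
    by_cases hz : z = 0
    · simp only [hz, apply_zero]
      exact cauchySeq_const 0
    · obtain ⟨m, hm⟩ := exists_mem_annulus hz
      refine Metric.cauchySeq_iff.2 fun ε hε => ?_
      obtain ⟨N, hN⟩ := hu m ε hε
      refine ⟨N, fun i hi j hj => ?_⟩
      rw [dist_eq_norm]
      exact ((u i - u j).norm_apply_le hm).trans_lt (hN i hi j hj)
  choose f hf using fun z => cauchySeq_tendsto_of_complete (hc z)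
  have hunif : ∀ m, TendstoUniformlyOn (fun i z => u i z) f Filter.atTop (annulus m) := by
    intro m
    refine UniformCauchySeqOn.tendstoUniformlyOn_of_tendsto ?_ fun z _ => hf z
    refine Metric.uniformCauchySeqOn_iff.2 fun ε hε => ?_
    obtain ⟨N, hN⟩ := hu m ε hε
    refine ⟨N, fun i hi j hj z hz => ?_⟩
    rw [dist_eq_norm]
    exact ((u i - u j).norm_apply_le hz).trans_lt (hN i hi j hj)
  have hloc : TendstoLocallyUniformlyOn (fun i z => u i z) f Filter.atTop {0}ᶜ := by
    intro s hs z hz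
    obtain ⟨m, hm⟩ := exists_annulus_mem_nhds hz
    exact ⟨annulus m, mem_nhdsWithin_of_mem_nhds hm, hunif m s hs⟩
  have hd : DifferentiableOn ℂ f {0}ᶜ :=
    hloc.differentiableOn (Filter.Eventually.of_forall fun i => (u i).differentiableOn)
      isOpen_compl_singleton
  have h0 : f 0 = 0 := tendsto_nhds_unique (hf 0) (by simp only [apply_zero]; exact tendsto_const_nhds)
  have him : ∀ z : ℂ, ‖z‖ = 1 → ∀ j, (f z j).im = 0 := by
    intro z hz j
    have h1 : Filter.Tendsto (fun i => (u i z j).im) Filter.atTop (𝓝 (f z j).im) :=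
      (Complex.continuous_im.tendsto _).comp ((continuous_apply j).tendsto _ |>.comp (hf z))
    simp only [fun i => (u i).im_apply hz j] at h1
    exact (tendsto_nhds_unique h1 tendsto_const_nhds)
  have hint : ∫ θ in (0 : ℝ)..2 * Real.pi, f (Circle.exp θ) = 0 := by
    have h1 : Filter.Tendsto (fun i => ∫ θ in (0 : ℝ)..2 * Real.pi, u i (Circle.exp θ))
        Filter.atTop (𝓝 (∫ θ in (0 : ℝ)..2 * Real.pi, f (Circle.exp θ))) := by
      obtain ⟨N, hN⟩ := hu 0 1 one_pos
      refine intervalIntegral.tendsto_integral_filter_of_dominated_convergence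
        (fun _ => gr 0 (u N) + 1)
        (Filter.Eventually.of_forall fun i =>
          (continuous_comp_exp (u i).differentiableOn).aestronglyMeasurable) ?_
        intervalIntegrable_const (Filter.Eventually.of_forall fun θ _ => hf _)
      filter_upwards [Filter.eventually_ge_atTop N] with i hi
      refine Filter.Eventually.of_forall fun θ _ => ?_
      have h2 := (u i).norm_apply_le (mem_annulus_of_norm_eq_one (Circle.norm_coe (Circle.exp θ)) 0)
      have h3 : gr 0 (u i) ≤ gr 0 (u N) + gr 0 (u i - u N) := by
        simpa using map_add_le_add (gr 0 : Seminorm ℝ (LoopSpace n)) (u N) (u i - u N)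
      linarith [hN i hi N le_rfl]
    simp only [integral_eq_zero] at h1
    exact (tendsto_nhds_unique h1 tendsto_const_nhds)
  refine ⟨⟨f, h0, hd, him, hint⟩, tendsto_iff.2 fun m => ?_⟩
  refine Metric.tendsto_atTop.2 fun ε hε => ?_
  obtain ⟨N, hN⟩ := hu m (ε / 2) (half_pos hε)
  refine ⟨N, fun i hi => ?_⟩
  rw [Real.dist_0_eq_abs, abs_of_nonneg (gr_nonneg _ _)]
  refine lt_of_le_of_lt (gr_le _ fun z hz => ?_) (half_lt_self hε)
  refine le_of_tendsto ((tendsto_const_nhds.sub (hf z)).norm) ?_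
  filter_upwards [Filter.eventually_ge_atTop N] with j hj
  exact ((u i - u j).norm_apply_le hz).trans (hN i hi j hj).le

theorem isGradedFrechet : IsGradedFrechet (LoopSpace n) where
  mono := MonoGraded.mono
  withSeminorms := withSeminorms
  hausdorff := inferInstance
  complete := complete

/-- Identity theorem on the connected set `ℂ^*`: the points `e^{i/(k+1)}` of the unit circle
accumulate at `1`. -/
theorem eqOn_of_eqOn_circle {E : Type*} [NormedAddCommGroup E] [NormedSpace ℂ E] [CompleteSpace E]
    {f g : ℂ → E} (hf : DifferentiableOn ℂ f {0}ᶜ)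
    (hg : DifferentiableOn ℂ g {0}ᶜ) (h : ∀ z : ℂ, ‖z‖ = 1 → f z = g z) : Set.EqOn f g {0}ᶜ := by
  have hpre : IsPreconnected ({0}ᶜ : Set ℂ) :=
    (isConnected_compl_singleton_of_one_lt_rank (by simp) 0).isPreconnected
  refine (hf.analyticOnNhd isOpen_compl_singleton).eqOn_of_preconnected_of_frequently_eq
    (hg.analyticOnNhd isOpen_compl_singleton) hpre (z₀ := 1) (by simp) ?_
  have h1 : Filter.Tendsto (fun k : ℕ => ((Circle.exp (1 / ((k : ℝ) + 1)) : Circle) : ℂ))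
      Filter.atTop (𝓝[≠] 1) := by
    refine tendsto_nhdsWithin_of_tendsto_nhds_of_eventually_within _ ?_ ?_
    · have h2 : Continuous fun x : ℝ => ((Circle.exp x : Circle) : ℂ) :=
        continuous_subtype_val.comp Circle.exp.continuous
      have h3 := (h2.tendsto 0).comp tendsto_one_div_add_atTop_nhds_zero_nat
      simpa [Function.comp_def] using h3
    · refine Filter.Eventually.of_forall fun k hk => ?_
      have hpos : (0 : ℝ) < 1 / ((k : ℝ) + 1) := by positivity
      have hle : 1 / ((k : ℝ) + 1) ≤ 1 := by
        rw [div_le_one (by positivity)]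
        linarith [(Nat.cast_nonneg k : (0 : ℝ) ≤ k)]
      have h2 : Complex.arg ((Circle.exp (1 / ((k : ℝ) + 1)) : Circle) : ℂ) = 1 / ((k : ℝ) + 1) :=
        Circle.arg_exp (by linarith [Real.pi_pos]) (by linarith [Real.pi_gt_three])
      rw [Set.mem_singleton_iff.1 hk, Complex.arg_one] at h2
      exact hpos.ne h2
  refine h1.frequently (Filter.Frequently.of_forall fun k => h _ (Circle.norm_coe _))

theorem ext_circle {η ζ : LoopSpace n} (h : ∀ z : ℂ, ‖z‖ = 1 → η z = ζ z) : η = ζ := by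
  ext z : 1
  by_cases hz : z = 0
  · rw [hz, η.apply_zero, ζ.apply_zero]
  · exact eqOn_of_eqOn_circle η.differentiableOn ζ.differentiableOn h hz

/-! ### Derivative and rotation -/

theorem hasDerivAt_comp_rotation {E : Type*} [NormedAddCommGroup E] [NormedSpace ℂ E]
    {f : ℂ → E} (hf : DifferentiableOn ℂ f {0}ᶜ) {z : ℂ} (hz : z ≠ 0)
    (s : ℝ) : HasDerivAt (fun s : ℝ => f (Circle.exp s * z))
      ((Complex.I * (Circle.exp s * z)) • deriv f (Circle.exp s * z)) s := by
  have hne : (Circle.exp s : ℂ) * z ≠ 0 := mul_ne_zero (Circle.coe_ne_zero _) hz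
  have h1 : HasDerivAt f (deriv f (Circle.exp s * z)) (Circle.exp s * z) :=
    ((hf _ hne).differentiableAt (isOpen_compl_singleton.mem_nhds hne)).hasDerivAt
  have h2 : HasDerivAt (fun s : ℝ => (Circle.exp s : ℂ) * z) (Complex.I * (Circle.exp s * z)) s := by
    simp only [Circle.coe_exp]
    have h3 : HasDerivAt (fun s : ℝ => Complex.exp (s * Complex.I) * z)
        (Complex.exp (s * Complex.I) * (1 * Complex.I) * z) s :=
      (((Complex.ofRealCLM.hasDerivAt (x := s)).mul_const Complex.I).cexp).mul_const z
    convert h3 using 1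
    ring
  exact h1.scomp s h2

/-- The derivative `∂_θ η = i z η'(z)`. -/
def deriv (η : LoopSpace n) : LoopSpace n :=
  ⟨fun z => (Complex.I * z) • _root_.deriv η.1 z, by
    have hd : DifferentiableOn ℂ (fun z => (Complex.I * z) • _root_.deriv η.1 z) {0}ᶜ :=
      (differentiableOn_id.const_mul Complex.I).smul
        (η.differentiableOn.deriv isOpen_compl_singleton)
    have hder : ∀ θ : ℝ, HasDerivAt (fun s : ℝ => η (Circle.exp s))
        ((Complex.I * Circle.exp θ) • _root_.deriv η.1 (Circle.exp θ)) θ := fun θ => by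
      simpa using hasDerivAt_comp_rotation η.differentiableOn one_ne_zero θ
    refine ⟨by simp, hd, ?_, ?_⟩
    -- On the circle `i z η'(z)` is the derivative of `θ ↦ η(e^{iθ})`, whose imaginary part is
    -- identically zero.
    · intro z hz j
      obtain ⟨θ, hθ⟩ : ∃ θ : ℝ, (Circle.exp θ : ℂ) = z :=
        ⟨Complex.arg z, by rw [Circle.coe_exp]; simpa [hz] using Complex.norm_mul_exp_arg_mul_I z⟩
      have h1 := Complex.imCLM.hasFDerivAt.comp_hasDerivAt θ
        ((hasDerivAt_pi.1 (hder θ)) j)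
      have h2 : (fun s : ℝ => Complex.imCLM (η (Circle.exp s) j)) = fun _ => 0 := by
        funext s
        exact η.im_apply (Circle.norm_coe _) j
      have h3 := h1.unique (h2 ▸ hasDerivAt_const θ (0 : ℝ))
      rw [hθ] at h3
      exact h3
    -- The integral of a derivative over a full period vanishes.
    · rw [intervalIntegral.integral_eq_sub_of_hasDerivAt (fun θ _ => hder θ)
        ((continuous_comp_exp hd).intervalIntegrable _ _)]
      simp⟩

theorem deriv_apply (η : LoopSpace n) (z : ℂ) :
    η.deriv z = (Complex.I * z) • _root_.deriv η.1 z := rfl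

theorem hasDerivAt_rotate_apply (η : LoopSpace n) (z : ℂ) (s : ℝ) :
    HasDerivAt (fun s : ℝ => η (Circle.exp s * z)) (η.deriv (Circle.exp s * z)) s := by
  by_cases hz : z = 0
  · simp only [hz, mul_zero, apply_zero]
    exact hasDerivAt_const s (0 : Fin n → ℂ)
  · exact hasDerivAt_comp_rotation η.differentiableOn hz s

/-- Linearity of `∂_θ` is read off from uniqueness of the derivative of `s ↦ η(e^{is} z)`. This also
covers `z = 0`, where the extended loop need not be complex differentiable. -/
theorem deriv_add (η ζ : LoopSpace n) : (η + ζ).deriv = η.deriv + ζ.deriv := by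
  ext z : 1
  have h := (hasDerivAt_rotate_apply (η + ζ) z 0).unique
    ((hasDerivAt_rotate_apply η z 0).add (hasDerivAt_rotate_apply ζ z 0))
  simpa using h

theorem deriv_smul (c : ℝ) (η : LoopSpace n) : (c • η).deriv = c • η.deriv := by
  ext z : 1
  have h := (hasDerivAt_rotate_apply (c • η) z 0).unique
    ((hasDerivAt_rotate_apply η z 0).const_smul c)
  simpa using h

/-- The derivative `∂_θ` as a linear map. -/
def derivL (n : ℕ) : LoopSpace n →ₗ[ℝ] LoopSpace n where
  toFun := deriv
  map_add' := deriv_add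
  map_smul' := deriv_smul

@[simp] theorem derivL_apply (η : LoopSpace n) : derivL n η = η.deriv := rfl

/-- Cauchy's estimate on the disc about `z` of radius `|z| (1 - e⁻¹)`. On its boundary the modulus
lies between `|z| e⁻¹` and `|z| (2 - e⁻¹) ≤ |z| e`, so the disc stays in the next annulus. The
factor `|z|` in `i z η'(z)` cancels the one in the radius, which makes the constant independent of
`m`. -/
theorem gr_deriv_le (m : ℕ) (η : LoopSpace n) :
    gr m η.deriv ≤ (1 - Real.exp (-1))⁻¹ * gr (m + 1) η := by
  have hlt : Real.exp (-1) < 1 := by rw [Real.exp_lt_one_iff]; norm_num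
  refine gr_le _ fun z hz => ?_
  have hz0 : 0 < ‖z‖ := (Real.exp_pos _).trans_le hz.1
  set r := ‖z‖ * (1 - Real.exp (-1)) with hr
  have hr0 : 0 < r := mul_pos hz0 (by linarith)
  have hsub : Metric.closedBall z r ⊆ {0}ᶜ := by
    intro w hw h0
    rw [Set.mem_singleton_iff.1 h0, Metric.mem_closedBall, dist_zero_left] at hw
    nlinarith [Real.exp_pos (-1)]
  have hdc : DiffContOnCl ℂ η.1 (Metric.ball z r) :=
    (η.differentiableOn.mono (Metric.closure_ball_subset_closedBall.trans hsub)).diffContOnCl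
  have h1 := Complex.norm_deriv_le_of_forall_mem_sphere_norm_le hr0 hdc (C := gr (m + 1) η)
    fun w hw => by
      refine η.norm_apply_le ?_
      rw [mem_sphere_iff_norm] at hw
      have h2 : ‖z‖ - r ≤ ‖w‖ := by
        have := norm_sub_norm_le z w
        rw [norm_sub_rev] at this
        linarith
      have h3 : ‖w‖ ≤ ‖z‖ + r := by
        have := norm_sub_norm_le w z
        linarith
      have h4 : ‖z‖ - r = ‖z‖ * Real.exp (-1) := by rw [hr]; ring
      have h5 : 2 - Real.exp (-1) ≤ Real.exp 1 := by
        have := Real.add_one_le_exp (1 : ℝ)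
        linarith [Real.exp_pos (-1)]
      constructor
      · have h6 : Real.exp (-((m + 1 : ℕ) : ℝ)) = Real.exp (-m) * Real.exp (-1) := by
          rw [← Real.exp_add]; push_cast; ring_nf
        rw [h6]
        rw [h4] at h2
        exact (mul_le_mul_of_nonneg_right hz.1 (Real.exp_pos _).le).trans h2
      · have h6 : Real.exp ((m + 1 : ℕ) : ℝ) = Real.exp m * Real.exp 1 := by
          rw [← Real.exp_add]; push_cast; ring_nf
        rw [h6]
        calc ‖w‖ ≤ ‖z‖ * (2 - Real.exp (-1)) := by rw [hr] at h3; linarith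
          _ ≤ Real.exp m * Real.exp 1 := mul_le_mul hz.2 h5 (by linarith) (Real.exp_pos _).le
  rw [deriv_apply, norm_smul, norm_mul, Complex.norm_I, one_mul]
  calc ‖z‖ * ‖_root_.deriv η.1 z‖ ≤ ‖z‖ * (gr (m + 1) η / r) :=
        mul_le_mul_of_nonneg_left h1 hz0.le
    _ = (1 - Real.exp (-1))⁻¹ * gr (m + 1) η := by
      rw [hr]
      have : 1 - Real.exp (-1) ≠ 0 := by linarith
      field_simp

theorem isTameLinear_derivL : IsTameLinear (derivL n) :=
  isTameLinear_of_forall 1 (fun _ => (1 - Real.exp (-1))⁻¹) gr_deriv_le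

theorem rotate_smul (w : Circle) (c : ℝ) (η : LoopSpace n) :
    (c • η).rotate w = c • η.rotate w := rfl

theorem rotate_sub (w : Circle) (η ζ : LoopSpace n) :
    (η - ζ).rotate w = η.rotate w - ζ.rotate w := rfl

@[simp] theorem rotate_zero (w : Circle) : (0 : LoopSpace n).rotate w = 0 := rfl

/-- The annuli are invariant under rotations. It suffices to prove one inequality for all `w` and to
apply it to `w⁻¹` for the converse. -/
theorem gr_rotate (w : Circle) (m : ℕ) (η : LoopSpace n) : gr m (η.rotate w) = gr m η := by
  have h : ∀ (w : Circle) (η : LoopSpace n), gr m (η.rotate w) ≤ gr m η := fun w η =>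
    gr_le _ fun z hz => η.norm_apply_le ((mul_mem_annulus (Circle.norm_coe w)).2 hz)
  refine le_antisymm (h w η) ?_
  have h1 := h w⁻¹ (η.rotate w)
  rwa [rotate_rotate, inv_mul_cancel, rotate_one] at h1

/-- Rotation as a linear map. -/
def rotateL (w : Circle) : LoopSpace n →ₗ[ℝ] LoopSpace n where
  toFun := rotate w
  map_add' := rotate_add w
  map_smul' := rotate_smul w

@[simp] theorem rotateL_apply (w : Circle) (η : LoopSpace n) : rotateL w η = η.rotate w := rfl

theorem isTameLinear_rotateL (w : Circle) : IsTameLinear (rotateL w : LoopSpace n →ₗ[ℝ] _) :=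
  isTameLinear_of_forall 0 (fun _ => 1) fun m η => by
    rw [rotateL_apply, gr_rotate, one_mul, add_zero]

theorem gr_rotate_exp_sub_le (s : ℝ) (m : ℕ) (η : LoopSpace n) :
    gr m (η.rotate (Circle.exp s) - η) ≤ |s| * gr m η.deriv := by
  refine gr_le _ fun z hz => ?_
  have h := (convex_univ (𝕜 := ℝ) (E := ℝ)).norm_image_sub_le_of_norm_hasDerivWithin_le
    (f := fun s : ℝ => η (Circle.exp s * z)) (C := gr m η.deriv) (x := 0) (y := s)
    (fun s _ => (hasDerivAt_rotate_apply η z s).hasDerivWithinAt)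
    (fun s _ => η.deriv.norm_apply_le ((mul_mem_annulus (Circle.norm_coe _)).2 hz)) trivial trivial
  simpa [mul_comm] using h

/-- Mean value inequality for `t ↦ η(e^{it} z) - t ∂_θ η(z)` between `0` and `s`: its derivative is
the increment of `∂_θ η` under a rotation by `t`, at most `|s|` times a seminorm of `∂_θ² η` by the
first-order estimate. This gives a quadratic remainder, uniform on the annulus. -/
theorem gr_rotate_exp_sub_sub_le (s : ℝ) (m : ℕ) (η : LoopSpace n) :
    gr m (η.rotate (Circle.exp s) - η - s • η.deriv) ≤ |s| * (|s| * gr m η.deriv.deriv) := by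
  refine gr_le _ fun z hz => ?_
  have h := (convex_uIcc (0 : ℝ) s).norm_image_sub_le_of_norm_hasDerivWithin_le
    (f := fun s : ℝ => η (Circle.exp s * z) - s • η.deriv z) (C := |s| * gr m η.deriv.deriv)
    (x := 0) (y := s)
    (fun t _ => ((hasDerivAt_rotate_apply η z t).sub
      ((hasDerivAt_id t).smul_const (η.deriv z))).hasDerivWithinAt)
    (fun t ht => by
      rw [one_smul]
      refine ((η.deriv.rotate (Circle.exp t) - η.deriv).norm_apply_le hz).trans
        ((gr_rotate_exp_sub_le t m η.deriv).trans
          (mul_le_mul_of_nonneg_right ?_ (gr_nonneg _ _)))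
      simpa using Set.abs_sub_left_of_mem_uIcc ht) Set.left_mem_uIcc Set.right_mem_uIcc
  simp only [Circle.exp_zero, Circle.coe_one, one_mul, zero_smul, sub_zero, Real.norm_eq_abs] at h
  rw [mul_comm |s|]
  rw [sub_right_comm] at h
  exact h

theorem gr_rotate_sub_le (w : Circle) (m : ℕ) (η : LoopSpace n) :
    gr m (η.rotate w - η) ≤ |Complex.arg w| * gr m η.deriv := by
  have h := gr_rotate_exp_sub_le (Complex.arg w) m η
  rwa [Circle.exp_arg] at h

theorem continuous_rotate :
    Continuous fun z : Circle × LoopSpace n => z.2.rotate z.1 := by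
  refine continuous_iff_continuousAt.2 fun ⟨w₀, η₀⟩ => tendsto_iff.2 fun m => ?_
  have h1 : Filter.Tendsto (fun z : Circle × LoopSpace n => gr m (z.2 - η₀) +
      |Complex.arg (z.1 / w₀ : Circle)| * gr m η₀.deriv) (𝓝 (w₀, η₀)) (𝓝 0) := by
    have h2 : Filter.Tendsto (fun z : Circle × LoopSpace n => gr m (z.2 - η₀))
        (𝓝 (w₀, η₀)) (𝓝 0) := by
      have h := ((continuous_gr m).comp
        (f := fun z : Circle × LoopSpace n => z.2 - η₀) (by fun_prop)).tendsto (w₀, η₀)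
      simpa [Function.comp_def] using h
    have h3 : Filter.Tendsto (fun z : Circle × LoopSpace n => |Complex.arg (z.1 / w₀ : Circle)|)
        (𝓝 (w₀, η₀)) (𝓝 0) := by
      have h4 : ContinuousAt (fun z : Circle × LoopSpace n => Complex.arg (z.1 / w₀ : Circle))
          (w₀, η₀) := by
        refine ContinuousAt.comp (f := fun z : Circle × LoopSpace n => ((z.1 / w₀ : Circle) : ℂ))
          (g := Complex.arg) (Complex.continuousAt_arg (by simp)) ?_
        exact (continuous_subtype_val.comp
          ((continuous_div_right' w₀).comp continuous_fst)).continuousAt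
      have h5 := h4.abs.tendsto
      simpa using h5
    simpa using h2.add (h3.mul_const (gr m η₀.deriv))
  refine squeeze_zero (fun _ => gr_nonneg _ _) (fun z => ?_) h1
  -- The loop is varied first, then the angle. Both pieces are measured after undoing a rotation,
  -- which costs nothing; the second is small because `η₀` is fixed.
  have h2 : z.2.rotate z.1 - η₀.rotate w₀ =
      (z.2 - η₀).rotate z.1 + (η₀.rotate (z.1 / w₀) - η₀).rotate w₀ := by
    rw [rotate_sub, rotate_sub, rotate_rotate, mul_div_cancel]
    abel
  rw [h2]
  refine (map_add_le_add _ _ _).trans ?_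
  rw [gr_rotate, gr_rotate]
  exact add_le_add le_rfl (gr_rotate_sub_le _ _ _)

/-- The difference quotient splits into the quotient of `f`, rotated by the moving angle, and the
quotient of the rotation at the fixed loop `f x`. Joint continuity of the rotation handles the first
and the quadratic remainder estimate the second. Rotations commute with `∂_θ`, so the common
rotation can be kept outside. -/
theorem _root_.KacMoody.HasDirDeriv.rotate {F : Type*} [AddCommGroup F] [Module ℝ F]
    [TopologicalSpace F] {f : F → LoopSpace n}
    {θ : F → ℝ} {x h : F} {y : LoopSpace n} {τ : ℝ} (hf : HasDirDeriv f x h y)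
    (hθ : HasDirDeriv θ x h τ) :
    HasDirDeriv (fun x => (f x).rotate (Circle.exp (θ x))) x h
      ((y + τ • (f x).deriv).rotate (Circle.exp (θ x))) := by
  have h1 : Filter.Tendsto (fun t : ℝ => (t⁻¹ • (f (x + t • h) - f x)).rotate
      (Circle.exp (θ (x + t • h)))) (𝓝[≠] 0) (𝓝 (y.rotate (Circle.exp (θ x)))) :=
    (continuous_rotate.tendsto (Circle.exp (θ x), y)).comp
      (((Circle.exp.continuous.tendsto _).comp hθ.tendsto).prodMk_nhds hf)
  have h2 : Filter.Tendsto (fun t : ℝ => t⁻¹ • ((f x).rotate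
      (Circle.exp (θ (x + t • h) - θ x)) - f x)) (𝓝[≠] 0) (𝓝 (τ • (f x).deriv)) := by
    refine tendsto_iff.2 fun m => ?_
    have h3 : Filter.Tendsto (fun t : ℝ => |t⁻¹ * (θ (x + t • h) - θ x)| *
        (|θ (x + t • h) - θ x| * gr m (f x).deriv.deriv) +
        |t⁻¹ * (θ (x + t • h) - θ x) - τ| * gr m (f x).deriv) (𝓝[≠] 0) (𝓝 0) := by
      have h4 : Filter.Tendsto (fun t : ℝ => θ (x + t • h) - θ x) (𝓝[≠] 0) (𝓝 0) := by
        simpa using hθ.tendsto.sub_const (θ x)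
      have h5 : Filter.Tendsto (fun t : ℝ => t⁻¹ * (θ (x + t • h) - θ x)) (𝓝[≠] 0) (𝓝 τ) := hθ
      have h6 : Filter.Tendsto (fun t : ℝ => t⁻¹ * (θ (x + t • h) - θ x) - τ) (𝓝[≠] 0) (𝓝 0) := by
        simpa using h5.sub_const τ
      simpa using (h5.abs.mul (h4.abs.mul_const (gr m (f x).deriv.deriv))).add
        (h6.abs.mul_const (gr m (f x).deriv))
    refine squeeze_zero (fun _ => gr_nonneg _ _) (fun t => ?_) h3
    set δ := θ (x + t • h) - θ x
    have h4 : t⁻¹ • ((f x).rotate (Circle.exp δ) - f x) - τ • (f x).deriv =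
        t⁻¹ • ((f x).rotate (Circle.exp δ) - f x - δ • (f x).deriv) +
          (t⁻¹ * δ - τ) • (f x).deriv := by
      rw [smul_sub t⁻¹ _ (δ • (f x).deriv), sub_smul (t⁻¹ * δ), mul_smul]
      abel
    rw [h4]
    refine (map_add_le_add _ _ _).trans (add_le_add ?_ ?_)
    · rw [map_smul_eq_mul, abs_mul, mul_assoc]
      exact mul_le_mul_of_nonneg_left (gr_rotate_exp_sub_sub_le δ m (f x)) (norm_nonneg _)
    · rw [map_smul_eq_mul, Real.norm_eq_abs]
  have h3 := h1.add ((continuous_rotate.tendsto (Circle.exp (θ x), τ • (f x).deriv)).comp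
    (tendsto_const_nhds.prodMk_nhds h2))
  refine h3.congr fun t => ?_
  simp only [Function.comp_apply, rotate_smul, rotate_sub, rotate_rotate]
  rw [← Circle.exp_add, add_sub_cancel, ← smul_add]
  congr 1
  abel

end LoopSpace

end

/-! ### Smooth tameness of rotations, the scalar product of loops and the cocycle -/

section

theorem IsTameLinear.continuous {F G : Type*} [AddCommGroup F] [Module ℝ F] [TopologicalSpace F]
    [Graded F] [MonoGraded F] [AddCommGroup G] [Module ℝ G] [TopologicalSpace G] [Graded G]
    [MonoGraded G] (hF : WithSeminorms (Graded.gr : SeminormFamily ℝ F ℕ))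
    (hG : WithSeminorms (Graded.gr : SeminormFamily ℝ G ℕ)) {A : F →ₗ[ℝ] G} (hA : IsTameLinear A) :
    Continuous A :=
  WithSeminorms.continuous_of_isBounded hF hG A <| Seminorm.IsBounded.of_real fun n => by
    obtain ⟨m, C, -, h⟩ := hA.exists_le n
    exact ⟨{m}, C, fun x => by simpa using h x⟩

namespace LoopSpace

variable {n : ℕ}

/-- The derivative `∂_θ` as a continuous linear map. -/
def derivCLM (n : ℕ) : LoopSpace n →L[ℝ] LoopSpace n :=
  ⟨derivL n, isTameLinear_derivL.continuous withSeminorms withSeminorms⟩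

@[simp] theorem derivCLM_apply (η : LoopSpace n) : derivCLM n η = η.deriv := rfl

theorem continuous_deriv : Continuous (deriv : LoopSpace n → LoopSpace n) := (derivCLM n).continuous

/-! ### Smooth tameness of the rotation action -/

/-- The `k`-th derivative of `(η, s) ↦ η(e^{is} ·)`, rotated back. -/
def rotateTowerAux : ∀ k : ℕ, LoopSpace n → (Fin k → LoopSpace n × ℝ) → LoopSpace n
  | 0, η, _ => η
  | k + 1, η, v => (v (Fin.last k)).2 • (rotateTowerAux k η (Fin.init v)).deriv +
      (∏ j, (Fin.init v j).2) • deriv^[k] (v (Fin.last k)).1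

/-- The derivatives of `(η, s) ↦ η(e^{is} ·)`. -/
def rotateTower (k : ℕ) (z : LoopSpace n × ℝ) (v : Fin k → LoopSpace n × ℝ) : LoopSpace n :=
  (rotateTowerAux k z.1 v).rotate (Circle.exp z.2)

/-- Rotated back, the `k`-th derivative is affine in `η` with linear part `(∏ sⱼ) ∂_θᵏ`, where the
`sⱼ` are the angular components of the directions. Its derivative in `η` is therefore independent of
the base point. -/
theorem hasDirDeriv_rotateTowerAux : ∀ (k : ℕ) (v : Fin k → LoopSpace n × ℝ)
    (z h : LoopSpace n × ℝ), HasDirDeriv (fun z : LoopSpace n × ℝ => rotateTowerAux k z.1 v) z h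
      ((∏ j, (v j).2) • deriv^[k] h.1)
  | 0, v, z, h => by
    rw [Finset.univ_eq_empty, Finset.prod_empty, one_smul]
    exact hasDirDeriv_clm (ContinuousLinearMap.fst ℝ (LoopSpace n) ℝ) z h
  | k + 1, v, z, h => by
    have h1 := ((hasDirDeriv_rotateTowerAux k (Fin.init v) z h).clm_comp
      ((v (Fin.last k)).2 • derivCLM n)).add
      (hasDirDeriv_const ((∏ j, (Fin.init v j).2) • deriv^[k] (v (Fin.last k)).1) z h)
    rw [add_zero] at h1
    have h2 : (∏ j, (v j).2) • deriv^[k + 1] h.1 = ((v (Fin.last k)).2 • derivCLM n)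
        ((∏ j, (Fin.init v j).2) • deriv^[k] h.1) := by
      rw [Fin.prod_univ_castSucc, Function.iterate_succ_apply']
      simp [smul_smul, mul_comm, Fin.init]
    rw [h2]
    exact h1

theorem continuous_iterate_deriv (k : ℕ) : Continuous (deriv^[k] : LoopSpace n → LoopSpace n) :=
  continuous_deriv.iterate k

theorem continuous_rotateTowerAux : ∀ k : ℕ,
    Continuous fun z : (LoopSpace n × ℝ) × (Fin k → LoopSpace n × ℝ) =>
      rotateTowerAux k z.1.1 z.2
  | 0 => by
    simp only [rotateTowerAux]
    fun_prop
  | k + 1 => by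
    have hi : Continuous fun v : Fin (k + 1) → LoopSpace n × ℝ =>
        (Fin.init v : Fin k → LoopSpace n × ℝ) := continuous_pi fun i => continuous_apply _
    have h1 : Continuous fun z : (LoopSpace n × ℝ) × (Fin (k + 1) → LoopSpace n × ℝ) =>
        rotateTowerAux k z.1.1 (Fin.init z.2) :=
      (continuous_rotateTowerAux k).comp (f := fun z : (LoopSpace n × ℝ) ×
        (Fin (k + 1) → LoopSpace n × ℝ) => (z.1, (Fin.init z.2 : Fin k → LoopSpace n × ℝ)))
        (continuous_fst.prodMk (hi.comp continuous_snd))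
    have h2 : Continuous fun z : (LoopSpace n × ℝ) × (Fin (k + 1) → LoopSpace n × ℝ) =>
        deriv^[k] (z.2 (Fin.last k)).1 := (continuous_iterate_deriv k).comp (by fun_prop)
    simp only [rotateTowerAux, Fin.init]
    exact ((by fun_prop : Continuous fun z : (LoopSpace n × ℝ) ×
        (Fin (k + 1) → LoopSpace n × ℝ) => (z.2 (Fin.last k)).2).smul
          (continuous_deriv.comp h1)).add ((by fun_prop : Continuous fun z : (LoopSpace n × ℝ) ×
        (Fin (k + 1) → LoopSpace n × ℝ) => ∏ j : Fin k, (z.2 j.castSucc).2).smul h2)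

theorem isTameLinear_iterate_derivL : ∀ k : ℕ, ∃ A : LoopSpace n →ₗ[ℝ] LoopSpace n,
    IsTameLinear A ∧ ∀ η, A η = deriv^[k] η
  | 0 => ⟨LinearMap.id, isTameLinear_id, fun _ => rfl⟩
  | k + 1 => by
    obtain ⟨A, hA, h⟩ := isTameLinear_iterate_derivL k
    exact ⟨derivL n ∘ₗ A, isTameLinear_derivL.comp hA, fun η => by
      rw [Function.iterate_succ_apply', ← h]; rfl⟩

/-- At most `k` applications of `∂_θ` occur, each losing one degree, and they are multiplied by
angular components, which are locally bounded. -/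
theorem tameAt_rotateTowerAux : ∀ (k : ℕ) (z₀ : LoopSpace n × ℝ) (v₀ : Fin k → LoopSpace n × ℝ),
    TameAt (𝓝 (z₀, v₀)) (towerSize k)
      (fun z : (LoopSpace n × ℝ) × (Fin k → LoopSpace n × ℝ) => rotateTowerAux k z.1.1 z.2)
  | 0, z₀, v₀ => by
    refine TameAt.of_le fun m z => ?_
    exact (le_max_left (gr m z.1.1) (gr m z.1.2)).trans
      (le_add_of_nonneg_right (Finset.sum_nonneg fun _ _ => gr_nonneg _ _))
  | k + 1, z₀, v₀ => by
    have hi : Continuous fun v : Fin (k + 1) → LoopSpace n × ℝ =>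
        (Fin.init v : Fin k → LoopSpace n × ℝ) := continuous_pi fun i => continuous_apply _
    have hb : ∀ c : (LoopSpace n × ℝ) × (Fin (k + 1) → LoopSpace n × ℝ) → ℝ, Continuous c →
        ∀ᶠ z in 𝓝 (z₀, v₀), |c z| ≤ |c (z₀, v₀)| + 1 := fun c hc =>
      ((hc.abs.tendsto (z₀, v₀)).eventually (gt_mem_nhds (lt_add_one _))).mono fun _ h => le_of_lt h
    refine TameAt.add (isSize_towerSize _) (TameAt.smul ?_ (hb _ (by fun_prop)))
      (TameAt.smul ?_ (hb _ (by simp only [Fin.init]; fun_prop)))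
    · refine TameAt.linear isTameLinear_derivL ((tameAt_rotateTowerAux k z₀
        (Fin.init v₀)).comp_tendsto (isSize_towerSize _)
        (T := fun z : (LoopSpace n × ℝ) × (Fin (k + 1) → LoopSpace n × ℝ) =>
          (z.1, (Fin.init z.2 : Fin k → LoopSpace n × ℝ)))
        ((continuous_fst.prodMk (hi.comp continuous_snd)).tendsto (z₀, v₀))
        (r := 0) (b := 0) (K := fun _ => 1) (fun _ => zero_le_one) fun m _ z => ?_)
      simp only [towerSize, Fin.sum_univ_castSucc, Fin.init, add_zero, one_mul]
      linarith [gr_nonneg m (z.2 (Fin.last k))]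
    · obtain ⟨A, hA, h⟩ := isTameLinear_iterate_derivL (n := n) k
      simp only [← h]
      refine TameAt.linear hA (TameAt.of_le fun m z => ?_)
      refine (le_max_left (gr m (z.2 (Fin.last k)).1) (gr m (z.2 (Fin.last k)).2)).trans ?_
      refine le_trans ?_ (le_add_of_nonneg_left (gr_nonneg m z.1))
      exact Finset.single_le_sum (f := fun i => gr m (z.2 i)) (fun _ _ => gr_nonneg _ _)
        (Finset.mem_univ (Fin.last k))

theorem isDerivTower_rotate :
    IsDerivTower (fun z : LoopSpace n × ℝ => z.1.rotate (Circle.exp z.2)) Set.univ rotateTower where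
  zero _ _ _ := rfl
  succ k z _ v h := by
    have h1 := (hasDirDeriv_rotateTowerAux k v z h).rotate
      (hasDirDeriv_clm (ContinuousLinearMap.snd ℝ (LoopSpace n) ℝ) z h)
    have h2 : rotateTower (k + 1) z (Fin.snoc (α := fun _ => LoopSpace n × ℝ) v h) =
        ((∏ j, (v j).2) • deriv^[k] h.1 + h.2 • (rotateTowerAux k z.1 v).deriv).rotate
          (Circle.exp z.2) := by
      simp [rotateTower, rotateTowerAux, add_comm]
    rw [h2]
    exact h1
  cont k := (continuous_rotate.comp ((Circle.exp.continuous.comp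
    (continuous_snd.comp continuous_fst)).prodMk (continuous_rotateTowerAux k))).continuousOn

theorem isTameTower_rotate : IsTameTower Set.univ (rotateTower (n := n)) := by
  intro k z₀ _ v₀
  obtain ⟨r, b, C, hC, h⟩ := tameAt_rotateTowerAux k z₀ v₀
  refine ⟨r, b, C, hC, ?_⟩
  filter_upwards [h.filter_mono nhdsWithin_le_nhds] with z hz m hm
  rw [rotateTower, gr_rotate]
  exact hz m hm

/-! ### The scalar product of loops -/

/-- The bilinear form `1/2π ∫ ηᵀ S ζ dθ`. -/
def form (S : Matrix (Fin n) (Fin n) ℝ) (η ζ : LoopSpace n) : ℝ :=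
  (2 * Real.pi)⁻¹ * ∫ θ in (0 : ℝ)..2 * Real.pi,
    ∑ i, ∑ j, S i j * (η (Circle.exp θ) i).re * (ζ (Circle.exp θ) j).re

theorem continuous_form_integrand (S : Matrix (Fin n) (Fin n) ℝ) (η ζ : LoopSpace n) :
    Continuous fun θ : ℝ => ∑ i, ∑ j, S i j * (η (Circle.exp θ) i).re * (ζ (Circle.exp θ) j).re :=
  continuous_finsetSum _ fun i _ => continuous_finsetSum _ fun j _ =>
    (continuous_const.mul (continuous_loop η i)).mul (continuous_loop ζ j)

theorem form_add_left (S : Matrix (Fin n) (Fin n) ℝ) (η η' ζ : LoopSpace n) :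
    form S (η + η') ζ = form S η ζ + form S η' ζ := by
  rw [form, form, form, ← mul_add, ← intervalIntegral.integral_add
    ((continuous_form_integrand S η ζ).intervalIntegrable _ _)
    ((continuous_form_integrand S η' ζ).intervalIntegrable _ _)]
  simp only [add_apply, Pi.add_apply, Complex.add_re, mul_add, add_mul, Finset.sum_add_distrib]

theorem form_smul_left (S : Matrix (Fin n) (Fin n) ℝ) (c : ℝ) (η ζ : LoopSpace n) :
    form S (c • η) ζ = c * form S η ζ := by
  rw [form, form, mul_left_comm, ← intervalIntegral.integral_const_mul c]
  simp only [smul_apply, Pi.smul_apply, Complex.smul_re, smul_eq_mul, Finset.mul_sum]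
  congr 2
  funext θ
  refine Finset.sum_congr rfl fun i _ => Finset.sum_congr rfl fun j _ => by ring

theorem form_symm {S : Matrix (Fin n) (Fin n) ℝ} (hS : ∀ i j, S i j = S j i) (η ζ : LoopSpace n) :
    form S η ζ = form S ζ η := by
  rw [form, form]
  congr 2
  funext θ
  rw [Finset.sum_comm]
  refine Finset.sum_congr rfl fun i _ => Finset.sum_congr rfl fun j _ => ?_
  rw [hS j i]
  ring

theorem form_transpose (S : Matrix (Fin n) (Fin n) ℝ) (η ζ : LoopSpace n) :
    form S η ζ = form S.transpose ζ η := by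
  rw [form, form]
  congr 2
  funext θ
  rw [Finset.sum_comm]
  refine Finset.sum_congr rfl fun i _ => Finset.sum_congr rfl fun j _ => ?_
  rw [Matrix.transpose_apply]
  ring

/-- The bilinear form `1/2π ∫ ηᵀ S ζ dθ`, as a bilinear map. -/
def formL (S : Matrix (Fin n) (Fin n) ℝ) : LoopSpace n →ₗ[ℝ] LoopSpace n →ₗ[ℝ] ℝ :=
  LinearMap.mk₂ ℝ (form S) (form_add_left S) (form_smul_left S)
    (fun η ζ ζ' => by
      rw [form_transpose, form_add_left, ← form_transpose, ← form_transpose])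
    (fun c η ζ => by
      rw [form_transpose, form_smul_left, ← form_transpose, smul_eq_mul])

@[simp] theorem formL_apply (S : Matrix (Fin n) (Fin n) ℝ) (η ζ : LoopSpace n) :
    formL S η ζ = form S η ζ := rfl

theorem form_rotate (S : Matrix (Fin n) (Fin n) ℝ) (w : Circle) (η ζ : LoopSpace n) :
    form S (η.rotate w) (ζ.rotate w) = form S η ζ := by
  set f : ℝ → ℝ := fun θ => ∑ i, ∑ j, S i j * (η (Circle.exp θ) i).re * (ζ (Circle.exp θ) j).re
    with hf
  have h1 : ∀ θ : ℝ, (w : ℂ) * Circle.exp θ = Circle.exp (θ + Complex.arg w) := by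
    intro θ
    rw [Circle.exp_add, Circle.exp_arg, mul_comm, Circle.coe_mul]
  have h2 : form S (η.rotate w) (ζ.rotate w) = (2 * Real.pi)⁻¹ *
      ∫ θ in (0 : ℝ)..2 * Real.pi, f (θ + Complex.arg w) := by
    simp only [form, hf, rotate_apply, h1]
  have hper : Function.Periodic f (2 * Real.pi) := by
    intro θ
    simp only [hf, Circle.periodic_exp θ]
  have h3 := hper.intervalIntegral_add_eq (Complex.arg w) 0
  rw [zero_add] at h3
  rw [h2, intervalIntegral.integral_comp_add_right f, zero_add, add_comm (2 * Real.pi), h3]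
  rfl

theorem abs_re_le (η : LoopSpace n) (m : ℕ) (θ : ℝ) (i : Fin n) :
    |(η (Circle.exp θ) i).re| ≤ gr m η :=
  (Complex.abs_re_le_norm _).trans ((norm_le_pi_norm _ i).trans
    (η.norm_apply_le (mem_annulus_of_norm_eq_one (Circle.norm_coe _) m)))

theorem abs_form_le (S : Matrix (Fin n) (Fin n) ℝ) (η ζ : LoopSpace n) :
    |form S η ζ| ≤ (∑ i, ∑ j, |S i j|) * gr 0 η * gr 0 ζ := by
  have hπ : 0 < 2 * Real.pi := by positivity
  have h1 := intervalIntegral.norm_integral_le_of_norm_le_const (a := 0) (b := 2 * Real.pi)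
    (f := fun θ : ℝ => ∑ i, ∑ j, S i j * (η (Circle.exp θ) i).re * (ζ (Circle.exp θ) j).re)
    (C := (∑ i, ∑ j, |S i j|) * gr 0 η * gr 0 ζ) fun θ _ => by
      rw [Finset.sum_mul, Finset.sum_mul]
      refine (norm_sum_le _ _).trans (Finset.sum_le_sum fun i _ => ?_)
      rw [Finset.sum_mul, Finset.sum_mul]
      refine (norm_sum_le _ _).trans (Finset.sum_le_sum fun j _ => ?_)
      rw [norm_mul, norm_mul]
      exact mul_le_mul (mul_le_mul_of_nonneg_left (abs_re_le η 0 θ i) (abs_nonneg _))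
        (abs_re_le ζ 0 θ j) (abs_nonneg _) (mul_nonneg (abs_nonneg _) (gr_nonneg _ _))
  rw [sub_zero, abs_of_pos hπ] at h1
  rw [form, abs_mul, abs_of_pos (inv_pos.2 hπ), inv_mul_le_iff₀ hπ, mul_comm (2 * Real.pi)]
  exact h1

theorem continuous_form (S : Matrix (Fin n) (Fin n) ℝ) :
    Continuous fun z : LoopSpace n × LoopSpace n => formL S z.1 z.2 := by
  set K := ∑ i, ∑ j, |S i j|
  refine continuous_iff_continuousAt.2 fun ⟨x, y⟩ => ?_
  rw [ContinuousAt, tendsto_iff_norm_sub_tendsto_zero]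
  have h1 : Filter.Tendsto (fun z : LoopSpace n × LoopSpace n =>
      K * gr 0 (z.1 - x) * gr 0 z.2 + K * gr 0 x * gr 0 (z.2 - y)) (𝓝 (x, y)) (𝓝 0) := by
    have h2 : Continuous fun z : LoopSpace n × LoopSpace n =>
        K * gr 0 (z.1 - x) * gr 0 z.2 + K * gr 0 x * gr 0 (z.2 - y) := by
      have h3 := (continuous_gr 0).comp (f := fun z : LoopSpace n × LoopSpace n => z.1 - x)
        (by fun_prop)
      have h4 := (continuous_gr 0).comp (f := fun z : LoopSpace n × LoopSpace n => z.2 - y)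
        (by fun_prop)
      have h5 := (continuous_gr 0).comp (f := fun z : LoopSpace n × LoopSpace n => z.2)
        (by fun_prop)
      exact ((continuous_const.mul h3).mul h5).add (continuous_const.mul h4)
    simpa using h2.tendsto (x, y)
  refine squeeze_zero (fun _ => norm_nonneg _) (fun z => ?_) h1
  have h2 : formL S z.1 z.2 - formL S x y = formL S (z.1 - x) z.2 + formL S x (z.2 - y) := by
    simp only [map_sub, LinearMap.sub_apply]
    abel
  rw [h2]
  exact (norm_add_le _ _).trans (add_le_add (abs_form_le S _ _) (abs_form_le S _ _))

theorem hasDerivAt_re_rotate (η : LoopSpace n) (θ : ℝ) (i : Fin n) :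
    HasDerivAt (fun θ : ℝ => (η (Circle.exp θ) i).re) (η.deriv (Circle.exp θ) i).re θ := by
  have h := hasDerivAt_rotate_apply η 1 θ
  simp only [mul_one] at h
  exact Complex.reCLM.hasFDerivAt.comp_hasDerivAt θ (hasDerivAt_pi.1 h i)

/-- Integration by parts; the boundary terms at `0` and `2π` cancel by periodicity. The antisymmetry
of `ω`, and hence the symmetry of the space, depends on this. -/
theorem form_deriv (S : Matrix (Fin n) (Fin n) ℝ) (η ζ : LoopSpace n) :
    form S η.deriv ζ = -form S η ζ.deriv := by
  have h1 : ∀ θ : ℝ, HasDerivAt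
      (fun θ : ℝ => ∑ i, ∑ j, S i j * (η (Circle.exp θ) i).re * (ζ (Circle.exp θ) j).re)
      ((∑ i, ∑ j, S i j * (η.deriv (Circle.exp θ) i).re * (ζ (Circle.exp θ) j).re) +
        ∑ i, ∑ j, S i j * (η (Circle.exp θ) i).re * (ζ.deriv (Circle.exp θ) j).re) θ := by
    intro θ
    simp only [← Finset.sum_add_distrib]
    refine HasDerivAt.fun_sum fun i _ => HasDerivAt.fun_sum fun j _ => ?_
    exact ((hasDerivAt_re_rotate η θ i).const_mul (S i j)).mul (hasDerivAt_re_rotate ζ θ j)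
  have i1 := (continuous_form_integrand S η.deriv ζ).intervalIntegrable
    (μ := MeasureTheory.volume) 0 (2 * Real.pi)
  have i2 := (continuous_form_integrand S η ζ.deriv).intervalIntegrable
    (μ := MeasureTheory.volume) 0 (2 * Real.pi)
  have h2 := intervalIntegral.integral_eq_sub_of_hasDerivAt (a := 0) (b := 2 * Real.pi)
    (fun θ _ => h1 θ) (i1.add i2)
  rw [intervalIntegral.integral_add i1 i2] at h2
  simp only [Circle.exp_two_pi, Circle.exp_zero, sub_self] at h2
  rw [form, form, ← mul_neg, eq_neg_of_add_eq_zero_left h2]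

/-- The integrand is nonnegative and continuous. A nonzero loop is nonzero somewhere on the unit
circle by the identity theorem, and its value there is real, so positive definiteness of `S` makes
the integrand positive at that point. -/
theorem form_nonneg_and {S : Matrix (Fin n) (Fin n) ℝ} (hS : S.PosDef) (η : LoopSpace n) :
    0 ≤ form S η η ∧ (form S η η = 0 → η = 0) := by
  have hπ : 0 < 2 * Real.pi := by positivity
  have hval : ∀ x : Fin n → ℝ, ∑ i, ∑ j, S i j * x i * x j = star x ⬝ᵥ S.mulVec x := fun x => by
    simp only [dotProduct, Matrix.mulVec, Finset.mul_sum, Pi.star_apply, star_trivial]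
    refine Finset.sum_congr rfl fun i _ => Finset.sum_congr rfl fun j _ => by ring
  have hnn : ∀ θ : ℝ, 0 ≤ ∑ i, ∑ j, S i j * (η (Circle.exp θ) i).re * (η (Circle.exp θ) j).re :=
    fun θ => by
      have h1 := hval fun i => (η (Circle.exp θ) i).re
      rw [h1]
      by_cases h0 : (fun i => (η (Circle.exp θ) i).re) = 0
      · rw [h0]; simp
      · exact (hS.dotProduct_mulVec_pos h0).le
  refine ⟨mul_nonneg (inv_pos.2 hπ).le (intervalIntegral.integral_nonneg hπ.le fun θ _ => hnn θ),
    fun h => ext_circle fun z hz => ?_⟩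
  by_contra hne
  have hpos := intervalIntegral.integral_pos hπ
    (continuous_form_integrand S η η).continuousOn (fun θ _ => hnn θ) (by
      -- The principal argument lies in `(-π, π]`; negative values are shifted by `2π` into the
      -- interval of integration.
      obtain ⟨θ, hθ, rfl⟩ : ∃ θ ∈ Set.Icc 0 (2 * Real.pi), (Circle.exp θ : ℂ) = z := by
        have hz' : (Circle.exp (Complex.arg z) : ℂ) = z := by
          rw [Circle.coe_exp]; simpa [hz] using Complex.norm_mul_exp_arg_mul_I z
        rcases le_total 0 (Complex.arg z) with h0 | h0
        · exact ⟨_, ⟨h0, by linarith [Complex.arg_le_pi z]⟩, hz'⟩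
        · refine ⟨Complex.arg z + 2 * Real.pi, ⟨by linarith [Complex.neg_pi_lt_arg z], by linarith⟩,
            ?_⟩
          rw [Circle.exp_add, Circle.exp_two_pi, mul_one, hz']
      refine ⟨θ, hθ, ?_⟩
      have h1 := hval fun i => (η (Circle.exp θ) i).re
      rw [h1]
      refine hS.dotProduct_mulVec_pos fun h0 => hne ?_
      funext i
      exact Complex.ext (congrFun h0 i) (η.im_apply (Circle.norm_coe _) i))
  rw [form] at h
  rcases mul_eq_zero.1 h with h2 | h2
  · exact (inv_pos.2 hπ).ne' h2
  · exact hpos.ne' h2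

end LoopSpace

/-! ### The cocycle and the metric on tangent vectors -/

variable {n : ℕ}

theorem omega_eq_form (q : Matrix (Fin n) (Fin n) ℤ) (η ζ : LoopSpace n) :
    omega q η ζ = LoopSpace.form (gram 1 q) η ζ.deriv := by
  rw [omega, LoopSpace.form]
  congr 2
  funext θ
  refine Finset.sum_congr rfl fun i _ => Finset.sum_congr rfl fun j _ => ?_
  have h1 : angularDeriv ζ θ j = (ζ.deriv (Circle.exp θ) j).re := by
    rw [angularDeriv, LoopSpace.deriv_apply, deriv_pi]
    · rfl
    · exact fun i => differentiableAt_loop ζ i (Circle.coe_ne_zero _)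
  rw [h1, gram]
  push_cast
  ring

theorem gram_symm (p : ℝ) (q : Matrix (Fin n) (Fin n) ℤ) (i j : Fin n) :
    gram p q i j = gram p q j i := by
  simp only [gram, add_comm]

theorem gram_eq_mul (p : ℝ) (q : Matrix (Fin n) (Fin n) ℤ) (i j : Fin n) :
    gram p q i j = p * gram 1 q i j := by
  simp only [gram, one_mul]

theorem omega_antisymm (q : Matrix (Fin n) (Fin n) ℤ) (η ζ : LoopSpace n) :
    omega q η ζ = -omega q ζ η := by
  rw [omega_eq_form, omega_eq_form, LoopSpace.form_symm (gram_symm 1 q), LoopSpace.form_deriv]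

theorem omega_self (q : Matrix (Fin n) (Fin n) ℤ) (η : LoopSpace n) : omega q η η = 0 := by
  linarith [omega_antisymm q η η]

/-- The cocycle `ω` as a bilinear map. -/
def omegaL (q : Matrix (Fin n) (Fin n) ℤ) : LoopSpace n →ₗ[ℝ] LoopSpace n →ₗ[ℝ] ℝ :=
  (LoopSpace.formL (gram 1 q)).compl₂ (LoopSpace.derivL n)

@[simp] theorem omegaL_apply (q : Matrix (Fin n) (Fin n) ℤ) (η ζ : LoopSpace n) :
    omegaL q η ζ = omega q η ζ := by
  rw [omega_eq_form]; rfl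

theorem continuous_omegaL (q : Matrix (Fin n) (Fin n) ℤ) :
    Continuous fun z : LoopSpace n × LoopSpace n => omegaL q z.1 z.2 :=
  (LoopSpace.continuous_form (gram 1 q)).comp (f := fun z : LoopSpace n × LoopSpace n =>
    (z.1, z.2.deriv)) (continuous_fst.prodMk (LoopSpace.continuous_deriv.comp continuous_snd))

theorem continuous_omega (q : Matrix (Fin n) (Fin n) ℤ) :
    Continuous fun z : LoopSpace n × LoopSpace n => omega q z.1 z.2 := by
  simpa using continuous_omegaL q

/-- The bilinear form `xᵀ S y`. -/
def vecFormL (S : Matrix (Fin n) (Fin n) ℝ) : (Fin n → ℝ) →ₗ[ℝ] (Fin n → ℝ) →ₗ[ℝ] ℝ :=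
  Matrix.toLinearMap₂' ℝ S

theorem vecFormL_apply (S : Matrix (Fin n) (Fin n) ℝ) (x y : Fin n → ℝ) :
    vecFormL S x y = ∑ i, ∑ j, S i j * x i * y j := by
  rw [vecFormL, Matrix.toLinearMap₂'_apply]
  refine Finset.sum_congr rfl fun i _ => Finset.sum_congr rfl fun j _ => by
    simp only [smul_eq_mul]; ring

theorem continuous_vecFormL (S : Matrix (Fin n) (Fin n) ℝ) :
    Continuous fun z : (Fin n → ℝ) × (Fin n → ℝ) => vecFormL S z.1 z.2 := by
  simp only [vecFormL_apply]
  fun_prop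

theorem vecFormL_symm {S : Matrix (Fin n) (Fin n) ℝ} (hS : ∀ i j, S i j = S j i)
    (x y : Fin n → ℝ) : vecFormL S x y = vecFormL S y x := by
  rw [vecFormL_apply, vecFormL_apply, Finset.sum_comm]
  refine Finset.sum_congr rfl fun i _ => Finset.sum_congr rfl fun j _ => ?_
  rw [hS j i]
  ring

theorem vecFormL_nonneg_and {S : Matrix (Fin n) (Fin n) ℝ} (hS : S.PosDef) (x : Fin n → ℝ) :
    0 ≤ vecFormL S x x ∧ (vecFormL S x x = 0 → x = 0) := by
  have hval : vecFormL S x x = star x ⬝ᵥ S.mulVec x := by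
    rw [vecFormL_apply]
    simp only [dotProduct, Matrix.mulVec, Finset.mul_sum, Pi.star_apply, star_trivial]
    refine Finset.sum_congr rfl fun i _ => Finset.sum_congr rfl fun j _ => by ring
  by_cases h0 : x = 0
  · rw [h0]; simp
  · have := hS.dotProduct_mulVec_pos h0
    rw [hval]
    exact ⟨this.le, fun h => absurd h this.ne'⟩

theorem integral_re_loop (η : LoopSpace n) (i : Fin n) :
    ∫ θ in (0 : ℝ)..2 * Real.pi, (η (Circle.exp θ) i).re = 0 := by
  have h1 := η.integral_eq_zero
  have hc := LoopSpace.continuous_comp_exp η.differentiableOn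
  have h2 := (Complex.reCLM.comp (ContinuousLinearMap.proj (R := ℂ) (φ := fun _ : Fin n => ℂ)
    i |>.restrictScalars ℝ)).intervalIntegral_comp_comm (hc.intervalIntegrable
      (μ := MeasureTheory.volume) 0 (2 * Real.pi))
  rw [h1, map_zero] at h2
  exact h2

/-- Constant loops are orthogonal to loops with mean value zero, so the mixed terms of the integral
vanish and the scalar product is an orthogonal sum. The common factor `p` comes out, which lets the
later computations use the integral matrix `q + qᵀ` alone. -/
theorem kmForm_eq (p : ℝ) (q : Matrix (Fin n) (Fin n) ℤ) (X Y : Model n) :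
    kmForm p q X Y = p * (vecFormL (gram 1 q) X.1 Y.1 + LoopSpace.form (gram 1 q) X.2.1 Y.2.1 -
      X.2.2.1 * Y.2.2.2 - X.2.2.2 * Y.2.2.1) := by
  have hπ : 2 * Real.pi ≠ 0 := by positivity
  have c1 := continuous_loop X.2.1
  have c2 := continuous_loop Y.2.1
  have e : ∀ θ : ℝ, ∑ i, ∑ j, gram p q i j * (X.1 i + (X.2.1 (Circle.exp θ) i).re) *
      (Y.1 j + (Y.2.1 (Circle.exp θ) j).re) =
      p * (∑ i, ∑ j, gram 1 q i j * X.1 i * Y.1 j +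
        ∑ i, ∑ j, gram 1 q i j * (X.2.1 (Circle.exp θ) i).re * (Y.2.1 (Circle.exp θ) j).re) +
      (∑ i, ∑ j, (p * gram 1 q i j * X.1 i) * (Y.2.1 (Circle.exp θ) j).re +
        ∑ i, ∑ j, (p * gram 1 q i j * Y.1 j) * (X.2.1 (Circle.exp θ) i).re) := by
    intro θ
    rw [mul_add, Finset.mul_sum, Finset.mul_sum]
    simp only [Finset.mul_sum]
    rw [← Finset.sum_add_distrib, ← Finset.sum_add_distrib, ← Finset.sum_add_distrib]
    refine Finset.sum_congr rfl fun i _ => ?_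
    rw [← Finset.sum_add_distrib, ← Finset.sum_add_distrib, ← Finset.sum_add_distrib]
    refine Finset.sum_congr rfl fun j _ => ?_
    rw [gram_eq_mul p q i j]
    ring
  have i0 : ∀ (η : LoopSpace n) (c : ℝ) (i : Fin n), IntervalIntegrable
      (fun θ : ℝ => c * (η (Circle.exp θ) i).re) MeasureTheory.volume 0 (2 * Real.pi) := fun η c i =>
    (continuous_const.mul (continuous_loop η i)).intervalIntegrable _ _
  have z1 : ∫ θ in (0 : ℝ)..2 * Real.pi, (∑ i, ∑ j, (p * gram 1 q i j * X.1 i) *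
      (Y.2.1 (Circle.exp θ) j).re + ∑ i, ∑ j, (p * gram 1 q i j * Y.1 j) *
      (X.2.1 (Circle.exp θ) i).re) = 0 := by
    rw [intervalIntegral.integral_add]
    · rw [intervalIntegral.integral_finsetSum, intervalIntegral.integral_finsetSum]
      · rw [Finset.sum_eq_zero, Finset.sum_eq_zero, add_zero]
        · intro i _
          rw [intervalIntegral.integral_finsetSum fun j _ => i0 _ _ _]
          exact Finset.sum_eq_zero fun j _ => by
            rw [intervalIntegral.integral_const_mul, integral_re_loop, mul_zero]
        · intro i _
          rw [intervalIntegral.integral_finsetSum fun j _ => i0 _ _ _]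
          exact Finset.sum_eq_zero fun j _ => by
            rw [intervalIntegral.integral_const_mul, integral_re_loop, mul_zero]
      all_goals
        intro i _
        exact (continuous_finsetSum _ fun j _ => continuous_const.mul
          (continuous_loop _ _)).intervalIntegrable _ _
    all_goals
      exact (continuous_finsetSum _ fun i _ => continuous_finsetSum _ fun j _ =>
        continuous_const.mul (continuous_loop _ _)).intervalIntegrable _ _
  have c3 : Continuous fun θ : ℝ => p * (∑ i, ∑ j, gram 1 q i j * X.1 i * Y.1 j +
        ∑ i, ∑ j, gram 1 q i j * (X.2.1 (Circle.exp θ) i).re * (Y.2.1 (Circle.exp θ) j).re) :=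
    continuous_const.mul (continuous_const.add (LoopSpace.continuous_form_integrand _ _ _))
  have c4 : Continuous fun θ : ℝ => ∑ i, ∑ j, (p * gram 1 q i j * X.1 i) *
      (Y.2.1 (Circle.exp θ) j).re + ∑ i, ∑ j, (p * gram 1 q i j * Y.1 j) *
      (X.2.1 (Circle.exp θ) i).re := by
    fun_prop
  rw [kmForm]
  simp only [e]
  rw [intervalIntegral.integral_add (c3.intervalIntegrable _ _) (c4.intervalIntegrable _ _), z1,
    intervalIntegral.integral_const_mul, intervalIntegral.integral_add
      (continuous_const.intervalIntegrable _ _)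
      ((LoopSpace.continuous_form_integrand _ _ _).intervalIntegrable _ _),
    intervalIntegral.integral_const, vecFormL_apply, LoopSpace.form]
  simp only [sub_zero, smul_eq_mul, add_zero]
  field_simp

end

/-! ### Laurent series and the tame Fréchet property -/

section

/-! ## Laurent series of loops -/

theorem gr_expSeq {B : Type*} [NormedAddCommGroup B] [NormedSpace ℝ B] (m : ℕ) (f : expSeq B) :
    gr m f = ∑' k : ℕ, Real.exp (m * k) * ‖f.1 k‖ := rfl

instance (B : Type*) [NormedAddCommGroup B] [NormedSpace ℝ B] : MonoGraded (expSeq B) :=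
  ⟨fun m f => by
    rw [gr_expSeq, gr_expSeq]
    refine Summable.tsum_le_tsum (fun k => ?_) (f.2 m) (f.2 (m + 1))
    refine mul_le_mul_of_nonneg_right (Real.exp_le_exp.2 ?_) (norm_nonneg _)
    exact mul_le_mul_of_nonneg_right (Nat.cast_le.2 (Nat.le_succ m)) (Nat.cast_nonneg k)⟩

namespace LoopSpace

variable {n : ℕ}

/-- The `k`-th Laurent coefficient of a loop. -/
def coeff (k : ℤ) (η : LoopSpace n) : Fin n → ℂ :=
  (2 * Real.pi)⁻¹ • ∫ θ in (0 : ℝ)..2 * Real.pi, ((Circle.exp θ : ℂ) ^ (-k)) • η (Circle.exp θ)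

theorem continuous_coeff_integrand (k : ℤ) (η : LoopSpace n) :
    Continuous fun θ : ℝ => ((Circle.exp θ : ℂ) ^ (-k)) • η (Circle.exp θ) :=
  ((continuous_subtype_val.comp Circle.exp.continuous).zpow₀ _
    fun _ => Or.inl (Circle.coe_ne_zero _)).smul (continuous_comp_exp η.differentiableOn)

theorem coeff_add (k : ℤ) (η ζ : LoopSpace n) : coeff k (η + ζ) = coeff k η + coeff k ζ := by
  rw [coeff, coeff, coeff, ← smul_add, ← intervalIntegral.integral_add
    ((continuous_coeff_integrand k η).intervalIntegrable _ _)
    ((continuous_coeff_integrand k ζ).intervalIntegrable _ _)]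
  simp only [add_apply, smul_add]

theorem coeff_smul (k : ℤ) (c : ℝ) (η : LoopSpace n) : coeff k (c • η) = c • coeff k η := by
  rw [coeff, coeff, smul_comm c, ← intervalIntegral.integral_smul c]
  simp only [smul_apply]
  congr 2
  funext θ
  rw [smul_comm]

/-- The integrand is holomorphic on `ℂ^*`, so by Cauchy's theorem the circle may have any radius.
The freedom in `R` is what produces the decay of the coefficients. -/
theorem coeff_eq_circleIntegral (k : ℤ) (η : LoopSpace n) {R : ℝ} (hR : 0 < R) :
    coeff k η = (2 * Real.pi * Complex.I : ℂ)⁻¹ • ∮ z in C(0, R), z ^ (-k - 1) • η z := by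
  have hd : DifferentiableOn ℂ (fun z => z ^ (-k - 1) • η z) {0}ᶜ := fun z hz =>
    ((differentiableAt_zpow.2 (Or.inl hz)).differentiableWithinAt).smul (η.differentiableOn z hz)
  have key : ∀ r R : ℝ, 0 < r → r ≤ R → (∮ z in C(0, R), z ^ (-k - 1) • η z) =
      ∮ z in C(0, r), z ^ (-k - 1) • η z := fun r R hr hrR =>
    Complex.circleIntegral_eq_of_differentiable_on_annulus_off_countable hr hrR
      Set.countable_empty (hd.continuousOn.mono fun z hz h0 => hz.2 (by
        rw [Set.mem_singleton_iff.1 h0]; exact Metric.mem_ball_self hr))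
      (fun z hz => (hd z (fun h0 => hz.1.2 (by
        rw [Set.mem_singleton_iff.1 h0]; exact Metric.mem_closedBall_self hr.le))).differentiableAt
          (isOpen_compl_singleton.mem_nhds (fun h0 => hz.1.2 (by
        rw [Set.mem_singleton_iff.1 h0]; exact Metric.mem_closedBall_self hr.le))))
  have h1 : (∮ z in C(0, R), z ^ (-k - 1) • η z) = ∮ z in C(0, 1), z ^ (-k - 1) • η z := by
    rcases le_total 1 R with h | h
    · exact key 1 R one_pos h
    · exact (key R 1 hR h).symm
  rw [h1, circleIntegral, coeff]
  have h2 : ∀ θ : ℝ, _root_.deriv (circleMap 0 1) θ • ((circleMap 0 1 θ) ^ (-k - 1) •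
      η (circleMap 0 1 θ)) = Complex.I • (((Circle.exp θ : ℂ) ^ (-k)) • η (Circle.exp θ)) := by
    intro θ
    have h3 : circleMap 0 1 θ = (Circle.exp θ : ℂ) := by simp [circleMap, Circle.coe_exp]
    rw [deriv_circleMap, h3, smul_smul, smul_smul, zpow_sub_one₀ (Circle.coe_ne_zero _)]
    congr 1
    have := Circle.coe_ne_zero (Circle.exp θ)
    field_simp
  simp only [h2]
  rw [intervalIntegral.integral_smul, smul_smul, mul_inv (2 * (Real.pi : ℂ)),
    inv_mul_cancel_right₀ Complex.I_ne_zero,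
    ← Complex.coe_smul]
  push_cast
  rfl

/-- The largest circle of the annulus, of radius `e^m`, gives the decay for nonnegative indices, and
the smallest, of radius `e^{-m}`, for nonpositive ones. -/
theorem norm_coeff_le (k : ℕ) (m : ℕ) (η : LoopSpace n) :
    ‖coeff k η‖ ≤ Real.exp (-(m * k)) * gr m η ∧
      ‖coeff (-k) η‖ ≤ Real.exp (-(m * k)) * gr m η := by
  have key : ∀ (k : ℤ) (R : ℝ), 0 < R → (∀ z : ℂ, ‖z‖ = R → z ∈ annulus m) →
      ‖coeff k η‖ ≤ R ^ (-k) * gr m η := by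
    intro k R hR h
    rw [coeff_eq_circleIntegral k η hR]
    have h1 := circleIntegral.norm_two_pi_i_inv_smul_integral_le_of_norm_le_const (c := 0) hR.le
      (f := fun z => z ^ (-k - 1) • η z) (C := R ^ (-k - 1) * gr m η) fun z hz => by
        rw [mem_sphere_zero_iff_norm] at hz
        rw [norm_smul, norm_zpow, hz]
        exact mul_le_mul_of_nonneg_left (η.norm_apply_le (h z hz)) (zpow_pos hR _).le
    refine h1.trans (le_of_eq ?_)
    rw [zpow_sub_one₀ hR.ne']
    field_simp
  have hm : (0 : ℝ) ≤ m := Nat.cast_nonneg m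
  constructor
  · have h := key k (Real.exp m) (Real.exp_pos _) fun z hz =>
      ⟨by rw [hz]; exact Real.exp_le_exp.2 (by linarith), hz.le⟩
    rw [← Real.rpow_intCast, ← Real.exp_mul] at h
    convert h using 3
    push_cast
    ring
  · have h := key (-k) (Real.exp (-m)) (Real.exp_pos _) fun z hz =>
      ⟨hz.ge, by rw [hz]; exact Real.exp_le_exp.2 (by linarith)⟩
    rw [← Real.rpow_intCast, ← Real.exp_mul] at h
    convert h using 3
    push_cast
    ring

theorem coeff_zero (η : LoopSpace n) : coeff 0 η = 0 := by
  have h := η.integral_eq_zero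
  simp only [coeff, neg_zero, zpow_zero, one_smul, h, smul_zero]

/-- The loop is real on the unit circle. Together with the vanishing of the zeroth coefficient this
makes the coefficients of positive index a complete set of data. -/
theorem coeff_neg_apply (k : ℤ) (η : LoopSpace n) (j : Fin n) :
    coeff (-k) η j = conj (coeff k η j) := by
  have h1 : ∀ k : ℤ, coeff k η j = (2 * Real.pi)⁻¹ • ∫ θ in (0 : ℝ)..2 * Real.pi,
      ((Circle.exp θ : ℂ) ^ (-k)) • η (Circle.exp θ) j := by
    intro k
    have h2 := (ContinuousLinearMap.proj (R := ℂ) (φ := fun _ : Fin n => ℂ)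
      j).intervalIntegral_comp_comm ((continuous_coeff_integrand k η).intervalIntegrable
        (μ := MeasureTheory.volume) 0 (2 * Real.pi))
    rw [coeff, Pi.smul_apply]
    congr 1
    exact h2.symm
  rw [h1, h1, Complex.real_smul, Complex.real_smul, map_mul, Complex.conj_ofReal]
  congr 1
  rw [← Complex.conjCLE_apply, ← ContinuousLinearEquiv.coe_coe,
    ← ContinuousLinearMap.intervalIntegral_comp_comm]
  · congr 1
    funext θ
    have h3 : conj (η (Circle.exp θ) j) = η (Circle.exp θ) j :=
      Complex.conj_eq_iff_im.2 (η.im_apply (Circle.norm_coe _) j)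
    simp only [ContinuousLinearEquiv.coe_coe, Complex.conjCLE_apply, smul_eq_mul, map_mul,
      map_zpow₀, h3, ← Circle.coe_inv_eq_conj]
    simp
  · exact (((continuous_apply j).comp (continuous_coeff_integrand k η))).intervalIntegrable _ _

/-- On the unit circle the Laurent series is the Fourier series. The coefficients are dominated by
`e^{-|k|}`, hence summable, so the series converges pointwise to the continuous function. -/
theorem hasSum_coeff (η : LoopSpace n) (θ : ℝ) (j : Fin n) :
    HasSum (fun k : ℤ => coeff k η j * (Circle.exp θ : ℂ) ^ k) (η (Circle.exp θ) j) := by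
  have : Fact (0 < 2 * Real.pi) := ⟨by positivity⟩
  let g : C(AddCircle (2 * Real.pi), ℂ) :=
    ⟨fun x => η (AddCircle.toCircle x) j, by
      have h1 : Continuous fun x : AddCircle (2 * Real.pi) => η (AddCircle.toCircle x) :=
        η.differentiableOn.continuousOn.comp_continuous
          (continuous_subtype_val.comp AddCircle.continuous_toCircle)
          (fun _ => Circle.coe_ne_zero _)
      exact (continuous_apply j).comp h1⟩
  have ht : ∀ x : ℝ, (AddCircle.toCircle (x : AddCircle (2 * Real.pi))) = Circle.exp x := by
    intro x
    rw [AddCircle.toCircle_apply_mk, div_self (by positivity), one_mul]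
  have hf : ∀ (k : ℤ) (x : ℝ), fourier k (x : AddCircle (2 * Real.pi)) =
      (Circle.exp x : ℂ) ^ k := by
    intro k x
    rw [fourier_apply, AddCircle.toCircle_zsmul, ht, Circle.coe_zpow]
  have hc : ∀ k, fourierCoeff g k = coeff k η j := by
    intro k
    rw [fourierCoeff_eq_intervalIntegral g k 0, zero_add, coeff, Pi.smul_apply, one_div]
    congr 1
    have h2 := (ContinuousLinearMap.proj (R := ℂ) (φ := fun _ : Fin n => ℂ)
      j).intervalIntegral_comp_comm ((continuous_coeff_integrand k η).intervalIntegrable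
        (μ := MeasureTheory.volume) 0 (2 * Real.pi))
    refine Eq.trans ?_ h2
    refine intervalIntegral.integral_congr fun x _ => ?_
    rw [hf]
    change _ • η (AddCircle.toCircle (x : AddCircle (2 * Real.pi))) j = _
    rw [ht]
    rfl
  have hs : Summable (fourierCoeff g) := by
    have h0 : Summable fun k : ℕ => Real.exp (-1 * k) * gr 1 η :=
      (Real.summable_exp_nat_mul_iff.2 (by norm_num : (-1 : ℝ) < 0) |>.congr fun k => by
        rw [mul_comm]).mul_right _
    refine Summable.of_nat_of_neg ?_ ?_
    · refine Summable.of_norm_bounded h0 fun k => ?_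
      rw [hc]
      refine (norm_le_pi_norm _ j).trans ((norm_coeff_le k 1 η).1.trans (le_of_eq ?_))
      simp
    · refine Summable.of_norm_bounded h0 fun k => ?_
      rw [hc]
      refine (norm_le_pi_norm _ j).trans ((norm_coeff_le k 1 η).2.trans (le_of_eq ?_))
      simp
  have h := has_pointwise_sum_fourier_series_of_summable hs (θ : AddCircle (2 * Real.pi))
  simp only [hc, hf, smul_eq_mul] at h
  change HasSum _ (η (AddCircle.toCircle (θ : AddCircle (2 * Real.pi))) j) at h
  rwa [ht] at h

theorem integral_exp_zpow_eq_zero {k : ℤ} (hk : k ≠ 0) :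
    ∫ θ in (0 : ℝ)..2 * Real.pi, (Circle.exp θ : ℂ) ^ k = 0 := by
  have hc : (k : ℂ) * Complex.I ≠ 0 := mul_ne_zero (Int.cast_ne_zero.2 hk) Complex.I_ne_zero
  have h1 : ∀ θ : ℝ, (Circle.exp θ : ℂ) ^ k = Complex.exp ((k * Complex.I) * θ) := by
    intro θ
    rw [Circle.coe_exp, ← Complex.exp_int_mul]
    ring_nf
  simp only [h1]
  rw [integral_exp_mul_complex hc]
  have h2 : (k : ℂ) * Complex.I * ((2 * Real.pi : ℝ) : ℂ) = k * (2 * Real.pi * Complex.I) := by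
    push_cast; ring
  rw [h2, Complex.exp_int_mul_two_pi_mul_I]
  simp

/-- The loop `a z^{k+1} + \bar a z^{-k-1}`. -/
def monomial (k : ℕ) (a : Fin n → ℂ) : LoopSpace n :=
  ⟨fun z => z ^ ((k : ℤ) + 1) • a + z ^ (-((k : ℤ) + 1)) • star a, by
    have hk : (k : ℤ) + 1 ≠ 0 := by positivity
    refine ⟨by dsimp only; rw [zero_zpow _ hk, zero_zpow _ (neg_ne_zero.2 hk), zero_smul, zero_smul, add_zero],
      fun z hz => ?_,
      fun z hz j => ?_, ?_⟩
    · exact ((differentiableAt_zpow.2 (Or.inl hz)).differentiableWithinAt.smul_const a).add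
        ((differentiableAt_zpow.2 (Or.inl hz)).differentiableWithinAt.smul_const _)
    · have h1 : z⁻¹ = conj z := by
        rw [Complex.inv_def, Complex.normSq_eq_norm_sq, hz]; simp
      have h2 : z ^ (-((k : ℤ) + 1)) = conj (z ^ ((k : ℤ) + 1)) := by
        rw [zpow_neg, ← inv_zpow, h1, map_zpow₀]
      change ((z ^ ((k : ℤ) + 1) • a + z ^ (-((k : ℤ) + 1)) • star a) j).im = 0
      rw [h2]
      simp only [Pi.add_apply, Pi.smul_apply, Pi.star_apply, smul_eq_mul, Complex.add_im,
        Complex.mul_im, Complex.conj_re, Complex.conj_im, Complex.star_def]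
      ring
    · have hcont : ∀ l : ℤ, Continuous fun θ : ℝ => (Circle.exp θ : ℂ) ^ l := fun l =>
        (continuous_subtype_val.comp Circle.exp.continuous).zpow₀ _
          fun θ => Or.inl (Circle.coe_ne_zero _)
      have hcs : ∀ (l : ℤ) (b : Fin n → ℂ), Continuous fun θ : ℝ => (Circle.exp θ : ℂ) ^ l • b :=
        fun l b => (hcont l).smul continuous_const
      change ∫ θ in (0 : ℝ)..2 * Real.pi, ((Circle.exp θ : ℂ) ^ ((k : ℤ) + 1) • a +
        (Circle.exp θ : ℂ) ^ (-((k : ℤ) + 1)) • star a) = 0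
      rw [intervalIntegral.integral_add ((hcs _ _).intervalIntegrable _ _)
        ((hcs _ _).intervalIntegrable _ _),
        intervalIntegral.integral_smul_const, intervalIntegral.integral_smul_const,
        integral_exp_zpow_eq_zero hk, integral_exp_zpow_eq_zero (neg_ne_zero.2 hk)]
      simp⟩

theorem monomial_apply (k : ℕ) (a : Fin n → ℂ) (z : ℂ) :
    monomial k a z = z ^ ((k : ℤ) + 1) • a + z ^ (-((k : ℤ) + 1)) • star a := rfl

theorem monomial_add (k : ℕ) (a b : Fin n → ℂ) :
    monomial k (a + b) = monomial k a + monomial k b := by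
  ext z : 1
  simp only [monomial_apply, add_apply, star_add, smul_add]
  abel

theorem monomial_smul (k : ℕ) (c : ℝ) (a : Fin n → ℂ) :
    monomial k (c • a) = c • monomial k a := by
  ext z : 1
  simp only [monomial_apply, smul_apply, star_smul, smul_add, star_trivial]
  rw [smul_comm, smul_comm c (z ^ (-((k : ℤ) + 1)))]

/-- The factor `2` counts the two conjugate terms; the factor `e^m` pays for the exponent `k + 1`,
as against the weight `e^{mk}` of `Σ(B)`. -/
theorem gr_monomial_le (m k : ℕ) (a : Fin n → ℂ) :
    gr m (monomial k a) ≤ 2 * Real.exp m * (Real.exp (m * k) * ‖a‖) := by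
  refine gr_le _ fun z hz => ?_
  have hz0 : 0 < ‖z‖ := (Real.exp_pos _).trans_le hz.1
  have hz1 : ‖z‖⁻¹ ≤ Real.exp m := by
    rw [inv_le_comm₀ hz0 (Real.exp_pos _), ← Real.exp_neg]
    exact hz.1
  have h1 : ‖z ^ ((k : ℤ) + 1)‖ ≤ Real.exp m * Real.exp (m * k) := by
    have : (k : ℤ) + 1 = ((k + 1 : ℕ) : ℤ) := by push_cast; ring
    rw [this, zpow_natCast, norm_pow, mul_comm (m : ℝ), Real.exp_nat_mul, ← pow_succ']
    exact pow_le_pow_left₀ hz0.le hz.2 _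
  have h2 : ‖z ^ (-((k : ℤ) + 1))‖ ≤ Real.exp m * Real.exp (m * k) := by
    have : (k : ℤ) + 1 = ((k + 1 : ℕ) : ℤ) := by push_cast; ring
    rw [this, zpow_neg, zpow_natCast, ← inv_pow, norm_pow, norm_inv, mul_comm (m : ℝ),
      Real.exp_nat_mul, ← pow_succ']
    exact pow_le_pow_left₀ (inv_pos.2 hz0).le hz1 _
  rw [monomial_apply]
  refine (norm_add_le _ _).trans ?_
  rw [norm_smul, norm_smul, norm_star]
  have h3 := mul_le_mul_of_nonneg_right h1 (norm_nonneg a)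
  have h4 := mul_le_mul_of_nonneg_right h2 (norm_nonneg a)
  linarith

theorem gr_sum_monomial_le (m N M : ℕ) (f : expSeq (Fin n → ℂ)) :
    gr m (∑ k ∈ Finset.Ico N M, monomial k (f.1 k)) ≤
      2 * Real.exp m * ∑ k ∈ Finset.Ico N M, Real.exp (m * k) * ‖f.1 k‖ := by
  rw [Finset.mul_sum]
  have h : ∀ s : Finset ℕ, gr m (∑ k ∈ s, monomial k (f.1 k)) ≤
      ∑ k ∈ s, 2 * Real.exp m * (Real.exp (m * k) * ‖f.1 k‖) := by
    intro s
    induction s using Finset.induction_on with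
    | empty => simp
    | insert a s ha ih =>
      rw [Finset.sum_insert ha, Finset.sum_insert ha]
      exact (map_add_le_add _ _ _).trans (add_le_add (gr_monomial_le _ _ _) ih)
  exact h _

theorem exists_tendsto_sum_monomial (f : expSeq (Fin n → ℂ)) : ∃ η : LoopSpace n,
    Filter.Tendsto (fun N => ∑ k ∈ Finset.range N, monomial k (f.1 k)) Filter.atTop (𝓝 η) := by
  refine complete _ fun m ε hε => ?_
  have hpos : 0 < 2 * Real.exp m := by positivity
  have hc := (f.2 m).hasSum.tendsto_sum_nat.cauchySeq
  obtain ⟨N, hN⟩ := Metric.cauchySeq_iff.1 hc (ε / (2 * Real.exp m)) (div_pos hε hpos)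
  have key : ∀ i ≥ N, ∀ j ≥ N, i ≤ j →
      gr m (∑ k ∈ Finset.range j, monomial k (f.1 k) -
        ∑ k ∈ Finset.range i, monomial k (f.1 k)) < ε := by
    intro i hi j hj hij
    rw [← Finset.sum_Ico_eq_sub _ hij]
    refine (gr_sum_monomial_le m i j f).trans_lt ?_
    have h1 := hN j hj i hi
    rw [Real.dist_eq, ← Finset.sum_Ico_eq_sub _ hij] at h1
    have h2 := (le_abs_self _).trans_lt h1
    rwa [lt_div_iff₀ hpos, mul_comm] at h2
  refine ⟨N, fun i hi j hj => ?_⟩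
  rcases le_total i j with h | h
  · have h1 := key i hi j hj h
    rwa [map_sub_rev] at h1
  · exact key j hj i hi h

/-- The loop with Laurent coefficients `fₖ` at `z^{k+1}`. -/
def ofCoeff (f : expSeq (Fin n → ℂ)) : LoopSpace n := (exists_tendsto_sum_monomial f).choose

theorem tendsto_ofCoeff (f : expSeq (Fin n → ℂ)) :
    Filter.Tendsto (fun N => ∑ k ∈ Finset.range N, monomial k (f.1 k)) Filter.atTop
      (𝓝 (ofCoeff f)) :=
  (exists_tendsto_sum_monomial f).choose_spec

/-- The loop with given Laurent coefficients, as a linear map. -/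
def ofCoeffL (n : ℕ) : expSeq (Fin n → ℂ) →ₗ[ℝ] LoopSpace n where
  toFun := ofCoeff
  map_add' f g := by
    refine tendsto_nhds_unique (tendsto_ofCoeff (f + g)) ?_
    refine ((tendsto_ofCoeff f).add (tendsto_ofCoeff g)).congr fun N => ?_
    rw [← Finset.sum_add_distrib]
    exact Finset.sum_congr rfl fun k _ => (monomial_add k _ _).symm
  map_smul' c f := by
    refine tendsto_nhds_unique (tendsto_ofCoeff (c • f)) ?_
    refine ((tendsto_ofCoeff f).const_smul c).congr fun N => ?_
    rw [Finset.smul_sum]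
    exact Finset.sum_congr rfl fun k _ => (monomial_smul k _ _).symm

theorem isTameLinear_ofCoeffL : IsTameLinear (ofCoeffL n) := by
  refine isTameLinear_of_forall 0 (fun m => 2 * Real.exp m) fun m f => ?_
  refine le_of_tendsto (((continuous_gr m).tendsto _).comp (tendsto_ofCoeff f))
    (Filter.Eventually.of_forall fun N => ?_)
  have h := gr_sum_monomial_le m 0 N f
  rw [Nat.Ico_zero_eq_range] at h
  refine h.trans (mul_le_mul_of_nonneg_left ?_ (by positivity))
  exact (f.2 m).sum_le_tsum _ fun k _ => by positivity

/-- Using the decay of degree `m + 1` against the weight of degree `m` leaves the summable factor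
`e^{-k}`. The price is one degree, so the passage to coefficients is tame with `r = 1`. -/
theorem norm_exp_mul_coeff_le (m k : ℕ) (η : LoopSpace n) :
    Real.exp (m * k) * ‖coeff (k + 1 : ℕ) η‖ ≤ Real.exp (-1 * k) * gr (m + 1) η := by
  have h := (norm_coeff_le (k + 1) (m + 1) η).1
  have h1 := mul_le_mul_of_nonneg_left h (Real.exp_pos (m * k)).le
  refine h1.trans ?_
  rw [← mul_assoc, ← Real.exp_add]
  refine mul_le_mul_of_nonneg_right (Real.exp_le_exp.2 ?_) (gr_nonneg _ _)
  push_cast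
  nlinarith [(Nat.cast_nonneg m : (0 : ℝ) ≤ m), (Nat.cast_nonneg k : (0 : ℝ) ≤ k)]

theorem summable_exp_neg : Summable fun k : ℕ => Real.exp (-1 * k) :=
  (Real.summable_exp_nat_mul_iff.2 (by norm_num : (-1 : ℝ) < 0)).congr fun k => by rw [mul_comm]

/-- The Laurent coefficients at `z^{k+1}`, as a linear map. -/
def coeffL (n : ℕ) : LoopSpace n →ₗ[ℝ] expSeq (Fin n → ℂ) where
  toFun η := ⟨fun k => coeff (k + 1 : ℕ) η, fun m =>
    Summable.of_nonneg_of_le (fun k => by positivity) (fun k => norm_exp_mul_coeff_le m k η)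
      (summable_exp_neg.mul_right _)⟩
  map_add' η ζ := Subtype.ext (funext fun k => coeff_add _ η ζ)
  map_smul' c η := Subtype.ext (funext fun k => coeff_smul _ c η)

theorem isTameLinear_coeffL : IsTameLinear (coeffL n) := by
  refine isTameLinear_of_forall 1 (fun _ => ∑' k : ℕ, Real.exp (-1 * k)) fun m η => ?_
  rw [gr_expSeq, ← tsum_mul_right]
  exact Summable.tsum_le_tsum (fun k => norm_exp_mul_coeff_le m k η) ((coeffL n η).2 m)
    (summable_exp_neg.mul_right _)

/-- By the identity theorem it is enough to compare on the unit circle. There, grouping the indices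
`k + 1` and `-(k + 1)` of the Fourier series gives precisely the partial sums of monomials, by the
conjugation symmetry of the coefficients. -/
theorem ofCoeffL_comp_coeffL : ofCoeffL n ∘ₗ coeffL n = LinearMap.id := by
  refine LinearMap.ext fun η => ext_circle fun z hz => ?_
  funext j
  obtain ⟨θ, rfl⟩ : ∃ θ : ℝ, (Circle.exp θ : ℂ) = z :=
    ⟨Complex.arg z, by rw [Circle.coe_exp]; simpa [hz] using Complex.norm_mul_exp_arg_mul_I z⟩
  have h1 : HasSum (fun k : ℕ => coeff (k + 1 : ℕ) η j * (Circle.exp θ : ℂ) ^ ((k + 1 : ℕ) : ℤ) +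
      coeff (-(k + 1 : ℕ)) η j * (Circle.exp θ : ℂ) ^ (-((k + 1 : ℕ) : ℤ)))
      (η (Circle.exp θ) j) := by
    have h2 := (hasSum_coeff η θ j).nat_add_neg
    -- The zeroth term, counted twice in the sum over pairs `±k`, vanishes; the index is then
    -- shifted by one.
    rw [coeff_zero, Pi.zero_apply, zero_mul, add_zero, ← hasSum_nat_add_iff' 1] at h2
    simpa [coeff_zero] using h2
  have h3 := h1.tendsto_sum_nat
  have h4 : Filter.Tendsto (fun N => (∑ k ∈ Finset.range N,
      monomial k ((coeffL n η).1 k)) (Circle.exp θ) j) Filter.atTop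
      (𝓝 (ofCoeff (coeffL n η) (Circle.exp θ) j)) := by
    have h5 := tendsto_iff.1 (tendsto_ofCoeff (coeffL n η)) 0
    rw [tendsto_iff_norm_sub_tendsto_zero]
    refine squeeze_zero (fun _ => norm_nonneg _) (fun N => ?_) h5
    refine le_trans ?_ (norm_apply_le _ (mem_annulus_of_norm_eq_one (Circle.norm_coe (Circle.exp θ)) 0))
    exact norm_le_pi_norm ((∑ k ∈ Finset.range N, monomial k ((coeffL n η).1 k) -
      ofCoeff (coeffL n η)) (Circle.exp θ)) j
  refine tendsto_nhds_unique h4 (h3.congr fun N => ?_)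
  have h6 : ∀ s : Finset ℕ, (∑ k ∈ s, monomial k ((coeffL n η).1 k)) (Circle.exp θ) j =
      ∑ k ∈ s, (monomial k ((coeffL n η).1 k)) (Circle.exp θ) j := by
    intro s
    induction s using Finset.induction_on with
    | empty => rfl
    | insert a s ha ih =>
      rw [Finset.sum_insert ha, Finset.sum_insert ha, ← ih]
      rfl
  rw [h6]
  refine Finset.sum_congr rfl fun k _ => ?_
  have h7 : (coeffL n η).1 k = coeff (k + 1 : ℕ) η := rfl
  rw [monomial_apply, h7, coeff_neg_apply]
  simp [mul_comm]

theorem isTameFrechet (n : ℕ) : IsTameFrechet (LoopSpace n) :=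
  ⟨isGradedFrechet, Fin n → ℂ, inferInstance, inferInstance, inferInstance, coeffL n, ofCoeffL n,
    isTameLinear_coeffL, isTameLinear_ofCoeffL, ofCoeffL_comp_coeffL⟩

end LoopSpace

/-! ## Products of tame Fréchet spaces -/

/-- Neighbourhood filters of `0` are infima of pullbacks by the seminorms, and a maximum of two
nonnegative functions tends to `0` exactly when both do. -/
theorem withSeminorms_prod {F G : Type*} [AddCommGroup F] [Module ℝ F] [TopologicalSpace F]
    [Graded F] [AddCommGroup G] [Module ℝ G] [TopologicalSpace G] [Graded G]
    (hF : WithSeminorms (Graded.gr : SeminormFamily ℝ F ℕ))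
    (hG : WithSeminorms (Graded.gr : SeminormFamily ℝ G ℕ)) :
    WithSeminorms (Graded.gr : SeminormFamily ℝ (F × G) ℕ) := by
  have := hF.topologicalAddGroup
  have := hG.topologicalAddGroup
  rw [SeminormFamily.withSeminorms_iff_nhds_eq_iInf]
  have hF' := (SeminormFamily.withSeminorms_iff_nhds_eq_iInf _).1 hF
  have hG' := (SeminormFamily.withSeminorms_iff_nhds_eq_iInf _).1 hG
  rw [← Prod.mk_zero_zero, nhds_prod_eq, hF', hG', Filter.prod_eq_inf, Filter.comap_iInf,
    Filter.comap_iInf, ← iInf_inf_eq]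
  refine iInf_congr fun m => ?_
  rw [Filter.comap_comap, Filter.comap_comap]
  refine le_antisymm ?_ (le_inf ?_ ?_)
  · rw [← Filter.tendsto_iff_comap]
    have h1 : Filter.Tendsto (fun z : F × G => gr m z.1)
        (Filter.comap ((gr m : Seminorm ℝ F) ∘ Prod.fst) (𝓝 0) ⊓
          Filter.comap ((gr m : Seminorm ℝ G) ∘ Prod.snd) (𝓝 0)) (𝓝 0) :=
      Filter.tendsto_comap.mono_left inf_le_left
    have h2 : Filter.Tendsto (fun z : F × G => gr m z.2)
        (Filter.comap ((gr m : Seminorm ℝ F) ∘ Prod.fst) (𝓝 0) ⊓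
          Filter.comap ((gr m : Seminorm ℝ G) ∘ Prod.snd) (𝓝 0)) (𝓝 0) :=
      Filter.tendsto_comap.mono_left inf_le_right
    have h3 := h1.max h2
    rw [max_self] at h3
    exact h3
  · rw [← Filter.tendsto_iff_comap]
    exact squeeze_zero (fun z : F × G => gr_nonneg m z.1)
      (fun z => le_max_left (gr m z.1) (gr m z.2)) Filter.tendsto_comap
  · rw [← Filter.tendsto_iff_comap]
    exact squeeze_zero (fun z : F × G => gr_nonneg m z.2)
      (fun z => le_max_right (gr m z.1) (gr m z.2)) Filter.tendsto_comap

theorem IsGradedFrechet.prod {F G : Type*} [AddCommGroup F] [Module ℝ F] [TopologicalSpace F]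
    [Graded F] [AddCommGroup G] [Module ℝ G] [TopologicalSpace G] [Graded G]
    (hF : IsGradedFrechet F) (hG : IsGradedFrechet G) : IsGradedFrechet (F × G) where
  mono m x := max_le_max (hF.mono m x.1) (hG.mono m x.2)
  withSeminorms := withSeminorms_prod hF.withSeminorms hG.withSeminorms
  hausdorff := by
    have := hF.hausdorff
    have := hG.hausdorff
    infer_instance
  complete u hu := by
    obtain ⟨x, hx⟩ := hF.complete (fun i => (u i).1) fun m ε hε => by
      obtain ⟨N, hN⟩ := hu m ε hε
      exact ⟨N, fun i hi j hj => (le_max_left _ _).trans_lt (hN i hi j hj)⟩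
    obtain ⟨y, hy⟩ := hG.complete (fun i => (u i).2) fun m ε hε => by
      obtain ⟨N, hN⟩ := hu m ε hε
      exact ⟨N, fun i hi j hj => (le_max_right _ _).trans_lt (hN i hi j hj)⟩
    exact ⟨(x, y), hx.prodMk_nhds hy⟩

/-- A bounded linear map acts on exponentially decreasing sequences. -/
def expSeqMap {B B' : Type*} [NormedAddCommGroup B] [NormedSpace ℝ B] [NormedAddCommGroup B']
    [NormedSpace ℝ B'] (A : B →L[ℝ] B') : expSeq B →ₗ[ℝ] expSeq B' where
  toFun f := ⟨fun k => A (f.1 k), fun m => by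
    refine Summable.of_nonneg_of_le (fun k => by positivity) (fun k => ?_)
      ((f.2 m).mul_left ‖A‖)
    rw [mul_left_comm]
    exact mul_le_mul_of_nonneg_left (A.le_opNorm _) (Real.exp_pos _).le⟩
  map_add' f g := Subtype.ext (funext fun k => map_add A _ _)
  map_smul' c f := Subtype.ext (funext fun k => map_smul A c _)

theorem isTameLinear_expSeqMap {B B' : Type*} [NormedAddCommGroup B] [NormedSpace ℝ B]
    [NormedAddCommGroup B'] [NormedSpace ℝ B'] (A : B →L[ℝ] B') : IsTameLinear (expSeqMap A) := by
  refine isTameLinear_of_forall 0 (fun _ => ‖A‖) fun m f => ?_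
  rw [gr_expSeq, gr_expSeq, ← tsum_mul_left]
  refine Summable.tsum_le_tsum (fun k => ?_) ((expSeqMap A f).2 m) ((f.2 m).mul_left _)
  rw [mul_left_comm]
  exact mul_le_mul_of_nonneg_left (A.le_opNorm _) (Real.exp_pos _).le

/-- Two summands, of `Σ(B)` and of `Σ(B')`, are combined in `Σ(B × B')` by means of the inclusions
and projections of the Banach spaces, applied termwise. -/
theorem IsTameFrechet.prod {F G : Type u} [AddCommGroup F] [Module ℝ F] [TopologicalSpace F]
    [Graded F] [AddCommGroup G] [Module ℝ G] [TopologicalSpace G] [Graded G]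
    (hF : IsTameFrechet F) (hG : IsTameFrechet G) : IsTameFrechet (F × G) := by
  obtain ⟨hF, B, _, _, _, φ, ψ, hφ, hψ, h⟩ := hF
  obtain ⟨hG, B', _, _, _, φ', ψ', hφ', hψ', h'⟩ := hG
  have : MonoGraded F := ⟨hF.mono⟩
  have : MonoGraded G := ⟨hG.mono⟩
  refine ⟨hF.prod hG, B × B', inferInstance, inferInstance, inferInstance,
    expSeqMap (ContinuousLinearMap.inl ℝ B B') ∘ₗ φ ∘ₗ LinearMap.fst ℝ F G +
      expSeqMap (ContinuousLinearMap.inr ℝ B B') ∘ₗ φ' ∘ₗ LinearMap.snd ℝ F G,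
    (ψ ∘ₗ expSeqMap (ContinuousLinearMap.fst ℝ B B')).prod
      (ψ' ∘ₗ expSeqMap (ContinuousLinearMap.snd ℝ B B')), ?_, ?_, ?_⟩
  · exact ((isTameLinear_expSeqMap _).comp (hφ.comp isTameLinear_fst)).add
      ((isTameLinear_expSeqMap _).comp (hφ'.comp isTameLinear_snd))
  · exact (hψ.comp (isTameLinear_expSeqMap _)).prod (hψ'.comp (isTameLinear_expSeqMap _))
  · refine LinearMap.ext fun x => Prod.ext ?_ ?_
    · have h1 : expSeqMap (ContinuousLinearMap.fst ℝ B B')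
          (expSeqMap (ContinuousLinearMap.inl ℝ B B') (φ x.1) +
            expSeqMap (ContinuousLinearMap.inr ℝ B B') (φ' x.2)) = φ x.1 :=
        Subtype.ext (funext fun k => add_zero _)
      change ψ _ = x.1
      simp only [LinearMap.add_apply, LinearMap.comp_apply, LinearMap.fst_apply,
        LinearMap.snd_apply]
      rw [h1]
      exact LinearMap.congr_fun h x.1
    · have h1 : expSeqMap (ContinuousLinearMap.snd ℝ B B')
          (expSeqMap (ContinuousLinearMap.inl ℝ B B') (φ x.1) +
            expSeqMap (ContinuousLinearMap.inr ℝ B B') (φ' x.2)) = φ' x.2 :=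
        Subtype.ext (funext fun k => zero_add _)
      change ψ' _ = x.2
      simp only [LinearMap.add_apply, LinearMap.comp_apply, LinearMap.fst_apply,
        LinearMap.snd_apply]
      rw [h1]
      exact LinearMap.congr_fun h' x.2

/-- The sequences supported at `0`. -/
def expSeqSingle (B : Type*) [NormedAddCommGroup B] [NormedSpace ℝ B] : B →ₗ[ℝ] expSeq B where
  toFun x := ⟨Pi.single 0 x, fun m => by
    refine summable_of_ne_finset_zero (s := {0}) fun k hk => ?_
    rw [Pi.single_eq_of_ne (by simpa using hk), norm_zero, mul_zero]⟩
  map_add' x y := Subtype.ext ((LinearMap.single ℝ (fun _ : ℕ => B) 0).map_add x y)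
  map_smul' c x := Subtype.ext ((LinearMap.single ℝ (fun _ : ℕ => B) 0).map_smul c x)

theorem expSeqSingle_coe {B : Type*} [NormedAddCommGroup B] [NormedSpace ℝ B] (x : B) :
    (expSeqSingle B x).1 = Pi.single (M := fun _ => B) 0 x := rfl

theorem gr_expSeqSingle {B : Type*} [NormedAddCommGroup B] [NormedSpace ℝ B] (m : ℕ) (x : B) :
    gr m (expSeqSingle B x) = ‖x‖ := by
  rw [gr_expSeq, tsum_eq_single 0 fun k hk => by
    rw [expSeqSingle_coe, Pi.single_eq_of_ne hk, norm_zero, mul_zero]]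
  rw [expSeqSingle_coe, Pi.single_eq_same]
  simp

/-- A Banach space `E` with constant grading is the summand of `Σ(E)` formed by the sequences
supported at `0`; the weight there is `e^0 = 1`. -/
theorem isTameFrechet_of_gr_eq_norm {E : Type u} [NormedAddCommGroup E] [NormedSpace ℝ E]
    [CompleteSpace E] [Graded E] (h : ∀ (m : ℕ) (x : E), gr m x = ‖x‖) : IsTameFrechet E := by
  refine ⟨⟨fun m x => by rw [h, h], ?_, inferInstance, ?_⟩, E, inferInstance, inferInstance,
    inferInstance, expSeqSingle E, ⟨⟨fun f => f.1 0, fun _ _ => rfl⟩, fun _ _ => rfl⟩, ?_, ?_, ?_⟩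
  · rw [SeminormFamily.withSeminorms_iff_nhds_eq_iInf]
    have h1 : ∀ m, (⇑(Graded.gr m : Seminorm ℝ E) : E → ℝ) = fun x => ‖x‖ := fun m => funext (h m)
    simp only [h1, iInf_const]
    exact comap_norm_nhds_zero.symm
  · intro v hv
    refine cauchySeq_tendsto_of_complete (Metric.cauchySeq_iff.2 fun ε hε => ?_)
    obtain ⟨N, hN⟩ := hv 0 ε hε
    exact ⟨N, fun i hi j hj => by rw [dist_eq_norm, ← h 0]; exact hN i hi j hj⟩
  · exact isTameLinear_of_forall 0 (fun _ => 1) fun m x => by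
      rw [gr_expSeqSingle, h, one_mul]
  · refine isTameLinear_of_forall 0 (fun _ => 1) fun m f => ?_
    rw [h, one_mul, gr_expSeq]
    have h1 := (f.2 (m + 0)).le_tsum 0 fun k _ => by positivity
    simpa using h1
  · refine LinearMap.ext fun x => ?_
    change (expSeqSingle E x).1 0 = x
    rw [expSeqSingle_coe, Pi.single_eq_same]

theorem isTameFrechet_model (n : ℕ) : IsTameFrechet (Model n) :=
  (isTameFrechet_of_gr_eq_norm fun _ _ => rfl).prod ((LoopSpace.isTameFrechet n).prod
    ((isTameFrechet_of_gr_eq_norm fun _ _ => rfl).prod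
      (isTameFrechet_of_gr_eq_norm fun _ _ => rfl)))

end

/-! ### Charts, lifts to angle coordinates and the metric in coordinates -/

section

variable {n : ℕ} {q : Matrix (Fin n) (Fin n) ℤ}

/-! ## Charts and lifts -/

/-- The element with the winding number `l` and angles given by `x`. -/
def expLift (q : Matrix (Fin n) (Fin n) ℤ) (l : Fin n → ℤ) (x : Model n) : HatMT q :=
  ⟨l, fun i => Circle.exp (x.1 i), x.2.1, Circle.exp x.2.2.1, Circle.exp x.2.2.2⟩

/-- The angles of the center of a chart. -/
def offset (c : HatMT q) : Model n :=
  (fun i => Complex.arg (c.tor i), 0, Complex.arg c.cen, Complex.arg c.rot)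

/-- Every inverse chart is the covering map `expLift` of its component composed with a translation.
This is why lifts can replace chart representatives. -/
theorem hatChart_symm_apply (c : HatMT q) (x : Model n) :
    (hatChart c).symm x = expLift q c.wind (x + offset c) := by
  have h : ∀ (w : Circle) (t : ℝ), w * Circle.exp t = Circle.exp (t + Complex.arg w) := fun w t => by
    rw [Circle.exp_add, Circle.exp_arg, mul_comm]
  refine HatMT.ext rfl (funext fun i => h _ _) ?_ (h _ _) (h _ _)
  exact (add_zero x.2.1).symm

theorem mem_hatChart_source (c x : HatMT q) : x ∈ (hatChart c).source ↔
    x.wind = c.wind ∧ (∀ i, x.tor i ∈ (angleChart (c.tor i)).source) ∧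
      x.cen ∈ (angleChart c.cen).source ∧ x.rot ∈ (angleChart c.rot).source := by
  simp [hatChart, HatMT.homeoProd, HatMT.equivProd, sliceChart]

theorem HatMT.continuous_iff {X : Type*} [TopologicalSpace X] {f : X → HatMT q} :
    Continuous f ↔ Continuous (fun x => (f x).wind) ∧ Continuous (fun x => (f x).tor) ∧
      Continuous (fun x => (f x).loop) ∧ Continuous (fun x => (f x).cen) ∧
        Continuous (fun x => (f x).rot) := by
  rw [← HatMT.homeoProd.comp_continuous_iff]
  simp only [continuous_prodMk, Function.comp_def, HatMT.homeoProd, HatMT.equivProd,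
    Equiv.toHomeomorphOfIsInducing_apply, Equiv.coe_fn_mk]

theorem HatMT.continuous_wind : Continuous (HatMT.wind : HatMT q → _) :=
  (HatMT.continuous_iff.1 continuous_id).1

theorem HatMT.continuous_tor : Continuous (HatMT.tor : HatMT q → _) :=
  (HatMT.continuous_iff.1 continuous_id).2.1

theorem HatMT.continuous_loop : Continuous (HatMT.loop : HatMT q → _) :=
  (HatMT.continuous_iff.1 continuous_id).2.2.1

theorem HatMT.continuous_cen : Continuous (HatMT.cen : HatMT q → _) :=
  (HatMT.continuous_iff.1 continuous_id).2.2.2.1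

theorem HatMT.continuous_rot : Continuous (HatMT.rot : HatMT q → _) :=
  (HatMT.continuous_iff.1 continuous_id).2.2.2.2

theorem continuous_expLift (l : Fin n → ℤ) : Continuous (expLift q l) := by
  refine HatMT.continuous_iff.2 ⟨continuous_const, ?_, ?_, ?_, ?_⟩
  · exact continuous_pi fun i => Circle.exp.continuous.comp
      ((continuous_apply i).comp continuous_fst)
  · exact continuous_fst.comp continuous_snd
  · exact Circle.exp.continuous.comp (by fun_prop)
  · exact Circle.exp.continuous.comp (by fun_prop)

theorem eq_zero_of_circle_exp_eq_one {t : ℝ} (h : Circle.exp t = 1) (ht : |t| < Real.pi) :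
    t = 0 := by
  have h1 := Circle.arg_exp (neg_lt_of_abs_lt ht) (lt_of_abs_lt ht).le
  rw [h, Circle.coe_one, Complex.arg_one] at h1
  exact h1.symm

/-- The difference between the angle coordinate and the parameter is continuous, and its exponential
is always `c⁻¹`. Two values closer than `π` have a difference in `2πℤ`, hence equal to zero, so the
difference is locally constant. -/
theorem eventually_angleChart_exp (c : Circle) {t₀ : ℝ}
    (h : Circle.exp t₀ ∈ (angleChart c).source) :
    ∀ᶠ t in 𝓝 t₀, angleChart c (Circle.exp t) - t = angleChart c (Circle.exp t₀) - t₀ := by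
  have hc : ContinuousAt (fun t => angleChart c (Circle.exp t) - t) t₀ :=
    (((angleChart c).continuousAt h).comp Circle.exp.continuous.continuousAt).sub continuousAt_id
  have hs : ∀ᶠ t in 𝓝 t₀, Circle.exp t ∈ (angleChart c).source :=
    Circle.exp.continuous.continuousAt.eventually ((angleChart c).open_source.mem_nhds h)
  have hd : ∀ᶠ t in 𝓝 t₀, |(angleChart c (Circle.exp t) - t) -
      (angleChart c (Circle.exp t₀) - t₀)| < Real.pi := by
    have := Metric.tendsto_nhds.1 hc.tendsto Real.pi Real.pi_pos
    simpa only [Real.dist_eq] using this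
  have hexp : ∀ t, Circle.exp t ∈ (angleChart c).source →
      Circle.exp (angleChart c (Circle.exp t) - t) = c⁻¹ := by
    intro t ht
    have h1 : c * Circle.exp (angleChart c (Circle.exp t)) = Circle.exp t :=
      (angleChart c).left_inv ht
    rw [Circle.exp_sub, div_eq_iff_eq_mul, eq_inv_mul_iff_mul_eq, h1]
  filter_upwards [hs, hd] with t ht htd
  refine sub_eq_zero.1 (eq_zero_of_circle_exp_eq_one ?_ htd)
  rw [Circle.exp_sub, hexp t ht, hexp t₀ h, div_self']

theorem eventually_hatChart_expLift (c : HatMT q) {l : Fin n → ℤ} {y : Model n}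
    (h : expLift q l y ∈ (hatChart c).source) : ∀ᶠ z in 𝓝 y,
      hatChart c (expLift q l z) - z = hatChart c (expLift q l y) - y := by
  obtain ⟨-, h1, h2, h3⟩ := (mem_hatChart_source _ _).1 h
  have e1 : ∀ᶠ z : Model n in 𝓝 y, ∀ i, angleChart (c.tor i) (Circle.exp (z.1 i)) - z.1 i =
      angleChart (c.tor i) (Circle.exp (y.1 i)) - y.1 i :=
    Filter.eventually_all.2 fun i => ((by fun_prop : Continuous fun z : Model n =>
      z.1 i).tendsto y).eventually (eventually_angleChart_exp _ (h1 i))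
  have e2 := ((by fun_prop : Continuous fun z : Model n => z.2.2.1).tendsto y).eventually
    (eventually_angleChart_exp _ h2)
  have e3 := ((by fun_prop : Continuous fun z : Model n => z.2.2.2).tendsto y).eventually
    (eventually_angleChart_exp _ h3)
  filter_upwards [e1, e2, e3] with z hz1 hz2 hz3
  refine Prod.ext (funext hz1) (Prod.ext ?_ (Prod.ext hz2 hz3))
  exact (sub_self z.2.1).trans (sub_self y.2.1).symm

/-- The maps `Φ l` of the model space lift the self-map `φ` of `\widehat{MT}`; they are smooth tame,
with derivatives `D l`. -/
structure IsTameLift (φ : HatMT q → HatMT q) (σ : (Fin n → ℤ) → (Fin n → ℤ))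
    (Φ : (Fin n → ℤ) → Model n → Model n)
    (D : (Fin n → ℤ) → ∀ k : ℕ, Model n → (Fin k → Model n) → Model n) : Prop where
  semiconj : ∀ l x, φ (expLift q l x) = expLift q (σ l) (Φ l x)
  tower : ∀ l, IsDerivTower (Φ l) Set.univ (D l)
  tame : ∀ l, IsTameTower Set.univ (D l)

theorem IsDerivTower.continuous {F G : Type*} [AddCommGroup F] [Module ℝ F] [TopologicalSpace F]
    [AddCommGroup G] [Module ℝ G] [TopologicalSpace G] {f : F → G}
    {D : ∀ k : ℕ, F → (Fin k → F) → G} (hD : IsDerivTower f Set.univ D) : Continuous f := by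
  have h1 := hD.cont 0
  rw [Set.univ_prod_univ, continuousOn_univ] at h1
  have h2 := h1.comp (f := fun x : F => (x, fun i : Fin 0 => i.elim0)) (by fun_prop)
  refine h2.congr fun x => hD.zero x trivial _

namespace IsTameLift

variable {φ : HatMT q → HatMT q} {σ : (Fin n → ℤ) → (Fin n → ℤ)}
  {Φ : (Fin n → ℤ) → Model n → Model n}
  {D : (Fin n → ℤ) → ∀ k : ℕ, Model n → (Fin k → Model n) → Model n}

theorem apply_symm (hφ : IsTameLift φ σ Φ D) (c : HatMT q) (x : Model n) :
    φ ((hatChart c).symm x) = expLift q (σ c.wind) (Φ c.wind (x + offset c)) := by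
  rw [hatChart_symm_apply, hφ.semiconj]

theorem continuous_comp_symm (hφ : IsTameLift φ σ Φ D) (c : HatMT q) :
    Continuous fun x => φ ((hatChart c).symm x) := by
  simp only [hφ.apply_symm]
  exact (continuous_expLift _).comp ((hφ.tower c.wind).continuous.comp (by fun_prop))

theorem continuous (hφ : IsTameLift φ σ Φ D) : Continuous φ := by
  refine continuous_iff_continuousAt.2 fun x => ?_
  have hx : x ∈ (hatChart x).source := mem_chart_source (Model n) x
  have h1 : ContinuousAt (fun y => φ ((hatChart x).symm (hatChart x y))) x :=
    (hφ.continuous_comp_symm x).continuousAt.comp ((hatChart x).continuousAt hx)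
  refine h1.congr ?_
  filter_upwards [(hatChart x).open_source.mem_nhds hx] with y hy
  rw [(hatChart x).left_inv hy]

theorem isOpen_localDomain (hφ : IsTameLift φ σ Φ D) (c c' : HatMT q) :
    IsOpen (localDomain (hatChart c) (hatChart c') φ) :=
  (hatChart c).open_target.inter ((hatChart c').open_source.preimage (hφ.continuous_comp_symm c))

theorem locallyConst (hφ : IsTameLift φ σ Φ D) (c c' : HatMT q) {x : Model n}
    (hx : x ∈ localDomain (hatChart c) (hatChart c') φ) : ∀ᶠ y in 𝓝 x,
      localRep (hatChart c) (hatChart c') φ y - Φ c.wind (y + offset c) =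
        localRep (hatChart c) (hatChart c') φ x - Φ c.wind (x + offset c) := by
  simp only [localRep, hφ.apply_symm]
  have h1 : Continuous fun y => Φ c.wind (y + offset c) :=
    (hφ.tower c.wind).continuous.comp (by fun_prop)
  refine (h1.tendsto x).eventually (eventually_hatChart_expLift c' ?_)
  have h2 : φ ((hatChart c).symm x) ∈ (hatChart c').source := hx.2
  rwa [hφ.apply_symm] at h2

/-- The derivatives of the representative of `φ` in two charts. -/
def repTower (φ : HatMT q → HatMT q)
    (D : (Fin n → ℤ) → ∀ k : ℕ, Model n → (Fin k → Model n) → Model n) (c c' : HatMT q) :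
    ∀ k : ℕ, Model n → (Fin k → Model n) → Model n :=
  shiftTower (localRep (hatChart c) (hatChart c') φ)
    (fun k x v => D c.wind k (x + offset c) v)

theorem tower_shift (hφ : IsTameLift φ σ Φ D) (c : HatMT q) :
    IsDerivTower (fun x => Φ c.wind (x + offset c)) Set.univ
      (fun k x v => D c.wind k (x + offset c) v) :=
  (hφ.tower c.wind).comp_affine (ContinuousLinearMap.id ℝ (Model n)) (offset c)

theorem isDerivTower_localRep (hφ : IsTameLift φ σ Φ D) (c c' : HatMT q) :
    IsDerivTower (localRep (hatChart c) (hatChart c') φ)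
      (localDomain (hatChart c) (hatChart c') φ) (repTower φ D c c') :=
  ((hφ.tower_shift c).mono (Set.subset_univ _)).of_locallyConst_sub (hφ.isOpen_localDomain c c')
    fun _ hx => hφ.locallyConst c c' hx

theorem smoothTameOn_localRep (hφ : IsTameLift φ σ Φ D) (c c' : HatMT q) :
    SmoothTameOn (localRep (hatChart c) (hatChart c') φ)
      (localDomain (hatChart c) (hatChart c') φ) := by
  refine smoothTameOn_of_tower (hφ.isDerivTower_localRep c c') ?_
  have h1 : IsTameTower Set.univ (fun k x v => D c.wind k (x + offset c) v) :=
    (hφ.tame c.wind).comp_affine (ContinuousLinearMap.id ℝ (Model n)) isTameLinear_id (offset c)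
  exact (h1.mono (Set.subset_univ _)).shift (g := fun x => Φ c.wind (x + offset c))
    (fun x _ v => (hφ.tower_shift c).zero x trivial v) fun _ hx => hφ.locallyConst c c' hx

theorem isSmoothTame (hφ : IsTameLift φ σ Φ D) : IsSmoothTame (Model n) φ := by
  refine ⟨hφ.continuous, ?_⟩
  rintro _ ⟨c, rfl⟩ _ ⟨c', rfl⟩
  exact hφ.smoothTameOn_localRep c c'

theorem tower_one_eq (hφ : IsTameLift φ σ Φ D) {c c' : HatMT q}
    {D' : ∀ k : ℕ, Model n → (Fin k → Model n) → Model n}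
    (hD' : IsDerivTower (localRep (hatChart c) (hatChart c') φ)
      (localDomain (hatChart c) (hatChart c') φ) D') {x : Model n}
    (hx : x ∈ localDomain (hatChart c) (hatChart c') φ) (h : Model n) :
    D' 1 x ![h] = D c.wind 1 (x + offset c) ![h] :=
  hD'.one_eq (hφ.isOpen_localDomain c c') hx
    ((hφ.isDerivTower_localRep c c').hasDirDeriv_one (hφ.isOpen_localDomain c c') hx h)

/-- The first derivatives of any two towers agree on the whole open domain, so they may be
differentiated once more. This is needed for the second-derivative term in the transformation rule
of Christoffel symbols. -/
theorem tower_two_eq (hφ : IsTameLift φ σ Φ D) {c c' : HatMT q}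
    {D' : ∀ k : ℕ, Model n → (Fin k → Model n) → Model n}
    (hD' : IsDerivTower (localRep (hatChart c) (hatChart c') φ)
      (localDomain (hatChart c) (hatChart c') φ) D') {x : Model n}
    (hx : x ∈ localDomain (hatChart c) (hatChart c') φ) (h k : Model n) :
    D' 2 x ![h, k] = D c.wind 2 (x + offset c) ![h, k] := by
  refine HasDirDeriv.unique (hD'.hasDirDeriv_two hx h k) ?_
  refine ((hφ.isDerivTower_localRep c c').hasDirDeriv_two hx h k).congr_of_eventuallyEq ?_
  filter_upwards [(hφ.isOpen_localDomain c c').mem_nhds hx] with y hy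
  exact (hφ.tower_one_eq hD' hy h).symm

end IsTameLift

/-- The chart transitions are the chart representatives of the identity, so this trivial lift
settles everything about them. -/
theorem isTameLift_id : IsTameLift (id : HatMT q → HatMT q) id (fun _ x => x)
    (fun _ => affineTower (ContinuousLinearMap.id ℝ (Model n)) 0) where
  semiconj _ _ := rfl
  tower _ := by
    simpa using isDerivTower_affine (ContinuousLinearMap.id ℝ (Model n)) 0 Set.univ
  tame _ := isTameTower_affine _ isTameLinear_id _ _

theorem transition_source (c c' : HatMT q) : ((hatChart c).symm ≫ₕ hatChart c').source =
    localDomain (hatChart c) (hatChart c') id := by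
  rw [OpenPartialHomeomorph.trans_source]
  rfl

theorem wind_eq_of_mem_localDomain {c c' : HatMT q} {x : Model n}
    (hx : x ∈ localDomain (hatChart c) (hatChart c') id) : c.wind = c'.wind := by
  have h1 : (hatChart c).symm x ∈ (hatChart c').source := hx.2
  rw [hatChart_symm_apply] at h1
  exact ((mem_hatChart_source _ _).1 h1).1

instance : T2Space (HatMT q) := HatMT.homeoProd.symm.t2Space

theorem isTameFrechetManifold (q : Matrix (Fin n) (Fin n) ℤ) :
    IsTameFrechetManifold (Model n) (HatMT q) where
  model := isTameFrechet_model n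
  hausdorff := inferInstance
  transition := by
    rintro _ ⟨c, rfl⟩ _ ⟨c', rfl⟩
    rw [transition_source]
    exact isTameLift_id.smoothTameOn_localRep c c'

/-! ## The metric -/

/-- The coefficient of the central direction of the left trivialization of a tangent vector. -/
def vert (q : Matrix (Fin n) (Fin n) ℤ) (l : Fin n → ℤ) (η : LoopSpace n) (h : Model n) : ℝ :=
  h.2.2.1 + ∑ i, (weight q l i : ℝ) * h.1 i - omega q η h.2.1 / 2

/-- The metric at the points with winding number `l` and loop `η`, divided by `p`. -/
def hatForm (q : Matrix (Fin n) (Fin n) ℤ) (l : Fin n → ℤ) (η : LoopSpace n) (h k : Model n) : ℝ :=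
  vecFormL (gram 1 q) h.1 k.1 + LoopSpace.form (gram 1 q) h.2.1 k.2.1 -
    vert q l η h * k.2.2.2 - h.2.2.2 * vert q l η k

/-- The left trivialization rotates the loop component, but the scalar product of loops is rotation
invariant. The point therefore enters only through its winding number and its loop. -/
theorem hatMetric_eq (p : ℝ) (c : HatMT q) (x X Y : Model n) :
    hatMetric p q (hatChart c) x X Y = p * hatForm q c.wind x.2.1 X Y := by
  have h1 : ((hatChart c).symm x).loop = x.2.1 := by
    rw [hatChart_symm_apply]
    exact add_zero x.2.1
  have h2 : ((hatChart c).symm x).wind = c.wind := by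
    rw [hatChart_symm_apply]
    rfl
  rw [hatMetric, kmForm_eq]
  simp only [leftTrivialization, LoopSpace.form_rotate, h1, h2]
  rfl

theorem localRep_snd_fst {c c' : HatMT q} (φ : HatMT q → HatMT q) (x : Model n) :
    (localRep (hatChart c) (hatChart c') φ x).2.1 = (φ ((hatChart c).symm x)).loop := rfl

/-- The derivative of a chart representative is the derivative of the lift, and the metric at the
image point sees only its winding number and loop, both given by the lift. Invariance can thus be
checked on `Model n`. -/
theorem isIsometry_of_lift {p : ℝ} {φ : Equiv.Perm (HatMT q)} {σ σ' : (Fin n → ℤ) → (Fin n → ℤ)}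
    {Φ Φ' : (Fin n → ℤ) → Model n → Model n}
    {D D' : (Fin n → ℤ) → ∀ k : ℕ, Model n → (Fin k → Model n) → Model n}
    (hφ : IsTameLift φ σ Φ D) (hφ' : IsTameLift φ.symm σ' Φ' D')
    (hg : ∀ l x h k, hatForm q (σ l) (Φ l x).2.1 (D l 1 x ![h]) (D l 1 x ![k]) =
      hatForm q l x.2.1 h k) : IsIsometry (hatMetric p q) φ where
  smooth := hφ.isSmoothTame
  smooth_symm := hφ'.isSmoothTame
  preserves := by
    rintro _ ⟨c, rfl⟩ _ ⟨c', rfl⟩ D₁ hD₁ x hx h k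
    rw [hφ.tower_one_eq hD₁ hx, hφ.tower_one_eq hD₁ hx, hatMetric_eq, hatMetric_eq]
    have h1 : φ ((hatChart c).symm x) ∈ (hatChart c').source := hx.2
    have h2 := ((mem_hatChart_source _ _).1 h1).1
    rw [localRep_snd_fst]
    rw [hφ.apply_symm] at h2 ⊢
    have h3 := hg c.wind (x + offset c) h k
    rw [← h2]
    have h4 : (x + offset c).2.1 = x.2.1 := add_zero x.2.1
    rw [h4] at h3
    exact congrArg (p * ·) h3

end

/-! ### Left translations, inversion and geodesic symmetries -/

section

variable {n : ℕ} {q : Matrix (Fin n) (Fin n) ℤ}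

/-! ## Left translations -/

theorem torusPow_exp (x : Fin n → ℝ) (m : Fin n → ℤ) :
    torusPow (fun i => Circle.exp (x i)) m = Circle.exp (∑ i, (m i : ℝ) * x i) := by
  have h : ∀ s : Finset (Fin n), ∏ i ∈ s, Circle.exp (x i) ^ m i =
      Circle.exp (∑ i ∈ s, (m i : ℝ) * x i) := by
    intro s
    induction s using Finset.induction_on with
    | empty => simp
    | insert a s ha ih =>
      rw [Finset.prod_insert ha, Finset.sum_insert ha, Circle.exp_add, ih, ← zsmul_eq_mul,
        Circle.exp_zsmul]
  exact h _

theorem circle_exp_zpow (t : ℝ) (m : ℤ) : Circle.exp t ^ m = Circle.exp (m * t) := by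
  rw [← zsmul_eq_mul, Circle.exp_zsmul]

/-- The linear functional `k ↦ ∑ mᵢ kᵢ`. -/
def pairL (m : Fin n → ℤ) : (Fin n → ℝ) →ₗ[ℝ] ℝ := ∑ i, (m i : ℝ) • LinearMap.proj i

theorem pairL_apply (m : Fin n → ℤ) (k : Fin n → ℝ) : pairL m k = ∑ i, (m i : ℝ) * k i := by
  simp [pairL]

theorem isTameLinear_pairL (m : Fin n → ℤ) : IsTameLinear (pairL m) :=
  isTameLinear_of_forall 0 (fun _ => ∑ i, |(m i : ℝ)|) fun _ k => by
    rw [gr_real, gr_pi, pairL_apply, Finset.sum_mul]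
    refine (Finset.abs_sum_le_sum_abs _ _).trans (Finset.sum_le_sum fun i _ => ?_)
    rw [abs_mul]
    exact mul_le_mul_of_nonneg_left (norm_le_pi_norm k i) (abs_nonneg _)

theorem isTameLinear_formL (S : Matrix (Fin n) (Fin n) ℝ) (η : LoopSpace n) :
    IsTameLinear (LoopSpace.formL S η) :=
  isTameLinear_of_forall 0 (fun _ => (∑ i, ∑ j, |S i j|) * gr 0 η) fun _ ζ =>
    (LoopSpace.abs_form_le S η ζ).trans (mul_le_mul_of_nonneg_left (gr_mono (Nat.zero_le _) _)
      (mul_nonneg (Finset.sum_nonneg fun _ _ => Finset.sum_nonneg fun _ _ => abs_nonneg _)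
        (gr_nonneg _ _)))

theorem isTameLinear_omegaL (q : Matrix (Fin n) (Fin n) ℤ) (η : LoopSpace n) :
    IsTameLinear (omegaL q η) :=
  (isTameLinear_formL (gram 1 q) η).comp LoopSpace.isTameLinear_derivL

theorem isTameLinear_smul {F : Type*} [AddCommGroup F] [Module ℝ F] [Graded F] (c : ℝ) :
    IsTameLinear (c • LinearMap.id : F →ₗ[ℝ] F) :=
  isTameLinear_of_forall 0 (fun _ => |c|) fun _ x => by
    simp only [LinearMap.smul_apply, LinearMap.id_apply, map_smul_eq_mul, Real.norm_eq_abs,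
      add_zero, le_refl]

/-- The projection of the model space to the loops. -/
def projLoop (n : ℕ) : Model n →ₗ[ℝ] LoopSpace n := LinearMap.fst ℝ _ _ ∘ₗ LinearMap.snd ℝ _ _

/-- The projection of the model space to the central coordinate. -/
def projCen (n : ℕ) : Model n →ₗ[ℝ] ℝ :=
  LinearMap.fst ℝ _ _ ∘ₗ LinearMap.snd ℝ _ _ ∘ₗ LinearMap.snd ℝ _ _

/-- The projection of the model space to the rotation coordinate. -/
def projRot (n : ℕ) : Model n →ₗ[ℝ] ℝ :=
  LinearMap.snd ℝ _ _ ∘ₗ LinearMap.snd ℝ _ _ ∘ₗ LinearMap.snd ℝ _ _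

theorem isTameLinear_projLoop : IsTameLinear (projLoop n) := isTameLinear_fst.comp isTameLinear_snd

theorem isTameLinear_projCen : IsTameLinear (projCen n) :=
  isTameLinear_fst.comp (isTameLinear_snd.comp isTameLinear_snd)

theorem isTameLinear_projRot : IsTameLinear (projRot n) :=
  isTameLinear_snd.comp (isTameLinear_snd.comp isTameLinear_snd)

theorem withSeminorms_model (n : ℕ) :
    WithSeminorms (Graded.gr : SeminormFamily ℝ (Model n) ℕ) :=
  (isTameFrechet_model n).1.withSeminorms

/-- The linear part of the left translation by `a` in angle coordinates. -/
def translationL (a : HatMT q) : Model n →ₗ[ℝ] Model n :=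
  (LinearMap.fst ℝ _ _).prod <| (LoopSpace.rotateL a.rot ∘ₗ projLoop n).prod <|
    (projCen n + (pairL (-weight q a.wind) ∘ₗ LinearMap.fst ℝ _ _ +
      omegaL q ((2 : ℝ)⁻¹ • a.loop) ∘ₗ LoopSpace.rotateL a.rot ∘ₗ projLoop n)).prod (projRot n)

theorem isTameLinear_translationL (a : HatMT q) : IsTameLinear (translationL a) := by
  have h1 := (LoopSpace.isTameLinear_rotateL a.rot).comp (isTameLinear_projLoop (n := n))
  exact isTameLinear_fst.prod (h1.prod ((isTameLinear_projCen.add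
    (((isTameLinear_pairL _).comp isTameLinear_fst).add
      ((isTameLinear_omegaL q _).comp h1))).prod isTameLinear_projRot))

/-- The linear part of the left translation by `a` in angle coordinates. -/
def translationCLM (a : HatMT q) : Model n →L[ℝ] Model n :=
  ⟨translationL a, (isTameLinear_translationL a).continuous (withSeminorms_model n)
    (withSeminorms_model n)⟩

theorem omega_smul_left (c : ℝ) (η ζ : LoopSpace n) : omega q (c • η) ζ = c * omega q η ζ := by
  rw [← omegaL_apply, map_smul, LinearMap.smul_apply, omegaL_apply, smul_eq_mul]

theorem omega_smul_right (c : ℝ) (η ζ : LoopSpace n) : omega q η (c • ζ) = c * omega q η ζ := by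
  rw [← omegaL_apply, map_smul, omegaL_apply, smul_eq_mul]

theorem translationCLM_apply (a : HatMT q) (h : Model n) : translationCLM a h =
    (h.1, h.2.1.rotate a.rot, h.2.2.1 + (∑ i, ((-weight q a.wind) i : ℝ) * h.1 i +
      omega q a.loop (h.2.1.rotate a.rot) / 2), h.2.2.2) := by
  have h1 : omegaL q ((2 : ℝ)⁻¹ • a.loop) (h.2.1.rotate a.rot) =
      omega q a.loop (h.2.1.rotate a.rot) / 2 := by
    rw [omegaL_apply, omega_smul_left, inv_mul_eq_div]
  rw [← h1, ← pairL_apply]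
  rfl

/-- The constant part of the left translation by `a` on the component with winding number `l`. -/
def translationOffset (a : HatMT q) (l : Fin n → ℤ) : Model n :=
  (fun i => Complex.arg (a.tor i) + l i * Complex.arg a.rot, a.loop,
    Complex.arg a.cen - bil q l l * Complex.arg a.rot +
      (∑ i, ((-weight q a.wind) i : ℝ) * (l i * Complex.arg a.rot) + bil q a.wind l * Real.pi),
    Complex.arg a.rot)

/-- With the left factor fixed, the cocycle is the exponential of an affine function of the angles
and loop of the right factor, and the rotation is by the fixed angle of `a`. Terms involving the
winding number `l` are constant on a component and go into `translationOffset`; the sign `(-1)^{q(a,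
l)}` appears as a multiple of `π`. -/
theorem mul_expLift (a : HatMT q) (l : Fin n → ℤ) (x : Model n) : a * expLift q l x =
    expLift q (a.wind + l) (translationCLM a x + translationOffset a l) := by
  have hr := Circle.exp_arg a.rot
  have hc := Circle.exp_arg a.cen
  have ht : ∀ i, Circle.exp (x.1 i) * a.rot ^ l i =
      Circle.exp (x.1 i + l i * Complex.arg a.rot) := fun i => by
    rw [Circle.exp_add, ← circle_exp_zpow, hr]
  rw [translationCLM_apply]
  refine HatMT.ext rfl (funext fun i => ?_) ?_ ?_ ?_
  · change a.tor i * (Circle.exp (x.1 i) * a.rot ^ l i) =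
      Circle.exp (x.1 i + (Complex.arg (a.tor i) + l i * Complex.arg a.rot))
    rw [ht, ← Circle.exp_arg (a.tor i), ← Circle.exp_add, Circle.exp_arg]
    congr 1
    ring
  · exact add_comm _ _
  · change a.cen * (Circle.exp x.2.2.1 * a.rot ^ (-bil q l l)) * (torusPow (fun i =>
      Circle.exp (x.1 i) * a.rot ^ l i) (-weight q a.wind) * Circle.exp Real.pi ^ bil q a.wind l *
      Circle.exp (omega q a.loop (x.2.1.rotate a.rot) / 2)) = Circle.exp (x.2.2.1 +
      (∑ i, ((-weight q a.wind) i : ℝ) * x.1 i + omega q a.loop (x.2.1.rotate a.rot) / 2) +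
      (Complex.arg a.cen - bil q l l * Complex.arg a.rot +
      (∑ i, ((-weight q a.wind) i : ℝ) * (l i * Complex.arg a.rot) + bil q a.wind l * Real.pi)))
    simp only [ht]
    rw [torusPow_exp, circle_exp_zpow, show a.rot ^ (-bil q l l) =
      Circle.exp (((-bil q l l : ℤ) : ℝ) * Complex.arg a.rot) by rw [← circle_exp_zpow, hr]]
    conv_lhs => rw [← hc]
    simp only [← Circle.exp_add]
    congr 1
    simp only [mul_add, Finset.sum_add_distrib, Int.cast_neg]
    ring
  · change a.rot * Circle.exp x.2.2.2 = Circle.exp (x.2.2.2 + Complex.arg a.rot)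
    rw [Circle.exp_add, hr, mul_comm]

theorem isTameLift_mulLeft (a : HatMT q) : IsTameLift (fun x => a * x) (fun l => a.wind + l)
    (fun l x => translationCLM a x + translationOffset a l)
    (fun l => affineTower (translationCLM a) (translationOffset a l)) where
  semiconj := mul_expLift a
  tower _ := isDerivTower_affine _ _ _
  tame _ := isTameTower_affine _ (isTameLinear_translationL a) _ _

/-- The map `x ↦ a (a⁻¹ x)⁻¹` needs only compositions with affine maps on either side, so no general
chain rule for towers is required. The constant is written as an affine map with linear part `0` so
that `affineTower` provides its derivatives. -/
theorem IsTameLift.mul_left {φ : HatMT q → HatMT q} {σ : (Fin n → ℤ) → (Fin n → ℤ)}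
    {Φ : (Fin n → ℤ) → Model n → Model n}
    {D : (Fin n → ℤ) → ∀ k : ℕ, Model n → (Fin k → Model n) → Model n} (hφ : IsTameLift φ σ Φ D)
    (a : HatMT q) : IsTameLift (fun x => a * φ x) (fun l => a.wind + σ l)
      (fun l x => translationCLM a (Φ l x) +
        ((0 : Model n →L[ℝ] Model n) x + translationOffset a (σ l)))
      (fun l k x v => translationCLM a (D l k x v) + affineTower 0 (translationOffset a (σ l)) k x v)
    where
  semiconj l x := by
    rw [hφ.semiconj, mul_expLift, zero_apply, zero_add]
  tower l := ((hφ.tower l).clm_comp _).add (isDerivTower_affine _ _ _)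
  tame l := ((hφ.tame l).linear_comp (isTameLinear_translationL a)).add
    (isTameTower_affine _ isTameLinear_zero _ _)

theorem IsTameLift.comp_mul_left {φ : HatMT q → HatMT q} {σ : (Fin n → ℤ) → (Fin n → ℤ)}
    {Φ : (Fin n → ℤ) → Model n → Model n}
    {D : (Fin n → ℤ) → ∀ k : ℕ, Model n → (Fin k → Model n) → Model n} (hφ : IsTameLift φ σ Φ D)
    (a : HatMT q) : IsTameLift (fun x => φ (a * x)) (fun l => σ (a.wind + l))
      (fun l x => Φ (a.wind + l) (translationCLM a x + translationOffset a l))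
      (fun l k x v => D (a.wind + l) k (translationCLM a x + translationOffset a l)
        (fun i => translationCLM a (v i))) where
  semiconj l x := by rw [mul_expLift, hφ.semiconj]
  tower l := (hφ.tower (a.wind + l)).comp_affine (translationCLM a) (translationOffset a l)
  tame l := (hφ.tame (a.wind + l)).comp_affine (translationCLM a) (isTameLinear_translationL a)
    (translationOffset a l)

/-- The linear part of the translation changes the central component by `-⟨a.wind, ·⟩ + ω(a.loop,
·)/2`. The new winding number and loop in `vert` contribute exactly the opposite terms. The
remaining terms are rotation invariant. -/
theorem hatForm_translation (a : HatMT q) (l : Fin n → ℤ) (x h k : Model n) :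
    hatForm q (a.wind + l) (translationCLM a x + translationOffset a l).2.1 (translationCLM a h)
      (translationCLM a k) = hatForm q l x.2.1 h k := by
  have hv : ∀ h : Model n, vert q (a.wind + l) (translationCLM a x + translationOffset a l).2.1
      (translationCLM a h) = vert q l x.2.1 h := by
    intro h
    have h0 : ∑ i, (((-weight q a.wind) i : ℤ) : ℝ) * h.1 i =
        -∑ i, (weight q a.wind i : ℝ) * h.1 i := by
      simp
    simp only [translationCLM_apply, vert, translationOffset, weight_add, Prod.snd_add,
      Prod.fst_add, omega_add_left, omega_rotate, Pi.add_apply, Int.cast_add,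
      add_mul, Finset.sum_add_distrib, h0]
    ring
  rw [hatForm, hv, hv]
  simp only [translationCLM_apply, LoopSpace.form_rotate, hatForm]

theorem isIsometry_mulLeft (p : ℝ) (a : HatMT q) :
    IsIsometry (hatMetric p q) (Equiv.mulLeft a) :=
  isIsometry_of_lift (isTameLift_mulLeft a) (σ' := fun l => a⁻¹.wind + l)
    (by rw [Equiv.mulLeft_symm]; exact isTameLift_mulLeft a⁻¹)
    fun l x h k => hatForm_translation a l x h k

/-! ## The inversion -/

/-- The linear part of the inversion in angle coordinates, except for the loop. -/
def inversionL (q : Matrix (Fin n) (Fin n) ℤ) (l : Fin n → ℤ) : Model n →ₗ[ℝ] Model n :=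
  ((-LinearMap.fst ℝ _ _ : Model n →ₗ[ℝ] (Fin n → ℝ)) +
    (projRot n).smulRight (fun i => (l i : ℝ))).prod <| (0 : Model n →ₗ[ℝ] LoopSpace n).prod <|
    (-projCen n + (pairL (-weight q l) ∘ₗ LinearMap.fst ℝ _ _ + (bil q l l : ℝ) • projRot n)).prod
      (-projRot n)

theorem inversionL_apply (l : Fin n → ℤ) (h : Model n) : inversionL q l h =
    (fun i => -h.1 i + h.2.2.2 * l i, 0, -h.2.2.1 + (∑ i, ((-weight q l) i : ℝ) * h.1 i +
      bil q l l * h.2.2.2), -h.2.2.2) := by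
  rw [← pairL_apply]
  rfl

theorem IsTameLinear.neg {F G : Type*} [AddCommGroup F] [Module ℝ F] [Graded F] [AddCommGroup G]
    [Module ℝ G] [Graded G] {A : F →ₗ[ℝ] G} (hA : IsTameLinear A) : IsTameLinear (-A) := by
  obtain ⟨r, b, C, h⟩ := hA
  exact ⟨r, b, C, fun n hn f => by rw [LinearMap.neg_apply, map_neg_eq_map]; exact h n hn f⟩

theorem isTameLinear_smulRight {F G : Type*} [AddCommGroup F] [Module ℝ F] [Graded F]
    [MonoGraded F] [AddCommGroup G] [Module ℝ G] [Graded G] [MonoGraded G] {A : F →ₗ[ℝ] ℝ}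
    (hA : IsTameLinear A) (c : G) : IsTameLinear (A.smulRight c) := by
  obtain ⟨r, b, C, h⟩ := hA
  refine ⟨r, b, fun n => C n * gr n c, fun n hn f => ?_⟩
  rw [LinearMap.smulRight_apply, map_smul_eq_mul, mul_right_comm]
  exact mul_le_mul_of_nonneg_right (h n hn f) (gr_nonneg _ _)

theorem isTameLinear_inversionL (l : Fin n → ℤ) : IsTameLinear (inversionL q l) := by
  refine (isTameLinear_fst.neg.add (isTameLinear_smulRight isTameLinear_projRot _)).prod
    (isTameLinear_zero.prod ((isTameLinear_projCen.neg.add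
      (((isTameLinear_pairL _).comp isTameLinear_fst).add ?_)).prod isTameLinear_projRot.neg))
  exact (isTameLinear_smul (bil q l l : ℝ)).comp isTameLinear_projRot

/-- The linear part of the inversion in angle coordinates, except for the loop. -/
def inversionCLM (q : Matrix (Fin n) (Fin n) ℤ) (l : Fin n → ℤ) : Model n →L[ℝ] Model n :=
  ⟨inversionL q l, (isTameLinear_inversionL l).continuous (withSeminorms_model n)
    (withSeminorms_model n)⟩

/-- The map `(k, η, a, b) ↦ (η, -b)`. -/
def loopRotCLM (n : ℕ) : Model n →L[ℝ] LoopSpace n × ℝ :=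
  ⟨(projLoop n).prod (-projRot n), by
    change Continuous fun x : Model n => (x.2.1, -x.2.2.2)
    fun_prop⟩

/-- The map `η ↦ (0, -η, 0, 0)`. -/
def negLoopL (n : ℕ) : LoopSpace n →ₗ[ℝ] Model n :=
  (0 : LoopSpace n →ₗ[ℝ] (Fin n → ℝ)).prod <| (-LinearMap.id).prod <|
    (0 : LoopSpace n →ₗ[ℝ] ℝ).prod 0

theorem isTameLinear_negLoopL : IsTameLinear (negLoopL n) :=
  isTameLinear_zero.prod (isTameLinear_id.neg.prod (isTameLinear_zero.prod isTameLinear_zero))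

/-- The map `η ↦ (0, -η, 0, 0)`. -/
def negLoopCLM (n : ℕ) : LoopSpace n →L[ℝ] Model n :=
  ⟨negLoopL n, by
    change Continuous fun η : LoopSpace n => ((0 : Fin n → ℝ), -η, (0 : ℝ), (0 : ℝ))
    fun_prop⟩

/-- The constant part of the inversion in angle coordinates. -/
def inversionOffset (q : Matrix (Fin n) (Fin n) ℤ) (l : Fin n → ℤ) : Model n :=
  (0, 0, bil q l l * Real.pi, 0)

/-- The inversion in angle coordinates. -/
def inversionLift (q : Matrix (Fin n) (Fin n) ℤ) (l : Fin n → ℤ) (x : Model n) : Model n :=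
  (inversionCLM q l x + inversionOffset q l) +
    negLoopCLM n ((loopRotCLM n x + 0).1.rotate (Circle.exp (loopRotCLM n x + 0).2))

/-- The derivatives of the inversion in angle coordinates. -/
def inversionTower (q : Matrix (Fin n) (Fin n) ℤ) (l : Fin n → ℤ) (k : ℕ) (x : Model n)
    (v : Fin k → Model n) : Model n :=
  affineTower (inversionCLM q l) (inversionOffset q l) k x v +
    negLoopCLM n (LoopSpace.rotateTower k (loopRotCLM n x + 0) fun i => loopRotCLM n (v i))

theorem weight_neg (l : Fin n → ℤ) : weight q (-l) = -weight q l := Matrix.mulVec_neg _ _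

theorem sum_weight_mul (l : Fin n → ℤ) :
    ∑ i, (weight q l i : ℝ) * (l i : ℝ) = 2 * (bil q l l : ℝ) := by
  have h : l ⬝ᵥ weight q l = 2 * bil q l l := by rw [dotProduct_weight, two_mul]
  have h2 := congrArg (Int.cast : ℤ → ℝ) h
  rw [dotProduct] at h2
  push_cast at h2
  rw [← h2]
  exact Finset.sum_congr rfl fun i _ => mul_comm _ _

theorem bil_neg_left (l m : Fin n → ℤ) : bil q (-l) m = -bil q l m := neg_dotProduct _ _

/-- The exponent `ω(η, η)` of the cocycle vanishes, so the central coordinate stays affine, with the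
sign `(-1)^{q(l, l)}` as the constant `q(l, l) π`. The quadratic winding terms combine through `⟨l,
l⟩ = 2 q(l, l)`. Only the loop component, rotated by a variable angle, is not affine. -/
theorem inv_expLift (l : Fin n → ℤ) (x : Model n) :
    (expLift q l x)⁻¹ = expLift q (-l) (inversionLift q l x) := by
  have hz : loopRotCLM n x + 0 = (x.2.1, -x.2.2.2) := add_zero _
  have hL : inversionLift q l x = (fun i => -x.1 i + x.2.2.2 * l i,
      -x.2.1.rotate (Circle.exp (-x.2.2.2)), -x.2.2.1 + (∑ i, ((-weight q l) i : ℝ) * x.1 i +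
      bil q l l * x.2.2.2) + bil q l l * Real.pi, -x.2.2.2) := by
    have h1 : inversionCLM q l x = _ := inversionL_apply l x
    rw [inversionLift, hz, h1]
    refine Prod.ext ?_ (Prod.ext ?_ (Prod.ext ?_ ?_))
    · exact (add_zero _).trans (add_zero _)
    · exact (congrArg (· + _) (add_zero (0 : LoopSpace n))).trans (zero_add _)
    · exact add_zero _
    · exact (add_zero _).trans (add_zero _)
  rw [hL]
  have ht : ∀ i, Circle.exp (x.1 i) * (Circle.exp x.2.2.2)⁻¹ ^ l i =
      Circle.exp (x.1 i - l i * x.2.2.2) := fun i => by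
    rw [← Circle.exp_neg, circle_exp_zpow, ← Circle.exp_add]
    congr 1
    ring
  refine HatMT.ext rfl (funext fun i => ?_) ?_ ?_ ?_
  · change (Circle.exp (x.1 i))⁻¹ * Circle.exp x.2.2.2 ^ l i =
      Circle.exp (-x.1 i + x.2.2.2 * l i)
    rw [Circle.exp_add, Circle.exp_neg, mul_comm x.2.2.2, ← circle_exp_zpow]
  · change -x.2.1.rotate (Circle.exp x.2.2.2)⁻¹ = -x.2.1.rotate (Circle.exp (-x.2.2.2))
    rw [Circle.exp_neg]
  · change (Circle.exp x.2.2.1 * (Circle.exp x.2.2.2)⁻¹ ^ (-bil q l l) *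
      (torusPow (fun i => Circle.exp (x.1 i) * (Circle.exp x.2.2.2)⁻¹ ^ l i) (-weight q (-l)) *
        Circle.exp Real.pi ^ bil q (-l) l * Circle.exp (omega q
          (-x.2.1.rotate (Circle.exp x.2.2.2)⁻¹) (x.2.1.rotate (Circle.exp x.2.2.2)⁻¹) / 2)))⁻¹ =
      Circle.exp (-x.2.2.1 + (∑ i, ((-weight q l) i : ℝ) * x.1 i + bil q l l * x.2.2.2) +
        bil q l l * Real.pi)
    have h0 : omega q (-x.2.1.rotate (Circle.exp x.2.2.2)⁻¹)
        (x.2.1.rotate (Circle.exp x.2.2.2)⁻¹) = 0 := by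
      rw [← omegaL_apply, map_neg, LinearMap.neg_apply, omegaL_apply, omega_self, neg_zero]
    simp only [ht]
    rw [h0, torusPow_exp, ← Circle.exp_neg, circle_exp_zpow, circle_exp_zpow, weight_neg, neg_neg,
      bil_neg_left]
    simp only [← Circle.exp_add, ← Circle.exp_neg]
    congr 1
    have h1 : ∑ i, (weight q l i : ℝ) * (l i * x.2.2.2) = 2 * bil q l l * x.2.2.2 := by
      rw [← sum_weight_mul, Finset.sum_mul]
      exact Finset.sum_congr rfl fun i _ => (mul_assoc _ _ _).symm
    simp only [mul_sub, Finset.sum_sub_distrib, h1, Pi.neg_apply, Int.cast_neg, neg_mul,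
      Finset.sum_neg_distrib]
    ring
  · exact (Circle.exp_neg _).symm

theorem isTameLift_inv : IsTameLift (fun x : HatMT q => x⁻¹) (fun l => -l) (inversionLift q)
    (inversionTower q) where
  semiconj := inv_expLift
  tower l := (isDerivTower_affine (inversionCLM q l) (inversionOffset q l) Set.univ).add
    ((LoopSpace.isDerivTower_rotate.comp_affine (loopRotCLM n) 0).clm_comp (negLoopCLM n))
  tame l := (isTameTower_affine (inversionCLM q l) (isTameLinear_inversionL l)
    (inversionOffset q l) Set.univ).add ((LoopSpace.isTameTower_rotate.comp_affine (loopRotCLM n)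
      (isTameLinear_projLoop.prod isTameLinear_projRot.neg) 0).linear_comp
        (A := (negLoopCLM n : LoopSpace n →ₗ[ℝ] Model n)) isTameLinear_negLoopL)

theorem inversionTower_one (l : Fin n → ℤ) (x h : Model n) : inversionTower q l 1 x ![h] =
    (fun i => -h.1 i + h.2.2.2 * l i,
      -((-h.2.2.2) • x.2.1.deriv + h.2.1).rotate (Circle.exp (-x.2.2.2)),
      -h.2.2.1 + (∑ i, ((-weight q l) i : ℝ) * h.1 i + bil q l l * h.2.2.2), -h.2.2.2) := by
  have hz : loopRotCLM n x + 0 = (x.2.1, -x.2.2.2) := add_zero _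
  have hR : LoopSpace.rotateTower 1 (x.2.1, -x.2.2.2) (fun i => loopRotCLM n (![h] i)) =
      ((-h.2.2.2) • x.2.1.deriv + h.2.1).rotate (Circle.exp (-x.2.2.2)) := by
    simp only [LoopSpace.rotateTower, LoopSpace.rotateTowerAux, Finset.univ_eq_empty,
      Finset.prod_empty, one_smul, Function.iterate_zero, id]
    rfl
  have h1 : affineTower (inversionCLM q l) (inversionOffset q l) 1 x ![h] = _ := inversionL_apply l h
  rw [inversionTower, hz, hR, h1]
  refine Prod.ext ?_ (Prod.ext ?_ (Prod.ext ?_ ?_))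
  · exact add_zero _
  · exact zero_add _
  · exact add_zero _
  · exact add_zero _

theorem inversionLift_loop (l : Fin n → ℤ) (x : Model n) :
    (inversionLift q l x).2.1 = -x.2.1.rotate (Circle.exp (-x.2.2.2)) := by
  have h := congrArg HatMT.loop (inv_expLift (q := q) l x)
  change -x.2.1.rotate (Circle.exp x.2.2.2)⁻¹ = (inversionLift q l x).2.1 at h
  rw [← h, Circle.exp_neg]

theorem vecFormL_gram_wind (k : Fin n → ℝ) (l : Fin n → ℤ) :
    vecFormL (gram 1 q) k (fun i => (l i : ℝ)) = ∑ i, (weight q l i : ℝ) * k i := by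
  rw [vecFormL_apply]
  refine Finset.sum_congr rfl fun i _ => ?_
  simp only [weight, gram, Matrix.mulVec, dotProduct, Matrix.add_apply, Matrix.transpose_apply]
  push_cast
  rw [Finset.sum_mul]
  exact Finset.sum_congr rfl fun j _ => by ring

/-- The scalar product is invariant under the adjoint action, so the left invariant metric is also
right invariant, and the inversion, with differential `-1` at the identity, preserves it. In
coordinates, with `b`, `b'` the rotation components of `h`, `k`, the torus part produces a term `2
q(l, l) b b'` and the loop part a term `-ω(η, ∂_θ η) b b'`, both cancelled by the products of `vert`
with `b` and `b'`. The terms linear in `b` or `b'` restore the original value of `vert`. -/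
theorem hatForm_inversion (l : Fin n → ℤ) (x h k : Model n) :
    hatForm q (-l) (inversionLift q l x).2.1 (inversionTower q l 1 x ![h])
      (inversionTower q l 1 x ![k]) = hatForm q l x.2.1 h k := by
  set w := Circle.exp (-x.2.2.2)
  set η := x.2.1 with hη
  have hv : ∀ h : Model n, vert q (-l) (inversionLift q l x).2.1 (inversionTower q l 1 x ![h]) =
      -h.2.2.1 - h.2.2.2 * bil q l l - omega q η h.2.1 / 2 + h.2.2.2 * omega q η η.deriv / 2 := by
    intro h
    have h1 : ∑ i, (weight q l i : ℝ) * (h.2.2.2 * l i) = h.2.2.2 * (2 * bil q l l) := by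
      rw [← sum_weight_mul, Finset.mul_sum]
      exact Finset.sum_congr rfl fun i _ => by ring
    have h2 : omega q (-η.rotate w) (-((-h.2.2.2) • η.deriv + h.2.1).rotate w) =
        -h.2.2.2 * omega q η η.deriv + omega q η h.2.1 := by
      rw [← omegaL_apply, map_neg, map_neg, LinearMap.neg_apply, neg_neg, omegaL_apply,
        omega_rotate, omega_add_right, omega_smul_right]
    rw [vert, inversionLift_loop, inversionTower_one, weight_neg]
    simp only
    rw [h2]
    simp only [Pi.neg_apply, Int.cast_neg, mul_add, neg_mul, mul_neg, Finset.sum_add_distrib, h1,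
      Finset.sum_neg_distrib]
    ring
  have hV : vecFormL (gram 1 q) (inversionTower q l 1 x ![h]).1 (inversionTower q l 1 x ![k]).1 =
      vecFormL (gram 1 q) h.1 k.1 - k.2.2.2 * ∑ i, (weight q l i : ℝ) * h.1 i -
        h.2.2.2 * ∑ i, (weight q l i : ℝ) * k.1 i + h.2.2.2 * k.2.2.2 * (2 * bil q l l) := by
    have h1 : ∀ h : Model n, (inversionTower q l 1 x ![h]).1 =
        -h.1 + h.2.2.2 • fun i => (l i : ℝ) := fun h => by
      rw [inversionTower_one]; rfl
    have h2 := vecFormL_symm (gram_symm 1 q) (fun i => (l i : ℝ)) k.1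
    rw [h1, h1, ← sum_weight_mul, ← vecFormL_gram_wind, ← vecFormL_gram_wind, ← vecFormL_gram_wind]
    simp only [map_add, map_neg, map_smul, LinearMap.add_apply, LinearMap.neg_apply,
      LinearMap.smul_apply, smul_eq_mul, h2]
    ring
  have hF : LoopSpace.form (gram 1 q) (inversionTower q l 1 x ![h]).2.1
      (inversionTower q l 1 x ![k]).2.1 = LoopSpace.form (gram 1 q) h.2.1 k.2.1 +
        k.2.2.2 * omega q η h.2.1 + h.2.2.2 * omega q η k.2.1 -
          h.2.2.2 * k.2.2.2 * omega q η η.deriv := by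
    -- All pairings with `∂_θ η` are rewritten as values of `ω`, so that its antisymmetry can be
    -- used.
    have e1 := LoopSpace.form_symm (gram_symm 1 q) η.deriv k.2.1
    have e2 := omega_eq_form q h.2.1 η
    have e3 := omega_eq_form q k.2.1 η
    have e4 := omega_eq_form q η.deriv η
    have a2 := omega_antisymm q h.2.1 η
    have a3 := omega_antisymm q k.2.1 η
    have a4 := omega_antisymm q η.deriv η
    rw [inversionTower_one, inversionTower_one]
    simp only [← LoopSpace.formL_apply, map_neg, LinearMap.neg_apply]
    simp only [LoopSpace.formL_apply, LoopSpace.form_rotate]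
    simp only [← LoopSpace.formL_apply, map_add, map_smul, LinearMap.add_apply,
      LinearMap.smul_apply, smul_eq_mul] at e1 e2 e3 e4 ⊢
    rw [e1, ← e2, ← e3, ← e4, a2, a3, a4]
    ring
  rw [hatForm, hv, hv, hV, hF, hatForm, vert, vert, inversionTower_one, inversionTower_one]
  ring

/-! ## The geodesic symmetries -/

/-- The geodesic symmetry `x ↦ a x⁻¹ a` at `a`. -/
def pointSymmetry (a : HatMT q) : Equiv.Perm (HatMT q) :=
  Equiv.mulLeft a * Equiv.inv (HatMT q) * Equiv.mulLeft a⁻¹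

theorem pointSymmetry_apply (a x : HatMT q) : pointSymmetry a x = a * (a⁻¹ * x)⁻¹ := rfl

theorem pointSymmetry_mul_self (a : HatMT q) : pointSymmetry a * pointSymmetry a = 1 := by
  ext1 x
  simp [pointSymmetry_apply]

theorem pointSymmetry_symm (a : HatMT q) : (pointSymmetry a).symm = pointSymmetry a :=
  inv_eq_of_mul_eq_one_right (pointSymmetry_mul_self a)

/-- The lift is the lift of the inversion between two affine maps, and each of the three factors
preserves `hatForm`. The symmetry being an involution, the same lift serves for its inverse. -/
theorem isIsometry_pointSymmetry (p : ℝ) (a : HatMT q) :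
    IsIsometry (hatMetric p q) (pointSymmetry a) := by
  have h := (isTameLift_inv.comp_mul_left a⁻¹).mul_left a
  have h' : IsTameLift (pointSymmetry a) _ _ _ := h
  refine isIsometry_of_lift h' (by rw [pointSymmetry_symm]; exact h') fun l x u v => ?_
  have e : ∀ u : Model n, (fun i => translationCLM a⁻¹ (![u] i)) = ![translationCLM a⁻¹ u] :=
    fun u => by funext i; fin_cases i; rfl
  simp only [affineTower, zero_apply, zero_add, add_zero, e]
  rw [hatForm_translation, hatForm_inversion, hatForm_translation]

theorem eventually_eq_one_of_inv_eq : ∀ᶠ z : Circle in 𝓝 1, z * z = 1 → z = 1 := by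
  have h : ∀ᶠ z : Circle in 𝓝 1, z ≠ -1 := by
    refine isOpen_ne.mem_nhds fun h => ?_
    have := congrArg (fun z : Circle => (z : ℂ)) h
    norm_num at this
  filter_upwards [h] with z hz h1
  have h2 : (z : ℂ) * z = 1 := by exact_mod_cast congrArg (fun z : Circle => (z : ℂ)) h1
  rcases mul_self_eq_one_iff.1 h2 with h3 | h3
  · exact Circle.ext h3
  · exact absurd (Circle.ext (by simpa using h3)) hz

/-- Near the identity the winding number is `0`. The rotation coordinate squares to `1` and is not
`-1`, so it is `1`; then nothing is twisted, the torus coordinates are `1`, the loop satisfies `2η =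
0`, the cocycle is trivial, and the central coordinate is `1` too. -/
theorem eventually_eq_one_of_mul_self : ∀ᶠ x : HatMT q in 𝓝 1, x * x = 1 → x = 1 := by
  have h1 : ∀ᶠ x : HatMT q in 𝓝 1, x.wind = 0 :=
    (HatMT.continuous_wind.tendsto (1 : HatMT q)).eventually
      ((isOpen_discrete ({0} : Set (Fin n → ℤ))).mem_nhds rfl)
  have h2 : ∀ᶠ x : HatMT q in 𝓝 1, ∀ i, x.tor i * x.tor i = 1 → x.tor i = 1 :=
    Filter.eventually_all.2 fun i => (((continuous_apply i).comp
      HatMT.continuous_tor).tendsto (1 : HatMT q)).eventually eventually_eq_one_of_inv_eq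
  have h3 : ∀ᶠ x : HatMT q in 𝓝 1, x.cen * x.cen = 1 → x.cen = 1 :=
    (HatMT.continuous_cen.tendsto (1 : HatMT q)).eventually eventually_eq_one_of_inv_eq
  have h4 : ∀ᶠ x : HatMT q in 𝓝 1, x.rot * x.rot = 1 → x.rot = 1 :=
    (HatMT.continuous_rot.tendsto (1 : HatMT q)).eventually eventually_eq_one_of_inv_eq
  filter_upwards [h1, h2, h3, h4] with x hw ht hc hr h
  have r1 : x.rot = 1 := hr (congrArg HatMT.rot h)
  have t1 : x.tor = 1 := by
    funext i
    refine ht i ?_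
    have h5 : x.tor i * (x.tor i * x.rot ^ x.wind i) = 1 := congrFun (congrArg HatMT.tor h) i
    simpa [hw, r1] using h5
  have l1 : x.loop = 0 := by
    have := congrArg HatMT.loop h
    rw [HatMT.loop_mul, r1, LoopSpace.rotate_one] at this
    have h2 : (2 : ℝ) • x.loop = 0 := by rw [two_smul]; exact this
    exact (smul_eq_zero.1 h2).resolve_left two_ne_zero
  have c1 : x.cen = 1 := by
    refine hc ?_
    have h5 : x.cen * (x.cen * x.rot ^ (-bil q x.wind x.wind)) * cocycle q x.wind x.loop x.wind
        (fun i => x.tor i * x.rot ^ x.wind i) (x.loop.rotate x.rot) = 1 := congrArg HatMT.cen h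
    simp only [hw, r1, t1, l1, LoopSpace.rotate_one, cocycle, omega_zero_left, bil,
      zero_dotProduct, torusPow] at h5
    simpa using h5
  exact HatMT.ext hw t1 l1 c1 r1

/-- A fixed point `x` of `x ↦ a (a⁻¹ x)⁻¹` means that `a⁻¹ x` is its own inverse, and `a⁻¹ x` is
near `1` when `x` is near `a`. -/
theorem exists_symmetry (p : ℝ) (a : HatMT q) : ∃ ρ : Equiv.Perm (HatMT q),
    IsIsometry (hatMetric p q) ρ ∧ ρ * ρ = 1 ∧ ρ a = a ∧ ∀ᶠ x in 𝓝 a, ρ x = x → x = a := by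
  refine ⟨pointSymmetry a, isIsometry_pointSymmetry p a, pointSymmetry_mul_self a, ?_, ?_⟩
  · simp [pointSymmetry_apply]
  · have h := (isTameLift_mulLeft a⁻¹).continuous.tendsto a
    rw [inv_mul_cancel] at h
    filter_upwards [h.eventually eventually_eq_one_of_mul_self] with x hx h1
    rw [pointSymmetry_apply] at h1
    have h2 : (a⁻¹ * x)⁻¹ = a⁻¹ * x := eq_inv_mul_of_mul_eq h1
    have h3 := hx (by nth_rewrite 1 [← h2]; exact inv_mul_cancel _)
    exact (inv_mul_eq_one.1 h3).symm

/-! ## Continuity of the multiplication -/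

theorem HatMT.continuous_mul : Continuous fun z : HatMT q × HatMT q => z.1 * z.2 := by
  have hw1 : Continuous fun z : HatMT q × HatMT q => z.1.wind :=
    HatMT.continuous_wind.comp continuous_fst
  have hw2 : Continuous fun z : HatMT q × HatMT q => z.2.wind :=
    HatMT.continuous_wind.comp continuous_snd
  have ht1 : Continuous fun z : HatMT q × HatMT q => z.1.tor :=
    HatMT.continuous_tor.comp continuous_fst
  have ht2 : Continuous fun z : HatMT q × HatMT q => z.2.tor :=
    HatMT.continuous_tor.comp continuous_snd
  have hl1 : Continuous fun z : HatMT q × HatMT q => z.1.loop :=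
    HatMT.continuous_loop.comp continuous_fst
  have hl2 : Continuous fun z : HatMT q × HatMT q => z.2.loop :=
    HatMT.continuous_loop.comp continuous_snd
  have hc1 : Continuous fun z : HatMT q × HatMT q => z.1.cen :=
    HatMT.continuous_cen.comp continuous_fst
  have hc2 : Continuous fun z : HatMT q × HatMT q => z.2.cen :=
    HatMT.continuous_cen.comp continuous_snd
  have hr1 : Continuous fun z : HatMT q × HatMT q => z.1.rot :=
    HatMT.continuous_rot.comp continuous_fst
  have hr2 : Continuous fun z : HatMT q × HatMT q => z.2.rot :=
    HatMT.continuous_rot.comp continuous_snd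
  -- The exponents are integer valued and continuous, hence locally constant, so powers with
  -- variable exponents are continuous.
  have hz : ∀ {f : HatMT q × HatMT q → Circle} {m : HatMT q × HatMT q → ℤ}, Continuous f →
      Continuous m → Continuous fun z => f z ^ m z := fun hf hm =>
    (continuous_prod_of_discrete_right.2 fun k : ℤ => continuous_zpow k :
      Continuous fun y : Circle × ℤ => y.1 ^ y.2).comp (hf.prodMk hm)
  have hd : ∀ {A : Type} [TopologicalSpace A] (f : (Fin n → ℤ) × (Fin n → ℤ) → A),
      Continuous fun z : HatMT q × HatMT q => f (z.1.wind, z.2.wind) := fun f =>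
    (continuous_of_discreteTopology (f := f)).comp (hw1.prodMk hw2)
  have hrot : Continuous fun z : HatMT q × HatMT q => z.2.loop.rotate z.1.rot :=
    LoopSpace.continuous_rotate.comp (hr1.prodMk hl2)
  have hs : Continuous fun z : HatMT q × HatMT q =>
      fun i => z.2.tor i * z.1.rot ^ z.2.wind i :=
    continuous_pi fun i => ((continuous_apply i).comp ht2).mul
      (hz hr1 ((continuous_apply i).comp hw2))
  refine HatMT.continuous_iff.2 ⟨hw1.add hw2, ?_, hl1.add hrot, ?_, hr1.mul hr2⟩
  · exact continuous_pi fun i => ((continuous_apply i).comp ht1).mul ((continuous_apply i).comp hs)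
  · refine (hc1.mul (hc2.mul (hz hr1 (hd fun l => -bil q l.2 l.2)))).mul ((Continuous.mul ?_ ?_).mul
      (Circle.exp.continuous.comp (((continuous_omega q).comp (hl1.prodMk hrot)).div_const 2)))
    · exact continuous_finsetProd _ fun i _ => hz ((continuous_apply i).comp hs)
        (hd fun l => (-weight q l.1) i)
    · exact hz continuous_const (hd fun l => bil q l.1 l.2)

end

/-! ### The Lorentzian metric and its Levi-Civita connection -/

section

/-! ## Combining smooth tame maps -/

section TameSmooth

variable {F G H : Type*} [AddCommGroup F] [Module ℝ F] [TopologicalSpace F] [Graded F]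
  [MonoGraded F] [AddCommGroup G] [Module ℝ G] [TopologicalSpace G] [Graded G] [MonoGraded G]
  [AddCommGroup H] [Module ℝ H] [TopologicalSpace H] [Graded H] [MonoGraded H]

/-- `f` has a tower of derivatives which satisfies locally uniform tame estimates. -/
def HasTameTower (f : F → G) (U : Set F) : Prop := ∃ D, IsDerivTower f U D ∧ IsTameTower U D

theorem HasTameTower.smoothTameOn {f : F → G} {U : Set F} (hf : HasTameTower f U) :
    SmoothTameOn f U :=
  let ⟨_, h, h'⟩ := hf
  smoothTameOn_of_tower h h'

theorem HasTameTower.smoothOn {f : F → G} {U : Set F} (hf : HasTameTower f U) :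
    SmoothOn f U :=
  let ⟨D, h, _⟩ := hf
  ⟨D, h⟩

theorem SmoothOn.hasTameTower {f : F → ℝ} {U : Set F} (hf : SmoothOn f U) : HasTameTower f U :=
  let ⟨D, h⟩ := hf
  ⟨D, h, h.isTameTower_real⟩

theorem hasTameTower_clm [ContinuousAdd G] (A : F →L[ℝ] G) (hA : IsTameLinear (A : F →ₗ[ℝ] G))
    (U : Set F) : HasTameTower (fun x => A x) U := by
  have h : HasTameTower (fun x => A x + 0) U :=
    ⟨_, isDerivTower_affine A 0 U, isTameTower_affine A hA 0 U⟩
  simpa only [add_zero] using h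

theorem HasTameTower.add [ContinuousAdd G] {f g : F → G} {U : Set F} (hf : HasTameTower f U)
    (hg : HasTameTower g U) : HasTameTower (fun x => f x + g x) U :=
  let ⟨_, h, h'⟩ := hf
  let ⟨_, k, k'⟩ := hg
  ⟨_, h.add k, h'.add k'⟩

theorem HasTameTower.prodMk {f : F → G} {g : F → H} {U : Set F} (hf : HasTameTower f U)
    (hg : HasTameTower g U) : HasTameTower (fun x => (f x, g x)) U :=
  let ⟨_, h, h'⟩ := hf
  let ⟨_, k, k'⟩ := hg
  ⟨_, h.prodMk k, h'.prodMk k'⟩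

theorem HasTameTower.smul [ContinuousAdd H] [ContinuousSMul ℝ H] {f : F → ℝ} {g : F → H} {U : Set F}
    (hf : SmoothOn f U) (hg : HasTameTower g U) : HasTameTower (fun x => f x • g x) U :=
  let ⟨_, h⟩ := hf
  let ⟨_, k, k'⟩ := hg
  ⟨_, h.bilin (LinearMap.lsmul ℝ H) (by simpa using continuous_smul) k, IsTameTower.smul (g := g) h k'⟩

theorem SmoothOn.neg {f : F → ℝ} {U : Set F} (hf : SmoothOn f U) : SmoothOn (fun x => -f x) U :=
  hf.clm_comp (-ContinuousLinearMap.id ℝ ℝ)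

theorem SmoothOn.sub {f g : F → ℝ} {U : Set F} (hf : SmoothOn f U) (hg : SmoothOn g U) :
    SmoothOn (fun x => f x - g x) U := by
  simpa only [sub_eq_add_neg] using hf.add hg.neg

end TameSmooth

variable {n : ℕ} {q : Matrix (Fin n) (Fin n) ℤ}

/-! ## The metric -/

/-- The linear functional `vert q l η`. -/
def vertL (q : Matrix (Fin n) (Fin n) ℤ) (l : Fin n → ℤ) (η : LoopSpace n) : Model n →ₗ[ℝ] ℝ :=
  projCen n + pairL (weight q l) ∘ₗ LinearMap.fst ℝ _ _ -
    (2 : ℝ)⁻¹ • (omegaL q η ∘ₗ projLoop n)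

theorem vertL_apply (l : Fin n → ℤ) (η : LoopSpace n) (h : Model n) :
    vertL q l η h = vert q l η h := by
  have h1 : vertL q l η h = h.2.2.1 + pairL (weight q l) h.1 - (2 : ℝ)⁻¹ * omegaL q η h.2.1 := rfl
  rw [h1, pairL_apply, omegaL_apply, inv_mul_eq_div, vert]

/-- The metric as a bilinear map. -/
def hatFormL (q : Matrix (Fin n) (Fin n) ℤ) (l : Fin n → ℤ) (η : LoopSpace n) :
    Model n →ₗ[ℝ] Model n →ₗ[ℝ] ℝ :=
  (vecFormL (gram 1 q)).compl₁₂ (LinearMap.fst ℝ _ _) (LinearMap.fst ℝ _ _) +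
    (LoopSpace.formL (gram 1 q)).compl₁₂ (projLoop n) (projLoop n) -
    (LinearMap.mul ℝ ℝ).compl₁₂ (vertL q l η) (projRot n) -
    (LinearMap.mul ℝ ℝ).compl₁₂ (projRot n) (vertL q l η)

theorem hatFormL_apply (l : Fin n → ℤ) (η : LoopSpace n) (h k : Model n) :
    hatFormL q l η h k = hatForm q l η h k := by
  rw [hatForm, ← vertL_apply, ← vertL_apply]
  rfl

theorem hatForm_symm (l : Fin n → ℤ) (η : LoopSpace n) (h k : Model n) :
    hatForm q l η h k = hatForm q l η k h := by
  rw [hatForm, hatForm, vecFormL_symm (gram_symm 1 q), LoopSpace.form_symm (gram_symm 1 q)]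
  ring

theorem hatForm_self_of_rot_eq_zero (l : Fin n → ℤ) (η : LoopSpace n) {h : Model n}
    (hb : h.2.2.2 = 0) : hatForm q l η h h =
      vecFormL (gram 1 q) h.1 h.1 + LoopSpace.form (gram 1 q) h.2.1 h.2.1 := by
  rw [hatForm, hb]
  ring

/-- Pairing with the central direction shows `b = 0`. The square of `h` then involves only the
positive definite parts, so the constant and the loop vanish, and pairing with the rotation
direction shows `a = 0`. -/
theorem eq_zero_of_hatForm (hq : (gram 1 q).PosDef) (l : Fin n → ℤ) (η : LoopSpace n) (h : Model n)
    (hh : ∀ k, hatForm q l η h k = 0) : h = 0 := by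
  have hb : h.2.2.2 = 0 := by
    have h1 := hh (0, 0, 1, 0)
    have h2 : vert q l η (0, 0, 1, 0) = 1 := by
      simp [vert, omega_zero_right]
    have h3 : LoopSpace.form (gram 1 q) h.2.1 0 = 0 := map_zero (LoopSpace.formL (gram 1 q) h.2.1)
    rw [hatForm, h2] at h1
    simp only [map_zero, h3] at h1
    linarith
  have h1 : hatForm q l η h h = 0 := hh h
  rw [hatForm_self_of_rot_eq_zero l η hb] at h1
  have h2 := vecFormL_nonneg_and hq h.1
  have h3 := LoopSpace.form_nonneg_and hq h.2.1
  have hk : h.1 = 0 := h2.2 (by linarith)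
  have hη : h.2.1 = 0 := h3.2 (by linarith)
  have ha : h.2.2.1 = 0 := by
    have h4 := hh (0, 0, 0, 1)
    have h6 : LoopSpace.form (gram 1 q) h.2.1 0 = 0 := map_zero (LoopSpace.formL (gram 1 q) h.2.1)
    have h5 : vert q l η h = h.2.2.1 := by
      simp [vert, hk, hη, omega_zero_right]
    rw [hatForm, h5, hb] at h4
    simp only [map_zero, h6] at h4
    linarith
  exact Prod.ext hk (Prod.ext hη (Prod.ext ha hb))

theorem hasSmooth_proj {F : Type*} [AddCommGroup F] [Module ℝ F] [TopologicalSpace F]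
    {f : F → Model n} {U : Set F} (hf : SmoothOn f U) :
    SmoothOn (fun x => (f x).1) U ∧ SmoothOn (fun x => (f x).2.1) U ∧
      SmoothOn (fun x => (f x).2.2.1) U ∧ SmoothOn (fun x => (f x).2.2.2) U :=
  ⟨hf.clm_comp (ContinuousLinearMap.fst ℝ _ _),
    (hf.clm_comp (ContinuousLinearMap.snd ℝ _ _)).clm_comp (ContinuousLinearMap.fst ℝ _ _),
    ((hf.clm_comp (ContinuousLinearMap.snd ℝ _ _)).clm_comp
      (ContinuousLinearMap.snd ℝ _ _)).clm_comp (ContinuousLinearMap.fst ℝ _ _),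
    ((hf.clm_comp (ContinuousLinearMap.snd ℝ _ _)).clm_comp
      (ContinuousLinearMap.snd ℝ _ _)).clm_comp (ContinuousLinearMap.snd ℝ _ _)⟩

/-- The functional `k ↦ ∑ mᵢ kᵢ` as a continuous linear map. -/
def pairCLM (m : Fin n → ℤ) : (Fin n → ℝ) →L[ℝ] ℝ := LinearMap.toContinuousLinearMap (pairL m)

theorem pairCLM_apply (m : Fin n → ℤ) (k : Fin n → ℝ) : pairCLM m k = ∑ i, (m i : ℝ) * k i :=
  pairL_apply m k

theorem smoothOn_omega {F : Type*} [AddCommGroup F] [Module ℝ F] [TopologicalSpace F]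
    {f g : F → LoopSpace n} {U : Set F} (hf : SmoothOn f U) (hg : SmoothOn g U) :
    SmoothOn (fun x => omega q (f x) (g x)) U := by
  simpa only [omegaL_apply] using hf.bilin (omegaL q) (continuous_omegaL q) hg

theorem smoothOn_vert {F : Type*} [AddCommGroup F] [Module ℝ F] [TopologicalSpace F] [Graded F]
    [MonoGraded F] (l : Fin n → ℤ) {η : F → LoopSpace n} {f : F → Model n} {U : Set F}
    (hη : SmoothOn η U) (hf : SmoothOn f U) : SmoothOn (fun x => vert q l (η x) (f x)) U := by
  obtain ⟨f1, f2, f3, -⟩ := hasSmooth_proj hf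
  have h1 : SmoothOn (fun x => ∑ i, (weight q l i : ℝ) * (f x).1 i) U := by
    simpa only [pairCLM_apply] using f1.clm_comp (pairCLM (weight q l))
  have h2 : SmoothOn (fun x => omega q (η x) (f x).2.1 / 2) U := by
    simpa only [div_eq_mul_inv] using (smoothOn_omega hη f2).mul (smoothOn_const (2 : ℝ)⁻¹ U)
  exact (f3.add h1).sub h2

theorem smoothOn_hatForm {F : Type*} [AddCommGroup F] [Module ℝ F] [TopologicalSpace F] [Graded F]
    [MonoGraded F] (l : Fin n → ℤ) {η : F → LoopSpace n} {f g : F → Model n} {U : Set F}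
    (hη : SmoothOn η U) (hf : SmoothOn f U) (hg : SmoothOn g U) :
    SmoothOn (fun x => hatForm q l (η x) (f x) (g x)) U := by
  obtain ⟨f1, f2, -, f4⟩ := hasSmooth_proj hf
  obtain ⟨g1, g2, -, g4⟩ := hasSmooth_proj hg
  exact (((f1.bilin (vecFormL (gram 1 q)) (continuous_vecFormL _) g1).add
    (f2.bilin (LoopSpace.formL (gram 1 q)) (LoopSpace.continuous_form _) g2)).sub
      ((smoothOn_vert l hη hf).mul g4)).sub (f4.mul (smoothOn_vert l hη hg))

/-- Transition maps are locally translations, so their first derivative is the identity and,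
likewise, their second derivative is zero. Metric and Christoffel symbols transform without any
correction. -/
theorem transition_one_eq {c c' : HatMT q} {D : ∀ k : ℕ, Model n → (Fin k → Model n) → Model n}
    (hD : IsDerivTower ((hatChart c).symm ≫ₕ hatChart c')
      ((hatChart c).symm ≫ₕ hatChart c').source D) {x : Model n}
    (hx : x ∈ ((hatChart c).symm ≫ₕ hatChart c').source) (h : Model n) : D 1 x ![h] = h := by
  rw [transition_source] at hD hx
  exact isTameLift_id.tower_one_eq hD hx h

theorem transition_two_eq {c c' : HatMT q} {D : ∀ k : ℕ, Model n → (Fin k → Model n) → Model n}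
    (hD : IsDerivTower ((hatChart c).symm ≫ₕ hatChart c')
      ((hatChart c).symm ≫ₕ hatChart c').source D) {x : Model n}
    (hx : x ∈ ((hatChart c).symm ≫ₕ hatChart c').source) (h k : Model n) : D 2 x ![h, k] = 0 := by
  rw [transition_source] at hD hx
  exact isTameLift_id.tower_two_eq hD hx h k

theorem transition_loop (c c' : HatMT q) (x : Model n) :
    (((hatChart c).symm ≫ₕ hatChart c') x).2.1 = x.2.1 := by
  change ((hatChart c).symm x).loop = x.2.1
  rw [hatChart_symm_apply]
  exact add_zero _

theorem isMetric_hatMetric {p : ℝ} (hp : 0 < p) (hq : (gram 1 q).PosDef) :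
    IsMetric (hatMetric p q) where
  bilinear := by
    rintro _ ⟨c, rfl⟩ x -
    exact ⟨p • hatFormL q c.wind x.2.1, fun h k => by
      rw [hatMetric_eq, ← hatFormL_apply]; rfl⟩
  symm := by
    rintro _ ⟨c, rfl⟩ x - h k
    rw [hatMetric_eq, hatMetric_eq, hatForm_symm]
  nondegenerate := by
    rintro _ ⟨c, rfl⟩ x - h hh
    refine eq_zero_of_hatForm hq c.wind x.2.1 h fun k => ?_
    have h1 := hh k
    rw [hatMetric_eq] at h1
    exact (mul_eq_zero.1 h1).resolve_left hp.ne'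
  smooth := by
    rintro _ ⟨c, rfl⟩
    simp only [hatMetric_eq]
    set U : Set (Model n × Model n × Model n) := (hatChart c).target ×ˢ Set.univ
    have h1 := smoothOn_clm (ContinuousLinearMap.fst ℝ (Model n) (Model n × Model n)) U
    have h2 := (smoothOn_clm (ContinuousLinearMap.snd ℝ (Model n) (Model n × Model n)) U).clm_comp
      (ContinuousLinearMap.fst ℝ _ _)
    have h3 := (smoothOn_clm (ContinuousLinearMap.snd ℝ (Model n) (Model n × Model n)) U).clm_comp
      (ContinuousLinearMap.snd ℝ _ _)
    exact (smoothOn_const p U).mul (smoothOn_hatForm c.wind (hasSmooth_proj h1).2.1 h2 h3)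
  transition := by
    rintro _ ⟨c, rfl⟩ _ ⟨c', rfl⟩ D hD x hx h k
    rw [transition_one_eq hD hx, transition_one_eq hD hx, hatMetric_eq, hatMetric_eq,
      transition_loop]
    rw [transition_source] at hx
    rw [wind_eq_of_mem_localDomain hx]

/-- The vector `c + d`, in coordinates `(0, 0, 1, 1)`, has square `-2p`. On the hyperplane `b = 0`
the form is nonnegative, so a negative definite subspace meets it only in `0` and is mapped
injectively to `ℝ` by the rotation coefficient. -/
theorem isLorentzian_hatMetric {p : ℝ} (hp : 0 < p) (hq : (gram 1 q).PosDef) :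
    IsLorentzian (hatMetric p q) := by
  rintro _ ⟨c, rfl⟩ x -
  refine ⟨⟨(0, 0, 1, 1), ?_⟩, fun W hW => ?_⟩
  · have h1 : LoopSpace.form (gram 1 q) (0 : LoopSpace n) 0 = 0 :=
      map_zero (LoopSpace.formL (gram 1 q) 0)
    have h2 : vert q c.wind x.2.1 (0, 0, 1, 1) = 1 := by
      simp [vert, omega_zero_right]
    rw [hatMetric_eq, hatForm, h2]
    simp only [map_zero, h1]
    linarith
  · have hinj : Function.Injective (projRot n ∘ₗ W.subtype) := by
      rw [injective_iff_map_eq_zero]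
      intro h hb
      by_contra hne
      have h1 := hW h h.2 fun h0 => hne (Subtype.ext h0)
      rw [hatMetric_eq, hatForm_self_of_rot_eq_zero _ _ (show h.1.2.2.2 = 0 from hb)] at h1
      have h2 := (vecFormL_nonneg_and hq h.1.1).1
      have h3 := (LoopSpace.form_nonneg_and hq h.1.2.1).1
      nlinarith
    simpa using LinearMap.rank_le_of_injective _ hinj

/-! ## The Levi-Civita connection -/

/-- The loop component of the Christoffel symbols. -/
def gammaLoop (h k : Model n) : LoopSpace n :=
  (2 : ℝ)⁻¹ • (h.2.2.2 • k.2.1.deriv + k.2.2.2 • h.2.1.deriv)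

/-- The Christoffel symbols of the metric. -/
def hatGamma (q : Matrix (Fin n) (Fin n) ℤ)
    (_ : OpenPartialHomeomorph (HatMT q) (Model n)) (x h k : Model n) : Model n :=
  (0, gammaLoop h k, omega q x.2.1 (gammaLoop h k) / 2, 0)

theorem gammaLoop_symm (h k : Model n) : gammaLoop h k = gammaLoop k h := by
  rw [gammaLoop, gammaLoop, add_comm]

/-- The loop component of the Christoffel symbols, as a bilinear map. -/
def gammaLoopL (n : ℕ) : Model n →ₗ[ℝ] Model n →ₗ[ℝ] LoopSpace n :=
  LinearMap.mk₂ ℝ gammaLoop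
    (fun h h' k => by
      simp only [gammaLoop, Prod.snd_add, Prod.fst_add, LoopSpace.deriv_add, add_smul, smul_add]
      abel)
    (fun c h k => by
      simp only [gammaLoop, Prod.smul_snd, Prod.smul_fst, LoopSpace.deriv_smul, smul_add, smul_smul,
        smul_eq_mul]
      congr 2 <;> ring)
    (fun h k k' => by
      simp only [gammaLoop, Prod.snd_add, Prod.fst_add, LoopSpace.deriv_add, add_smul, smul_add]
      abel)
    (fun c h k => by
      simp only [gammaLoop, Prod.smul_snd, Prod.smul_fst, LoopSpace.deriv_smul, smul_add, smul_smul,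
        smul_eq_mul]
      congr 2 <;> ring)

theorem form_gammaLoop (h k W : Model n) : LoopSpace.form (gram 1 q) (gammaLoop h k) W.2.1 =
    (h.2.2.2 * omega q W.2.1 k.2.1 + k.2.2.2 * omega q W.2.1 h.2.1) / 2 := by
  have e := fun η : LoopSpace n => LoopSpace.form_symm (gram_symm 1 q) η.deriv W.2.1
  rw [omega_eq_form, omega_eq_form, ← e, ← e]
  simp only [gammaLoop, ← LoopSpace.formL_apply, map_add, map_smul, LinearMap.add_apply,
    LinearMap.smul_apply, smul_eq_mul]
  ring

/-- The central component of the Christoffel symbols is chosen to make `vert` vanish on them, and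
their rotation component is `0`; only the pairing of the loop components remains. -/
theorem hatForm_hatGamma (e : OpenPartialHomeomorph (HatMT q) (Model n)) (l : Fin n → ℤ)
    (x h k W : Model n) : hatForm q l x.2.1 (hatGamma q e x h k) W =
      (h.2.2.2 * omega q W.2.1 k.2.1 + k.2.2.2 * omega q W.2.1 h.2.1) / 2 := by
  have hv : vert q l x.2.1 (hatGamma q e x h k) = 0 := by
    simp [vert, hatGamma]
  rw [hatForm, hv, ← form_gammaLoop]
  simp [hatGamma]

theorem HasDirDeriv.proj {F : Type*} [AddCommGroup F] [Module ℝ F] [TopologicalSpace F] {f : F → Model n} {x h : F}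
    {y : Model n} (hf : HasDirDeriv f x h y) : HasDirDeriv (fun x => (f x).1) x h y.1 ∧
      HasDirDeriv (fun x => (f x).2.1) x h y.2.1 ∧ HasDirDeriv (fun x => (f x).2.2.1) x h y.2.2.1 ∧
        HasDirDeriv (fun x => (f x).2.2.2) x h y.2.2.2 :=
  have s1 := hf.clm_comp (ContinuousLinearMap.snd ℝ (Fin n → ℝ) (LoopSpace n × ℝ × ℝ))
  have s2 := s1.clm_comp (ContinuousLinearMap.snd ℝ (LoopSpace n) (ℝ × ℝ))
  ⟨hf.clm_comp (ContinuousLinearMap.fst ℝ (Fin n → ℝ) (LoopSpace n × ℝ × ℝ)),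
    s1.clm_comp (ContinuousLinearMap.fst ℝ (LoopSpace n) (ℝ × ℝ)),
    s2.clm_comp (ContinuousLinearMap.fst ℝ ℝ ℝ), s2.clm_comp (ContinuousLinearMap.snd ℝ ℝ ℝ)⟩

theorem HasDirDeriv.hasDerivAt_omega {f g : ℝ → LoopSpace n} {t : ℝ} {y z : LoopSpace n}
    (hf : HasDirDeriv f t 1 y) (hg : HasDirDeriv g t 1 z) :
    HasDerivAt (fun s => omega q (f s) (g s)) (omega q y (g t) + omega q (f t) z) t := by
  have h := hf.bilin (omegaL q) (continuous_omegaL q) hg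
  simp only [omegaL_apply] at h
  exact hasDirDeriv_real_iff.1 h

theorem HasDirDeriv.hasDerivAt_vert (l : Fin n → ℤ) {c V : ℝ → Model n} {t : ℝ} {c' V' : Model n}
    (hc : HasDirDeriv c t 1 c') (hV : HasDirDeriv V t 1 V') :
    HasDerivAt (fun s => vert q l (c s).2.1 (V s))
      (vert q l (c t).2.1 V' - omega q c'.2.1 (V t).2.1 / 2) t := by
  obtain ⟨v1, v2, v3, -⟩ := hV.proj
  have h1 := hasDirDeriv_real_iff.1 (v1.clm_comp (pairCLM (weight q l)))
  simp only [pairCLM_apply] at h1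
  have h := ((hasDirDeriv_real_iff.1 v3).add h1).sub ((hc.proj.2.1.hasDerivAt_omega (q := q) v2).div_const 2)
  refine h.congr_deriv ?_
  rw [vert]
  ring

/-- The last summand is the derivative of the metric coefficients along the curve. It comes from the
term `-ω(η, ·)/2` of `vert` alone; the Christoffel symbols have to compensate it. -/
theorem HasDirDeriv.hasDerivAt_hatForm (l : Fin n → ℤ) {c V W : ℝ → Model n} {t : ℝ} {c' V' W' : Model n}
    (hc : HasDirDeriv c t 1 c') (hV : HasDirDeriv V t 1 V') (hW : HasDirDeriv W t 1 W') :
    HasDerivAt (fun s => hatForm q l (c s).2.1 (V s) (W s))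
      (hatForm q l (c t).2.1 V' (W t) + hatForm q l (c t).2.1 (V t) W' +
        ((W t).2.2.2 * omega q c'.2.1 (V t).2.1 + (V t).2.2.2 * omega q c'.2.1 (W t).2.1) / 2) t := by
  obtain ⟨v1, v2, -, v4⟩ := hV.proj
  obtain ⟨w1, w2, -, w4⟩ := hW.proj
  have h1 := hasDirDeriv_real_iff.1 (v1.bilin (vecFormL (gram 1 q)) (continuous_vecFormL _) w1)
  have h2 := hasDirDeriv_real_iff.1
    (v2.bilin (LoopSpace.formL (gram 1 q)) (LoopSpace.continuous_form _) w2)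
  have h := ((h1.add h2).sub ((hc.hasDerivAt_vert (q := q) l hV).mul (hasDirDeriv_real_iff.1 w4))).sub
    ((hasDirDeriv_real_iff.1 v4).mul (hc.hasDerivAt_vert (q := q) l hW))
  refine h.congr_deriv ?_
  simp only [hatForm, LoopSpace.formL_apply]
  ring

/-- Real coefficients, smooth in the arguments, multiply the tame linear map `∂_θ` applied to a
component. -/
theorem hasTameTower_gammaLoop : HasTameTower (fun z : Model n × Model n × Model n =>
    gammaLoop z.2.1 z.2.2) Set.univ := by
  set U : Set (Model n × Model n × Model n) := Set.univ
  have h2 := (smoothOn_clm (ContinuousLinearMap.snd ℝ (Model n) (Model n × Model n)) U).clm_comp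
    (ContinuousLinearMap.fst ℝ _ _)
  have h3 := (smoothOn_clm (ContinuousLinearMap.snd ℝ (Model n) (Model n × Model n)) U).clm_comp
    (ContinuousLinearMap.snd ℝ _ _)
  have t2 : IsTameLinear (LoopSpace.derivL n ∘ₗ projLoop n ∘ₗ LinearMap.fst ℝ (Model n) (Model n) ∘ₗ
      LinearMap.snd ℝ (Model n) (Model n × Model n)) :=
    LoopSpace.isTameLinear_derivL.comp (isTameLinear_projLoop.comp
      (isTameLinear_fst.comp isTameLinear_snd))
  have t3 : IsTameLinear (LoopSpace.derivL n ∘ₗ projLoop n ∘ₗ LinearMap.snd ℝ (Model n) (Model n) ∘ₗ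
      LinearMap.snd ℝ (Model n) (Model n × Model n)) :=
    LoopSpace.isTameLinear_derivL.comp (isTameLinear_projLoop.comp
      (isTameLinear_snd.comp isTameLinear_snd))
  have d2 : HasTameTower (fun z : Model n × Model n × Model n => z.2.1.2.1.deriv) U :=
    hasTameTower_clm ⟨_, LoopSpace.continuous_deriv.comp (f := fun z : Model n × Model n × Model n =>
      z.2.1.2.1) (by fun_prop)⟩ t2 U
  have d3 : HasTameTower (fun z : Model n × Model n × Model n => z.2.2.2.1.deriv) U :=
    hasTameTower_clm ⟨_, LoopSpace.continuous_deriv.comp (f := fun z : Model n × Model n × Model n =>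
      z.2.2.2.1) (by fun_prop)⟩ t3 U
  exact HasTameTower.smul (smoothOn_const _ _) ((HasTameTower.smul (hasSmooth_proj h2).2.2.2 d3).add
    (HasTameTower.smul (hasSmooth_proj h3).2.2.2 d2))

theorem HasTameTower.mono {F G : Type*} [AddCommGroup F] [Module ℝ F] [TopologicalSpace F] [Graded F]
    [MonoGraded F] [AddCommGroup G] [Module ℝ G] [TopologicalSpace G] [Graded G] [MonoGraded G]
    {f : F → G} {U V : Set F} (hf : HasTameTower f U) (hV : V ⊆ U) : HasTameTower f V :=
  let ⟨D, h, h'⟩ := hf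
  ⟨D, h.mono hV, h'.mono hV⟩

theorem hasTameTower_hatGamma (e : OpenPartialHomeomorph (HatMT q) (Model n)) :
    HasTameTower (fun z : Model n × Model n × Model n => hatGamma q e z.1 z.2.1 z.2.2) Set.univ := by
  have h1 : SmoothOn (fun z : Model n × Model n × Model n => z.1) Set.univ :=
    smoothOn_clm (ContinuousLinearMap.fst ℝ (Model n) (Model n × Model n)) Set.univ
  have h2 : SmoothOn (fun z : Model n × Model n × Model n =>
      omega q z.1.2.1 (gammaLoop z.2.1 z.2.2) / 2) Set.univ := by
    simpa only [div_eq_mul_inv] using (smoothOn_omega (hasSmooth_proj h1).2.1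
      hasTameTower_gammaLoop.smoothOn).mul (smoothOn_const (2 : ℝ)⁻¹ Set.univ)
  have h0 : HasTameTower (fun _ : Model n × Model n × Model n => (0 : Fin n → ℝ)) Set.univ :=
    hasTameTower_clm 0 isTameLinear_zero _
  exact h0.prodMk (hasTameTower_gammaLoop.prodMk (h2.hasTameTower.prodMk
    (smoothOn_const (0 : ℝ) _).hasTameTower))

theorem isLeviCivita_hatGamma (p : ℝ) (q : Matrix (Fin n) (Fin n) ℤ) :
    IsLeviCivita (hatMetric p q) (hatGamma q) where
  bilinear := by
    rintro e - x -
    refine ⟨(gammaLoopL n).compr₂ ((0 : LoopSpace n →ₗ[ℝ] (Fin n → ℝ)).prod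
      (LinearMap.id.prod (((2 : ℝ)⁻¹ • omegaL q x.2.1).prod 0))), fun h k => ?_⟩
    have h1 : (2 : ℝ)⁻¹ * omegaL q x.2.1 (gammaLoop h k) = omega q x.2.1 (gammaLoop h k) / 2 := by
      rw [omegaL_apply, inv_mul_eq_div]
    rw [hatGamma, ← h1]
    rfl
  smooth e _ := ((hasTameTower_hatGamma e).mono (Set.subset_univ _)).smoothTameOn
  transition := by
    rintro _ ⟨c, rfl⟩ _ ⟨c', rfl⟩ D hD x hx h k
    rw [transition_one_eq hD hx, transition_one_eq hD hx, transition_one_eq hD hx,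
      transition_two_eq hD hx, add_zero, hatGamma, hatGamma, transition_loop]
  symm e _ x _ h k := by rw [hatGamma, hatGamma, gammaLoop_symm]
  compatible := by
    rintro _ ⟨c₀, rfl⟩ c V W t c' V' W' - hc hV hW
    simp only [hatMetric_eq]
    refine ((hc.hasDerivAt_hatForm c₀.wind hV hW).const_mul p).congr_deriv ?_
    rw [hatForm_symm _ _ (V t) (W' - _), ← hatFormL_apply _ _ (V' - _), ← hatFormL_apply _ _ (W' - _),
      map_sub, map_sub, LinearMap.sub_apply, LinearMap.sub_apply]
    simp only [hatFormL_apply, hatForm_hatGamma]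
    -- With `ω` antisymmetric, the terms containing the rotation component of `c'` cancel between
    -- the two corrections, and the others reproduce the derivative of the coefficients.
    rw [hatForm_symm _ _ W' (V t), omega_antisymm q (W t).2.1 (V t).2.1,
      omega_antisymm q (W t).2.1 c'.2.1, omega_antisymm q (V t).2.1 c'.2.1]
    ring

theorem isLorentzSymmetricSpace_hatMetric {p : ℝ} (hp : 0 < p) (hq : (gram 1 q).PosDef) :
    IsLorentzSymmetricSpace (hatMetric p q) where
  manifold := isTameFrechetManifold q
  metric := isMetric_hatMetric hp hq
  lorentzian := isLorentzian_hatMetric hp hq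
  leviCivita := ⟨hatGamma q, isLeviCivita_hatGamma p q⟩
  symmetry := exists_symmetry p

/-! ## The group of left translations -/

/-- The group is the image of the left regular representation. It is a faithful copy of `HatMT q`,
and it acts simply transitively. -/
theorem isEuclideanKacMoodySymmetricSpace_hatMetric {p : ℝ} (hp : 0 < p) (hq : (gram 1 q).PosDef) :
    IsEuclideanKacMoodySymmetricSpace (hatMetric p q) where
  symmetricSpace := isLorentzSymmetricSpace_hatMetric hp hq
  kacMoodyGroup := by
    set f : HatMT q →* Equiv.Perm (HatMT q) := MulAction.toPermHom (HatMT q) (HatMT q)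
    have hf : Function.Injective f := MulAction.toPerm_injective
    have hfa : ∀ a, f a = Equiv.mulLeft a := fun a => Equiv.ext fun _ => rfl
    refine ⟨n, q, f.range, f.ofInjective hf, hq, ?_, HatMT.continuous_mul, fun x y => ?_, ?_⟩
    · rintro _ ⟨a, rfl⟩
      rw [hfa]
      exact isIsometry_mulLeft p a
    · exact ⟨f (y * x⁻¹), ⟨_, rfl⟩, inv_mul_cancel_right y x⟩
    · rintro x _ ⟨a, rfl⟩ h
      have h1 : a = 1 := mul_eq_right.1 (show a * x = x from h)
      rw [h1, map_one]

end

/-! ### Logarithms of holomorphic loops and the central extension -/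

section

/-! ## The structure of the group of loops -/

/-- Simple connectedness of `ℂ` gives a continuous logarithm. Near `z₀` it equals the principal
logarithm of `G / G(z₀)` plus a constant, because the imaginary part of the increment stays below
`π`; hence it is holomorphic. -/
theorem exists_entire_log {G : ℂ → ℂ} (hG : Differentiable ℂ G) (h0 : ∀ z, G z ≠ 0) :
    ∃ h : ℂ → ℂ, Differentiable ℂ h ∧ ∀ z, Complex.exp (h z) = G z := by
  have hsc : IsSimplyConnected (Set.univ : Set ℂ) := by
    have := (convex_univ (𝕜 := ℝ) (E := ℂ)).contractibleSpace Set.univ_nonempty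
    exact (inferInstance : SimplyConnectedSpace (Set.univ : Set ℂ))
  obtain ⟨h, hc, he⟩ := Complex.exists_continuousOn_eqOn_exp_comp (X := ℂ) (U := Set.univ)
    (g := G) hsc isOpen_univ hG.continuous.continuousOn
    (by rintro ⟨z, -, hz⟩; exact h0 z hz)
  have he' : ∀ z, Complex.exp (h z) = G z := fun z => he (Set.mem_univ z)
  refine ⟨h, fun z₀ => ?_, he'⟩
  have hcz : ContinuousAt (fun z => (h z - h z₀).im) z₀ :=
    Complex.continuous_im.continuousAt.comp
      ((continuousOn_univ.1 hc).continuousAt.sub continuousAt_const)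
  have hev : ∀ᶠ z in 𝓝 z₀, |(h z - h z₀).im| < Real.pi := by
    refine hcz.abs.eventually (gt_mem_nhds ?_)
    simpa using Real.pi_pos
  have heq : h =ᶠ[𝓝 z₀] fun z => Complex.log (G z / G z₀) + h z₀ := by
    filter_upwards [hev] with z hz
    rw [← he' z, ← he' z₀, ← Complex.exp_sub, Complex.log_exp (neg_lt_of_abs_lt hz)
      (lt_of_abs_lt hz).le, sub_add_cancel]
  refine DifferentiableAt.congr_of_eventuallyEq ?_ heq
  refine (DifferentiableAt.clog ((hG z₀).div_const _) ?_).add_const _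
  rw [div_self (h0 z₀)]
  exact Complex.one_mem_slitPlane

/-- Since `k` depends only on the exponential of its argument, the branch cut does no harm: near
`z₀` one may use `log (z / z₀) + log z₀`, which is holomorphic there. -/
theorem differentiableOn_comp_log {k : ℂ → ℂ} (hk : Differentiable ℂ k)
    (hper : ∀ a b, Complex.exp a = Complex.exp b → k a = k b) :
    DifferentiableOn ℂ (fun z => k (Complex.log z)) {0}ᶜ := by
  intro z₀ hz₀
  have hz₀' : z₀ ≠ 0 := hz₀
  refine DifferentiableAt.differentiableWithinAt ?_
  have heq : (fun z => k (Complex.log z)) =ᶠ[𝓝 z₀]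
      fun z => k (Complex.log (z / z₀) + Complex.log z₀) := by
    filter_upwards [isOpen_compl_singleton.mem_nhds hz₀] with z hz
    have hz' : z ≠ 0 := hz
    refine hper _ _ ?_
    rw [Complex.exp_add, Complex.exp_log hz', Complex.exp_log hz₀',
      Complex.exp_log (div_ne_zero hz' hz₀'), div_mul_cancel₀ _ hz₀']
  refine DifferentiableAt.congr_of_eventuallyEq ?_ heq
  refine (hk _).comp (f := fun z => Complex.log (z / z₀) + Complex.log z₀) z₀ ?_
  refine (DifferentiableAt.clog (differentiableAt_id.div_const _) ?_).add_const _
  rw [div_self hz₀']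
  exact Complex.one_mem_slitPlane

/-- Let `h` be a logarithm of `g ∘ exp`. Its increment over the period `2πi` takes values in `2πiℤ`
and is holomorphic, so it is a constant `2πi m`, with `m` the winding number. Then `h(ζ) - m ζ` is
periodic and descends to `ℂ^*`. -/
theorem exists_loop_coordinates {g : ℂ → ℂ} (hg : DifferentiableOn ℂ g {0}ᶜ)
    (h0 : ∀ z, g z ≠ 0) (h1 : ∀ z : ℂ, ‖z‖ = 1 → ‖g z‖ = 1) :
    ∃ (m : ℤ) (e : ℂ → ℂ), DifferentiableOn ℂ e {0}ᶜ ∧ (∀ z : ℂ, ‖z‖ = 1 → (e z).im = 0) ∧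
      ∀ z, z ≠ 0 → g z = z ^ m * Complex.exp (Complex.I * e z) := by
  have hG : Differentiable ℂ fun ζ => g (Complex.exp ζ) := fun ζ =>
    ((hg _ (Complex.exp_ne_zero ζ)).differentiableAt
      (isOpen_compl_singleton.mem_nhds (Complex.exp_ne_zero ζ))).comp ζ
        Complex.differentiableAt_exp
  obtain ⟨h, hd, he⟩ := exists_entire_log hG fun ζ => h0 _
  set P : ℂ := 2 * Real.pi * Complex.I
  have hd' : Differentiable ℂ fun ζ => h (ζ + P) - h ζ :=
    (hd.comp (differentiable_id.add_const P)).sub hd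
  have hone : ∀ ζ, Complex.exp (h (ζ + P) - h ζ) = 1 := fun ζ => by
    rw [Complex.exp_sub, he, he, Complex.exp_periodic ζ, div_self (h0 _)]
  -- The exponential of the increment is identically `1`; differentiating this identity shows that
  -- the increment is constant.
  have hconst : ∀ ζ, h (ζ + P) - h ζ = h (0 + P) - h 0 := fun ζ => by
    refine is_const_of_deriv_eq_zero hd' (fun ξ => ?_) ζ 0
    have e1 := (hd' ξ).hasDerivAt.cexp
    simp only [hone] at e1
    have e2 := e1.unique (hasDerivAt_const ξ (1 : ℂ))
    rwa [one_mul] at e2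
  obtain ⟨m, hm⟩ := Complex.exp_eq_one_iff.1 (hone 0)
  have hshift : ∀ ζ, h (ζ + P) - m * (ζ + P) = h ζ - m * ζ := fun ζ => by
    have := hconst ζ
    rw [hm] at this
    linear_combination this
  set k : ℂ → ℂ := fun ζ => -Complex.I * (h ζ - m * ζ) with hk
  have hkd : Differentiable ℂ k :=
    (hd.sub (differentiable_id.const_mul _)).const_mul _
  have hkp : Function.Periodic k P := fun ζ => by
    simp only [hk, hshift]
  have hper : ∀ a b, Complex.exp a = Complex.exp b → k a = k b := fun a b hab => by
    obtain ⟨j, hj⟩ := Complex.exp_eq_exp_iff_exists_int.1 hab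
    rw [hj]
    exact hkp.int_mul j b
  refine ⟨m, fun z => k (Complex.log z), differentiableOn_comp_log hkd hper, fun z hz => ?_,
    fun z hz => ?_⟩
  -- On the unit circle `h` is imaginary because `|g| = 1`, and so is `log z`; hence `-i (h - m log
  -- z)` is real.
  · have hz0 : z ≠ 0 := fun h => by simp [h] at hz
    have hre : (h (Complex.log z)).re = 0 := by
      have h2 := h1 z hz
      rw [← Complex.exp_log hz0, ← he, Complex.norm_exp, Real.exp_eq_one_iff] at h2
      exact h2
    have hlog : (Complex.log z).re = 0 := by rw [Complex.log_re, hz, Real.log_one]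
    simp [hk, hre, hlog]
  · have h2 : Complex.I * k (Complex.log z) = h (Complex.log z) - m * Complex.log z := by
      simp only [hk]
      rw [← mul_assoc, mul_neg, Complex.I_mul_I, neg_neg, one_mul]
    rw [h2, Complex.exp_sub, he, Complex.exp_log hz, Complex.exp_int_mul, Complex.exp_log hz,
      mul_div_cancel₀ _ (zpow_ne_zero _ hz)]

variable {n : ℕ} {q : Matrix (Fin n) (Fin n) ℤ}

/-- The loop with mean value zero obtained from a holomorphic loop by subtracting a constant. -/
theorem exists_loopSpace {e : ℂ → Fin n → ℂ} (hd : DifferentiableOn ℂ e {0}ᶜ)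
    (hr : ∀ z : ℂ, ‖z‖ = 1 → ∀ j, (e z j).im = 0) :
    ∃ (c : Fin n → ℝ) (η : LoopSpace n), ∀ z, z ≠ 0 → ∀ j, e z j = c j + η z j := by
  have hπ : (2 * Real.pi : ℝ) ≠ 0 := by positivity
  have hc := LoopSpace.continuous_comp_exp hd
  set M : Fin n → ℂ := ∫ θ in (0 : ℝ)..2 * Real.pi, e (Circle.exp θ)
  have hM : ∀ j, ((M j).re : ℂ) = M j := fun j => by
    have h2 := (Complex.imCLM.comp (ContinuousLinearMap.proj (R := ℂ) (φ := fun _ : Fin n => ℂ)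
      j |>.restrictScalars ℝ)).intervalIntegral_comp_comm (hc.intervalIntegrable
        (μ := MeasureTheory.volume) 0 (2 * Real.pi))
    have h3 : ∫ θ in (0 : ℝ)..2 * Real.pi, (e (Circle.exp θ) j).im = (M j).im := h2
    simp only [hr _ (Circle.norm_coe _), intervalIntegral.integral_zero] at h3
    exact Complex.ext rfl h3
  set c : Fin n → ℝ := fun j => (2 * Real.pi)⁻¹ * (M j).re with hcdef
  set C : Fin n → ℂ := fun j => (c j : ℂ) with hCdef
  have hMC : (2 * Real.pi : ℝ) • C = M := by
    funext j
    rw [Pi.smul_apply, Complex.real_smul, ← hM j, hCdef, hcdef]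
    dsimp only
    rw [← Complex.ofReal_mul, mul_inv_cancel_left₀ hπ]
  refine ⟨c, ⟨fun z => if z = 0 then 0 else e z - C, if_pos rfl, ?_, fun z hz j => ?_, ?_⟩,
    fun z hz j => ?_⟩
  · exact (hd.sub (differentiableOn_const C)).congr fun z hz => if_neg hz
  · have hz0 : z ≠ 0 := fun h => by simp [h] at hz
    simp [hz0, hr z hz j, hCdef]
  · simp only [Circle.coe_ne_zero, if_false]
    rw [intervalIntegral.integral_sub (hc.intervalIntegrable _ _)
      (continuous_const.intervalIntegrable _ _), intervalIntegral.integral_const, sub_zero, hMC,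
      sub_self]
  · change e z j = c j + (if z = 0 then (0 : Fin n → ℂ) else e z - C) j
    rw [if_neg hz, Pi.sub_apply, hCdef]
    ring

theorem HatMT.toLoop_apply (x : HatMT q) {z : ℂ} (hz : z ≠ 0) (j : Fin n) :
    x.toLoop z j = x.tor j * z ^ x.wind j * Complex.exp (Complex.I * x.loop z j) := by
  rw [HatMT.toLoop, if_neg hz]

theorem HatMT.toLoop_zero (x : HatMT q) : x.toLoop 0 = 1 := if_pos rfl

theorem HatMT.toLoop_mem (x : HatMT q) : x.toLoop ∈ MT n := by
  refine ⟨x.toLoop_zero, ?_, fun z j => ?_, fun z hz j => ?_⟩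
  · refine differentiableOn_pi.2 fun j => ?_
    have h1 : DifferentiableOn ℂ (fun z : ℂ => (x.tor j : ℂ) * z ^ x.wind j *
        Complex.exp (Complex.I * x.loop z j)) {0}ᶜ := by
      refine ((differentiableOn_const _).mul fun z hz => ?_).mul
        (((differentiableOn_const _).mul (differentiableOn_pi.1 x.loop.differentiableOn j)).cexp)
      exact (differentiableAt_zpow.2 (Or.inl hz)).differentiableWithinAt
    exact h1.congr fun z hz => x.toLoop_apply hz j
  · by_cases hz : z = 0
    · rw [hz, x.toLoop_zero]
      exact one_ne_zero
    · rw [x.toLoop_apply hz]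
      exact mul_ne_zero (mul_ne_zero (Circle.coe_ne_zero _) (zpow_ne_zero _ hz))
        (Complex.exp_ne_zero _)
  · have hz0 : z ≠ 0 := fun h => by simp [h] at hz
    rw [x.toLoop_apply hz0, norm_mul, norm_mul, norm_zpow, hz, Complex.norm_exp]
    simp [x.loop.im_apply hz j, Circle.norm_coe]

theorem HatMT.toLoop_mul (x y : HatMT q) (z : ℂ) :
    (x * y).toLoop z = x.toLoop z * y.toLoop (x.rot * z) := by
  by_cases hz : z = 0
  · rw [hz, mul_zero, HatMT.toLoop_zero, HatMT.toLoop_zero, HatMT.toLoop_zero, one_mul]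
  · have hw : (x.rot : ℂ) * z ≠ 0 := mul_ne_zero (Circle.coe_ne_zero _) hz
    funext j
    rw [Pi.mul_apply, HatMT.toLoop_apply _ hz, HatMT.toLoop_apply _ hz, HatMT.toLoop_apply _ hw]
    have h1 : ((x * y).tor j : ℂ) = x.tor j * (y.tor j * (x.rot : ℂ) ^ y.wind j) := by
      rw [HatMT.tor_mul]
      simp
    have h2 : (x * y).loop z j = x.loop z j + y.loop (x.rot * z) j := rfl
    rw [h1, h2, HatMT.wind_mul, Pi.add_apply, zpow_add₀ hz, mul_zpow, mul_add, Complex.exp_add]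
    ring

theorem HatMT.exists_toLoop_eq {f : ℂ → Fin n → ℂ} (hf : f ∈ MT n) (w : Circle) :
    ∃ x : HatMT q, x.toLoop = f ∧ x.rot = w := by
  obtain ⟨f0, fd, fne, fc⟩ := hf
  choose m e hd hr he using fun j => exists_loop_coordinates (differentiableOn_pi.1 fd j)
    (fun z => fne z j) fun z hz => fc z hz j
  obtain ⟨c, η, hη⟩ := exists_loopSpace (e := fun z j => e j z) (differentiableOn_pi.2 hd)
    fun z hz j => hr j z hz
  -- The mean value of the exponent becomes the torus element. The central coordinate is not seen by
  -- the loop and is put equal to `1`.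
  refine ⟨⟨m, fun j => Circle.exp (c j), η, 1, w⟩, funext fun z => ?_, rfl⟩
  by_cases hz : z = 0
  · rw [hz, HatMT.toLoop_zero, f0]
  · funext j
    rw [HatMT.toLoop_apply _ hz, he j z hz, hη z hz j, mul_add, Complex.exp_add, Circle.coe_exp,
      mul_comm Complex.I (c j : ℂ)]
    ring

/-- Along the circle the loop has the phase `λ θ + η(e^{iθ})` up to a constant. If the loop is
trivial, the exponential of this phase is constant, and so is the phase. Comparing `θ = 0` with `θ =
2π` gives `λ = 0`; then `η` is constant with mean value zero, hence `0`, and `t = 1`. -/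
theorem HatMT.eq_central_of_toLoop_eq_one {x : HatMT q} (hx : x.toLoop = 1) (hr : x.rot = 1) :
    x = HatMT.central x.cen := by
  have key : ∀ j, x.wind j = 0 ∧ ∀ θ : ℝ, (x.loop (Circle.exp θ) j).re = 0 := by
    intro j
    set φ : ℝ → ℝ := fun θ => x.wind j * θ + (x.loop (Circle.exp θ) j).re with hφ
    have hφd : ∀ θ, HasDerivAt φ (x.wind j + (x.loop.deriv (Circle.exp θ) j).re) θ := fun θ =>
      (((hasDerivAt_id θ).const_mul (x.wind j : ℝ)).add
        (LoopSpace.hasDerivAt_re_rotate x.loop θ j)).congr_deriv (by rw [mul_one])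
    have hexp : ∀ θ, Complex.exp (φ θ * Complex.I) = ((x.tor j)⁻¹ : Circle) := fun θ => by
      have h1 := congrFun (congrFun hx (Circle.exp θ)) j
      rw [HatMT.toLoop_apply _ (Circle.coe_ne_zero _)] at h1
      have h2 : x.loop (Circle.exp θ) j = ((x.loop (Circle.exp θ) j).re : ℂ) :=
        Complex.ext rfl (x.loop.im_apply (Circle.norm_coe _) j)
      rw [h2, ← Circle.coe_zpow, circle_exp_zpow, Circle.coe_exp, mul_assoc,
        mul_comm Complex.I, ← Complex.exp_add, ← add_mul, ← Complex.ofReal_add] at h1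
      rw [Circle.coe_inv]
      exact eq_inv_of_mul_eq_one_right h1
    have hconst : ∀ θ, φ θ = φ 0 := fun θ => by
      refine is_const_of_deriv_eq_zero (fun θ => (hφd θ).differentiableAt) (fun θ => ?_) θ 0
      have h1 := ((hφd θ).ofReal_comp.mul_const Complex.I).cexp
      simp only [hexp] at h1
      have h2 := h1.unique (hasDerivAt_const θ _)
      rw [(hφd θ).deriv]
      have h3 := (mul_eq_zero.1 h2).resolve_left (Circle.coe_ne_zero _)
      exact Complex.ofReal_eq_zero.1 ((mul_eq_zero.1 h3).resolve_right Complex.I_ne_zero)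
    have hw : x.wind j = 0 := by
      have h1 := hconst (2 * Real.pi)
      simp only [hφ, Circle.exp_two_pi, Circle.exp_zero, mul_zero, zero_add] at h1
      have h2 : (x.wind j : ℝ) * (2 * Real.pi) = 0 := by linarith
      have h3 := (mul_eq_zero.1 h2).resolve_right (by positivity)
      exact_mod_cast h3
    refine ⟨hw, ?_⟩
    have hφ' : ∀ θ, (x.loop (Circle.exp θ) j).re = (x.loop (Circle.exp 0) j).re := fun θ => by
      simpa [hφ, hw] using hconst θ
    have h1 := integral_re_loop x.loop j
    simp only [hφ', intervalIntegral.integral_const, sub_zero, smul_eq_mul] at h1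
    have h2 := (mul_eq_zero.1 h1).resolve_left (by positivity)
    exact fun θ => (hφ' θ).trans h2
  have hloop : x.loop = 0 := LoopSpace.ext_circle fun z hz => by
    have hz' : (Circle.exp (Complex.arg z) : ℂ) = z := by
      rw [Circle.coe_exp]; simpa [hz] using Complex.norm_mul_exp_arg_mul_I z
    funext j
    refine Complex.ext ?_ (x.loop.im_apply hz j)
    rw [← hz']
    exact (key j).2 _
  have hwind : x.wind = 0 := funext fun j => (key j).1
  refine HatMT.ext hwind (funext fun j => Circle.ext ?_) hloop rfl hr
  have h1 := congrFun (congrFun hx 1) j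
  rw [HatMT.toLoop_apply _ one_ne_zero, hloop] at h1
  change (x.tor j : ℂ) = 1
  simpa using h1

theorem isLoopGroupExtension (q : Matrix (Fin n) (Fin n) ℤ) : IsLoopGroupExtension q where
  mem := HatMT.toLoop_mem
  mul_loop := HatMT.toLoop_mul
  mul_rot := HatMT.rot_mul
  surjective _ hf w := HatMT.exists_toLoop_eq hf w
  kernel x := by
    refine ⟨fun h => ⟨x.cen, HatMT.eq_central_of_toLoop_eq_one h.1 h.2⟩, ?_⟩
    rintro ⟨u, rfl⟩
    refine ⟨funext fun z => ?_, rfl⟩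
    by_cases hz : z = 0
    · rw [hz, HatMT.toLoop_zero]; rfl
    · funext j
      rw [HatMT.toLoop_apply _ hz]
      simp [HatMT.central]
  central_mul u v := by
    have hc : u * v = u * (v * (1 : Circle) ^ (-bil q 0 0)) *
        cocycle q 0 0 0 (fun _ => 1 * 1 ^ (0 : ℤ)) ((0 : LoopSpace n).rotate 1) := by
      simp [cocycle, omega_zero_left, bil, torusPow]
    refine HatMT.ext (add_zero _).symm (funext fun i => ?_) ?_ hc (one_mul _).symm
    · change (1 : Circle) = 1 * (1 * 1 ^ (0 : ℤ))
      simp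
    · change (0 : LoopSpace n) = 0 + (0 : LoopSpace n).rotate 1
      rw [LoopSpace.rotate_one, zero_add]
  central_comm u x := by
    have hw : weight q 0 = 0 := Matrix.mulVec_zero _
    have hb : bil q x.wind 0 = 0 := by simp [bil]
    have hc : u * (x.cen * 1 ^ (-bil q x.wind x.wind)) *
        cocycle q 0 0 x.wind (fun i => x.tor i * 1 ^ x.wind i) (x.loop.rotate 1) =
        x.cen * (u * x.rot ^ (-bil q 0 0)) *
        cocycle q x.wind x.loop 0 (fun i => 1 * x.rot ^ (0 : ℤ)) ((0 : LoopSpace n).rotate x.rot) := by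
      have h0 : (0 : LoopSpace n).rotate x.rot = 0 := LoopSpace.rotate_zero _
      have hb0 : bil q 0 x.wind = 0 := zero_dotProduct _
      have hb1 : bil q 0 0 = 0 := zero_dotProduct _
      rw [h0]
      simp [cocycle, omega_zero_left, omega_zero_right, hb, hb0, hb1, hw, torusPow, mul_comm]
    refine HatMT.ext ((zero_add _).trans (add_zero _).symm) (funext fun i => ?_) ?_ hc
      (mul_comm _ _)
    · change 1 * (x.tor i * 1 ^ x.wind i) = x.tor i * (1 * x.rot ^ (0 : ℤ))
      simp
    · change 0 + x.loop.rotate 1 = x.loop + (0 : LoopSpace n).rotate x.rot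
      rw [LoopSpace.rotate_one, LoopSpace.rotate_zero, add_zero, zero_add]

end

/-! ### The adjoint representation and the Lie bracket -/

section

section DirDeriv

variable {F G : Type*} [AddCommGroup F] [Module ℝ F] [TopologicalSpace F]
  [AddCommGroup G] [Module ℝ G] [TopologicalSpace G]

theorem HasDirDeriv.const_smul [ContinuousConstSMul ℝ G] (c : ℝ) {f : F → G} {x h : F} {y : G}
    (hf : HasDirDeriv f x h y) : HasDirDeriv (fun x => c • f x) x h (c • y) := by
  refine (Filter.Tendsto.const_smul hf c).congr fun t => ?_
  rw [smul_comm, smul_sub]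

theorem HasDirDeriv.sub [IsTopologicalAddGroup G] {f g : F → G} {x h : F} {y z : G}
    (hf : HasDirDeriv f x h y) (hg : HasDirDeriv g x h z) :
    HasDirDeriv (fun x => f x - g x) x h (y - z) := by
  refine (Filter.Tendsto.sub hf hg).congr fun t => ?_
  rw [← smul_sub, sub_sub_sub_comm]

theorem HasDirDeriv.line {f : F → G} {h : F} {y : G} (hf : HasDirDeriv f 0 h y) :
    HasDirDeriv (fun s : ℝ => f (s • h)) 0 1 y := by
  refine Filter.Tendsto.congr (fun t => ?_) hf
  simp

theorem HasDirDeriv.continuousAt_real [ContinuousAdd G] [ContinuousSMul ℝ G] {f : ℝ → G} {x : ℝ}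
    {y : G} (hf : HasDirDeriv f x 1 y) : ContinuousAt f x := by
  refine continuousWithinAt_compl_self.1 ?_
  have h1 := hf.tendsto
  have h2 : Filter.Tendsto (fun z : ℝ => z - x) (𝓝[≠] x) (𝓝[≠] 0) := by
    refine tendsto_nhdsWithin_iff.2 ⟨?_, ?_⟩
    · have : ContinuousAt (fun z : ℝ => z - x) x := by fun_prop
      have h3 := this.tendsto
      rw [sub_self] at h3
      exact h3.mono_left nhdsWithin_le_nhds
    · filter_upwards [self_mem_nhdsWithin] with z hz
      exact sub_ne_zero.2 hz
  refine (h1.comp h2).congr fun z => ?_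
  simp

theorem HasDirDeriv.congr_deriv {f : F → G} {x h : F} {y z : G} (hf : HasDirDeriv f x h y)
    (hyz : y = z) : HasDirDeriv f x h z := hyz ▸ hf

end DirDeriv

variable {n : ℕ} {q : Matrix (Fin n) (Fin n) ℤ}

/-! ## The adjoint representation -/

/-- The loop component of the conjugation by `x` in angle coordinates. -/
def conjLoop (x : HatMT q) (y : Model n) : LoopSpace n :=
  x.loop + (translationCLM x y).2.1 - x.loop.rotate (Circle.exp y.2.2.2)

/-- The conjugation by `x` of the identity component, in angle coordinates. -/
def conjLift (x : HatMT q) (y : Model n) : Model n :=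
  (y.1 - y.2.2.2 • (fun i => (x.wind i : ℝ)), conjLoop x y,
    (translationCLM x y).2.2.1 + (bil q x.wind x.wind : ℝ) • y.2.2.2 -
      (2 : ℝ)⁻¹ • omegaL q (conjLoop x y) (x.loop.rotate (Circle.exp y.2.2.2)), y.2.2.2)

/-- The conjugate of an element of the identity component is found by solving `x y = y' x` for `y'`
one coordinate at a time, which avoids the formula for `x⁻¹`. -/
theorem mul_expLift_zero (x : HatMT q) (y : Model n) :
    x * expLift q 0 y = expLift q 0 (conjLift x y) * x := by
  have hw : weight q 0 = 0 := Matrix.mulVec_zero _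
  have hb : bil q x.wind 0 = 0 := by simp [bil]
  have hb0 : bil q 0 0 = 0 := zero_dotProduct _
  have hb1 : bil q 0 x.wind = 0 := zero_dotProduct _
  refine HatMT.ext ((add_zero _).trans (zero_add _).symm) (funext fun i => ?_) ?_ ?_ (mul_comm _ _)
  · change x.tor i * (Circle.exp (y.1 i) * x.rot ^ (0 : ℤ)) =
      Circle.exp (y.1 i - y.2.2.2 * x.wind i) * (x.tor i * Circle.exp y.2.2.2 ^ x.wind i)
    rw [zpow_zero, mul_one, circle_exp_zpow, mul_left_comm, ← Circle.exp_add]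
    congr 2
    ring
  · change x.loop + y.2.1.rotate x.rot = conjLoop x y + x.loop.rotate (Circle.exp y.2.2.2)
    rw [conjLoop, sub_add_cancel, translationCLM_apply]
  · change x.cen * (Circle.exp y.2.2.1 * x.rot ^ (-bil q 0 0)) * (torusPow (fun i =>
      Circle.exp (y.1 i) * x.rot ^ (0 : ℤ)) (-weight q x.wind) * Circle.exp Real.pi ^ bil q x.wind 0 *
      Circle.exp (omega q x.loop (y.2.1.rotate x.rot) / 2)) =
      Circle.exp ((translationCLM x y).2.2.1 + bil q x.wind x.wind * y.2.2.2 -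
        (2 : ℝ)⁻¹ * omegaL q (conjLoop x y) (x.loop.rotate (Circle.exp y.2.2.2))) *
      (x.cen * Circle.exp y.2.2.2 ^ (-bil q x.wind x.wind)) * (torusPow (fun i =>
        x.tor i * Circle.exp y.2.2.2 ^ x.wind i) (-weight q 0) * Circle.exp Real.pi ^ bil q 0 x.wind *
        Circle.exp (omega q (conjLoop x y) (x.loop.rotate (Circle.exp y.2.2.2)) / 2))
    have h0 : ∀ t : Fin n → Circle, torusPow t 0 = 1 := fun t => by simp [torusPow]
    simp only [hb, hb0, hb1, hw, neg_zero, zpow_zero, mul_one, h0, one_mul, omegaL_apply]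
    obtain ⟨c, hc⟩ : ∃ c : ℝ, x.cen = Circle.exp c := ⟨_, (Circle.exp_arg _).symm⟩
    rw [torusPow_exp, circle_exp_zpow, hc, translationCLM_apply]
    simp only [← Circle.exp_add]
    congr 1
    push_cast
    ring

theorem arg_coe_one : Complex.arg ((1 : Circle) : ℂ) = 0 := by simp

theorem offset_one : offset (1 : HatMT q) = 0 := by
  refine Prod.ext (funext fun i => arg_coe_one) (Prod.ext rfl (Prod.ext ?_ ?_))
  · exact arg_coe_one
  · exact arg_coe_one

theorem hatChart_one_symm (y : Model n) : (hatChart (1 : HatMT q)).symm y = expLift q 0 y := by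
  rw [hatChart_symm_apply, offset_one, add_zero]
  rfl

theorem hatChart_one_one : hatChart (1 : HatMT q) 1 = 0 := by
  have h : Complex.arg (((1 : Circle) / 1 : Circle) : ℂ) = 0 := by simp
  exact Prod.ext (funext fun i => h) (Prod.ext rfl (Prod.ext h h))

theorem expLift_zero : expLift q 0 0 = 1 := by
  rw [← hatChart_one_symm, ← hatChart_one_one]
  exact (hatChart (1 : HatMT q)).left_inv (mem_chart_source (Model n) (1 : HatMT q))

theorem eventually_hatChart_one_expLift :
    ∀ᶠ y in 𝓝 (0 : Model n), hatChart (1 : HatMT q) (expLift q 0 y) = y := by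
  have h1 : expLift q 0 (0 : Model n) ∈ (hatChart (1 : HatMT q)).source := by
    rw [expLift_zero]
    exact mem_chart_source (Model n) (1 : HatMT q)
  filter_upwards [eventually_hatChart_expLift 1 h1] with y hy
  rw [expLift_zero, hatChart_one_one, sub_zero] at hy
  exact sub_eq_zero.1 hy

/-- The adjoint representation. -/
def adjoint (x : HatMT q) (Y : Model n) : Model n :=
  (Y.1 - Y.2.2.2 • (fun i => (x.wind i : ℝ)), Y.2.1.rotate x.rot - Y.2.2.2 • x.loop.deriv,
    (Y.2.2.1 + ∑ i, ((-weight q x.wind) i : ℝ) * Y.1 i) + bil q x.wind x.wind * Y.2.2.2 +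
      omega q x.loop (Y.2.1.rotate x.rot) - Y.2.2.2 / 2 * omega q x.loop x.loop.deriv, Y.2.2.2)

theorem hasDirDeriv_id {F : Type*} [AddCommGroup F] [Module ℝ F] [TopologicalSpace F] (x h : F) :
    HasDirDeriv (fun x => x) x h h :=
  hasDirDeriv_clm (ContinuousLinearMap.id ℝ F) x h

theorem conjLift_zero (x : HatMT q) : conjLift x 0 = 0 := by
  have h0 : conjLoop x 0 = 0 := by
    rw [conjLoop, map_zero]
    change x.loop + 0 - x.loop.rotate (Circle.exp 0) = 0
    rw [Circle.exp_zero, LoopSpace.rotate_one, add_zero, sub_self]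
  rw [conjLift, h0, map_zero]
  simp only [map_zero, Prod.snd_zero, Prod.fst_zero, zero_smul, smul_zero, sub_zero, add_zero,
    LinearMap.zero_apply]
  rfl

theorem hasDirDeriv_conjLift (x : HatMT q) (Y : Model n) :
    HasDirDeriv (conjLift x) 0 Y (adjoint x Y) := by
  obtain ⟨p1, -, -, p4⟩ := (hasDirDeriv_id (0 : Model n) Y).proj
  obtain ⟨-, t2, t3, -⟩ := (hasDirDeriv_clm (translationCLM x) 0 Y).proj
  have hrot := (hasDirDeriv_const x.loop (0 : Model n) Y).rotate p4
  have hloop := ((hasDirDeriv_const x.loop (0 : Model n) Y).add t2).sub hrot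
  have hom := hloop.bilin (omegaL q) (continuous_omegaL q) hrot
  have hk := p1.sub (p4.clm_comp ((ContinuousLinearMap.id ℝ ℝ).smulRight
    (fun i => (x.wind i : ℝ) : Fin n → ℝ)))
  have h := hk.prodMk (hloop.prodMk (((t3.add (p4.const_smul (bil q x.wind x.wind : ℝ))).sub
    (hom.const_smul (2 : ℝ)⁻¹)).prodMk p4))
  refine HasDirDeriv.congr_deriv (f := conjLift x) h ?_
  have e0 : x.loop.rotate (Circle.exp (0 : Model n).2.2.2) = x.loop := by
    change x.loop.rotate (Circle.exp 0) = x.loop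
    rw [Circle.exp_zero, LoopSpace.rotate_one]
  have e1 : (0 + Y.2.2.2 • x.loop.deriv).rotate (Circle.exp (0 : Model n).2.2.2) =
      Y.2.2.2 • x.loop.deriv := by
    change (0 + Y.2.2.2 • x.loop.deriv).rotate (Circle.exp 0) = _
    rw [Circle.exp_zero, LoopSpace.rotate_one, zero_add]
  -- The loop of the conjugate vanishes at the base point, so the derivative of the `ω` term retains
  -- only the summand in which that loop is differentiated.
  have e2 : x.loop + (translationCLM x 0).2.1 - x.loop = 0 := by
    rw [map_zero]
    exact add_sub_cancel_left _ _
  rw [e0, e1, e2, translationCLM_apply]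
  refine Prod.ext rfl (Prod.ext ?_ (Prod.ext ?_ rfl))
  · change 0 + Y.2.1.rotate x.rot - _ = _
    rw [zero_add]
    rfl
  · change Y.2.2.1 + (∑ i, ((-weight q x.wind) i : ℝ) * Y.1 i +
      omega q x.loop (Y.2.1.rotate x.rot) / 2) + bil q x.wind x.wind * Y.2.2.2 -
      (2 : ℝ)⁻¹ * (omegaL q (0 + Y.2.1.rotate x.rot - Y.2.2.2 • x.loop.deriv) x.loop +
        omegaL q 0 (Y.2.2.2 • x.loop.deriv)) = (Y.2.2.1 + ∑ i, ((-weight q x.wind) i : ℝ) * Y.1 i) +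
      bil q x.wind x.wind * Y.2.2.2 + omega q x.loop (Y.2.1.rotate x.rot) -
      Y.2.2.2 / 2 * omega q x.loop x.loop.deriv
    have h1 := omega_antisymm q (Y.2.1.rotate x.rot) x.loop
    have h2 := omega_antisymm q x.loop.deriv x.loop
    rw [zero_add, map_zero, LinearMap.zero_apply, map_sub, map_smul, LinearMap.sub_apply,
      LinearMap.smul_apply, omegaL_apply, omegaL_apply, h1, h2, smul_eq_mul]
    ring

/-- The chart at the identity inverts `expLift` near `0`, and the conjugated curve, being continuous
and starting at `0`, stays there for small `s`. -/
theorem hasDirDeriv_conj (x : HatMT q) (Y : Model n) : HasDirDeriv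
    (fun s : ℝ => hatChart (1 : HatMT q) (x * (hatChart (1 : HatMT q)).symm (s • Y) * x⁻¹)) 0 1
      (adjoint x Y) := by
  have h := (hasDirDeriv_conjLift x Y).line
  refine h.congr_of_eventuallyEq ?_
  have hc := h.continuousAt_real
  rw [ContinuousAt, zero_smul, conjLift_zero] at hc
  filter_upwards [hc.eventually (eventually_hatChart_one_expLift (q := q))] with s hs
  rw [hatChart_one_symm, mul_expLift_zero, mul_inv_cancel_right, hs]

/-! ## The bracket -/

theorem hasDirDeriv_adjoint (X Y : Model n) :
    HasDirDeriv (fun y => adjoint (expLift q 0 y) Y) 0 X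
      (0, X.2.2.2 • Y.2.1.deriv - Y.2.2.2 • X.2.1.deriv, omega q X.2.1 Y.2.1, 0) := by
  obtain ⟨-, p2, -, p4⟩ := (hasDirDeriv_id (0 : Model n) X).proj
  have hrot := (hasDirDeriv_const Y.2.1 (0 : Model n) X).rotate p4
  have hder := p2.clm_comp (LoopSpace.derivCLM n)
  have h1 := p2.bilin (omegaL q) (continuous_omegaL q) hrot
  -- The term `ω(η, ∂_θ η)` is quadratic in the base point and does not contribute to the derivative
  -- at `0`.
  have h2 := p2.bilin (omegaL q) (continuous_omegaL q) hder
  have h := (hasDirDeriv_const Y.1 (0 : Model n) X).prodMk ((hrot.sub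
    (hder.const_smul Y.2.2.2)).prodMk (((((hasDirDeriv_const Y.2.2.1 (0 : Model n) X).add h1).sub
      (h2.const_smul (Y.2.2.2 / 2)))).prodMk (hasDirDeriv_const Y.2.2.2 (0 : Model n) X)))
  have hfun : (fun y => adjoint (expLift q 0 y) Y) = fun y : Model n => (Y.1,
      Y.2.1.rotate (Circle.exp y.2.2.2) - Y.2.2.2 • LoopSpace.derivCLM n y.2.1,
      Y.2.2.1 + omegaL q y.2.1 (Y.2.1.rotate (Circle.exp y.2.2.2)) -
        (Y.2.2.2 / 2) • omegaL q y.2.1 (LoopSpace.derivCLM n y.2.1), Y.2.2.2) := by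
    funext y
    have hw : weight q 0 = 0 := Matrix.mulVec_zero _
    have hb : bil q 0 0 = 0 := zero_dotProduct _
    have e1 : (expLift q 0 y).wind = 0 := rfl
    have e2 : (expLift q 0 y).loop = y.2.1 := rfl
    have e3 : (expLift q 0 y).rot = Circle.exp y.2.2.2 := rfl
    rw [adjoint, e1, e2, e3, hw, hb]
    refine Prod.ext ?_ (Prod.ext rfl (Prod.ext ?_ rfl))
    · funext i
      simp
    · simp
  rw [hfun]
  refine h.congr_deriv ?_
  have e0 : ∀ η : LoopSpace n, η.rotate (Circle.exp (0 : Model n).2.2.2) = η := fun η => by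
    change η.rotate (Circle.exp 0) = η
    rw [Circle.exp_zero, LoopSpace.rotate_one]
  have e1 : (0 : Model n).2.1 = 0 := rfl
  have e2 : (0 : LoopSpace n).deriv = 0 := map_zero (LoopSpace.derivL n)
  rw [e0, e0, e1]
  refine Prod.ext rfl (Prod.ext ?_ (Prod.ext ?_ rfl))
  · simp
  · simp [e2, omega_zero_right]

theorem circle_deriv_loop (η : LoopSpace n) {z : ℂ} (hz : ‖z‖ = 1) (j : Fin n) :
    η.deriv z j = ((η.deriv z j).re : ℂ) :=
  Complex.ext rfl (η.deriv.im_apply hz j)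

theorem toKMAlgebra_loop_apply (p : ℝ) (X : Model n) {z : ℂ} (hz : z ≠ 0) :
    (toKMAlgebra p X).1.1 z = Complex.I • ((fun j => (X.1 j : ℂ)) + X.2.1 z) := if_neg hz

theorem deriv_toKMAlgebra_loop (p : ℝ) (X : Model n) {z : ℂ} (hz : z ≠ 0) :
    (Complex.I * z) • deriv (toKMAlgebra p X).1.1 z = Complex.I • X.2.1.deriv z := by
  have h1 : (toKMAlgebra p X).1.1 =ᶠ[𝓝 z]
      fun z => Complex.I • ((fun j => (X.1 j : ℂ)) + X.2.1 z) := by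
    filter_upwards [isOpen_compl_singleton.mem_nhds (show z ∈ ({0}ᶜ : Set ℂ) from hz)] with w hw
    exact toKMAlgebra_loop_apply p X hw
  have h2 : DifferentiableAt ℂ X.2.1.1 z := (X.2.1.differentiableOn z hz).differentiableAt
    (isOpen_compl_singleton.mem_nhds hz)
  have h3 : HasDerivAt (fun z => Complex.I • ((fun j => (X.1 j : ℂ)) + X.2.1 z))
      (Complex.I • deriv X.2.1.1 z) z := (h2.hasDerivAt.const_add _).const_smul Complex.I
  rw [h1.deriv_eq, h3.deriv, LoopSpace.deriv_apply, smul_comm]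

/-- With `dz = i z dθ` on the unit circle, `g' dz` becomes `∂_θ g dθ`. The two factors `i` of the
embedding give `-1`, and `-1 / (2πi)` accounts for the factor `i` on the right. The constant loop of
`X` drops out because `∂_θ` of a loop has mean value zero. -/
theorem residueCocycle_toKMAlgebra (p : ℝ) (X Y : Model n) :
    residueCocycle (gram p q) (toKMAlgebra p X).1 (toKMAlgebra p Y).1 =
      Complex.I * (p * (omega q X.2.1 Y.2.1 : ℝ)) := by
  have hint : ∀ θ : ℝ, deriv (circleMap 0 1) θ • (∑ i, ∑ j, (gram p q i j : ℂ) *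
      (toKMAlgebra p X).1.1 (circleMap 0 1 θ) i *
        deriv (toKMAlgebra p Y).1.1 (circleMap 0 1 θ) j) =
      ((-∑ i, ∑ j, gram p q i j * (X.1 i + (X.2.1 (Circle.exp θ) i).re) *
        (0 + (Y.2.1.deriv (Circle.exp θ) j).re) : ℝ) : ℂ) := by
    intro θ
    have hz : circleMap 0 1 θ = Circle.exp θ := by
      rw [circleMap_zero, Complex.ofReal_one, one_mul, Circle.coe_exp]
    rw [deriv_circleMap, hz, smul_eq_mul, Finset.mul_sum]
    generalize Circle.exp θ = w
    have hne := Circle.coe_ne_zero w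
    have hn := Circle.norm_coe w
    push_cast
    rw [← Finset.sum_neg_distrib]
    refine Finset.sum_congr rfl fun i _ => ?_
    rw [Finset.mul_sum, ← Finset.sum_neg_distrib]
    refine Finset.sum_congr rfl fun j _ => ?_
    have h1 := congrFun (deriv_toKMAlgebra_loop p Y hne) j
    rw [Pi.smul_apply, Pi.smul_apply, smul_eq_mul, smul_eq_mul, circle_deriv_loop Y.2.1 hn] at h1
    have h2 : X.2.1 w i = ((X.2.1 w i).re : ℂ) :=
      Complex.ext rfl (X.2.1.im_apply hn i)
    rw [toKMAlgebra_loop_apply p X hne, Pi.smul_apply, Pi.add_apply, smul_eq_mul, h2]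
    linear_combination (gram p q i j : ℂ) * Complex.I *
      ((X.1 i : ℂ) + ((X.2.1 w i).re : ℂ)) * h1 +
      (gram p q i j : ℂ) * ((X.1 i : ℂ) + ((X.2.1 w i).re : ℂ)) *
      ((Y.2.1.deriv w j).re : ℂ) * Complex.I_mul_I
  -- The remaining integral is a value of `kmForm` with vanishing coefficients of `c` and `d`, so
  -- its orthogonal decomposition can be reused.
  have hkm := kmForm_eq p q (X.1, X.2.1, 0, 0) (0, Y.2.1.deriv, 0, 0)
  rw [kmForm] at hkm
  simp only [map_zero, Pi.zero_apply, mul_zero, sub_zero, zero_add, ← omega_eq_form] at hkm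
  rw [residueCocycle, circleIntegral]
  simp only [hint]
  rw [intervalIntegral.integral_ofReal, intervalIntegral.integral_neg]
  simp only [zero_add]
  rw [← Complex.ofReal_mul, ← hkm]
  push_cast
  rw [mul_inv, Complex.inv_I]
  ring

theorem toKMAlgebra_bracket (p : ℝ) (X Y : Model n) :
    toKMAlgebra p (0, X.2.2.2 • Y.2.1.deriv - Y.2.2.2 • X.2.1.deriv, omega q X.2.1 Y.2.1, 0) =
      kmBracket (gram p q) (toKMAlgebra p X) (toKMAlgebra p Y) := by
  refine Prod.ext (Subtype.ext (funext fun z => ?_)) (Prod.ext ?_ ?_)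
  · change (if z = 0 then (0 : Fin n → ℂ) else Complex.I • ((fun j => ((0 : Fin n → ℝ) j : ℂ)) +
      (X.2.2.2 • Y.2.1.deriv - Y.2.2.2 • X.2.1.deriv) z)) =
      (X.2.2.2 : ℂ) • ((Complex.I * z) • deriv (toKMAlgebra p Y).1.1 z) -
        (Y.2.2.2 : ℂ) • ((Complex.I * z) • deriv (toKMAlgebra p X).1.1 z)
    by_cases hz : z = 0
    · simp [hz]
    · rw [if_neg hz, deriv_toKMAlgebra_loop p X hz, deriv_toKMAlgebra_loop p Y hz,
        LoopSpace.sub_apply, LoopSpace.smul_apply, LoopSpace.smul_apply]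
      funext j
      simp only [Pi.smul_apply, Pi.add_apply, Pi.sub_apply, Pi.zero_apply, Complex.real_smul,
        smul_eq_mul, Complex.ofReal_zero]
      ring
  · exact (residueCocycle_toKMAlgebra p X Y).symm
  · exact Complex.ofReal_zero

theorem hasEuclideanKMAlgebra (p : ℝ) (q : Matrix (Fin n) (Fin n) ℤ) :
    HasEuclideanKMAlgebra p q := by
  refine ⟨adjoint, fun x Y => hasDirDeriv_conj x Y, fun X Y =>
    ⟨(0, X.2.2.2 • Y.2.1.deriv - Y.2.2.2 • X.2.1.deriv, omega q X.2.1 Y.2.1, 0), ?_,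
      toKMAlgebra_bracket p X Y⟩⟩
  have h := (hasDirDeriv_adjoint (q := q) X Y).line
  have e : ∀ s : ℝ, (chartAt (Model n) (1 : HatMT q)).symm (s • X) = expLift q 0 (s • X) :=
    fun s => hatChart_one_symm _
  simp only [e]
  exact h

end

/-! ### Positive definiteness of the integral form of a torus -/

section

/-! ## The scalar product on the cocharacters of a torus -/

section Torus

variable {d n : ℕ} {G : Type*} [TopologicalSpace G] [ChartedSpace (EuclideanSpace ℝ (Fin d)) G]
  [Group G] [LieGroup (𝓡 d) ∞ G]

/-- The exponential map of the torus parametrized by `φ`. -/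
def torusExp (φ : (Fin n → Circle) →* G) (x : Fin n → ℝ) : G := φ fun i => Circle.exp (x i)

theorem torusExp_zero (φ : (Fin n → Circle) →* G) : torusExp φ 0 = 1 := by
  have h : (fun i => Circle.exp ((0 : Fin n → ℝ) i)) = 1 := funext fun i => Circle.exp_zero
  rw [torusExp, h, map_one]

theorem torusExp_add (φ : (Fin n → Circle) →* G) (x y : Fin n → ℝ) :
    torusExp φ (x + y) = torusExp φ x * torusExp φ y := by
  rw [torusExp, torusExp, torusExp, ← map_mul]
  exact congrArg φ (funext fun i => Circle.exp_add _ _)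

/-- The differential of the exponential map of a torus at `0`. -/
def torusDifferential (φ : (Fin n → Circle) →* G) : (Fin n → ℝ) →L[ℝ] EuclideanSpace ℝ (Fin d) :=
  mfderiv 𝓘(ℝ, Fin n → ℝ) (𝓡 d) (torusExp φ) 0

theorem IsTorusParam.exists_hasMFDerivAt {φ : (Fin n → Circle) →* G} (hφ : IsTorusParam d φ)
    (v : Fin n → ℝ) : ∃ A : ℝ →L[ℝ] EuclideanSpace ℝ (Fin d), A 1 = torusDifferential φ v ∧
      HasMFDerivAt 𝓘(ℝ, ℝ) (𝓡 d) (fun s : ℝ => torusExp φ (s • v)) 0 A := by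
  have h1 : HasMFDerivAt 𝓘(ℝ, Fin n → ℝ) (𝓡 d) (torusExp φ) 0 (torusDifferential φ) :=
    (hφ.smooth.mdifferentiable (by simp) 0).hasMFDerivAt
  have h2 : HasMFDerivAt 𝓘(ℝ, ℝ) 𝓘(ℝ, Fin n → ℝ) (fun s : ℝ => s • v) 0
      (ContinuousLinearMap.toSpanSingleton ℝ v) :=
    (ContinuousLinearMap.toSpanSingleton ℝ v).hasFDerivAt.hasMFDerivAt
  have h3 : HasMFDerivAt 𝓘(ℝ, Fin n → ℝ) (𝓡 d) (torusExp φ) ((0 : ℝ) • v)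
      (torusDifferential φ) := by
    rw [zero_smul]; exact h1
  refine ⟨(torusDifferential φ).comp (ContinuousLinearMap.toSpanSingleton ℝ v), ?_,
    HasMFDerivAt.comp (g := torusExp φ) (f := fun s : ℝ => s • v) (0 : ℝ) h3 h2⟩
  rw [ContinuousLinearMap.comp_apply, ContinuousLinearMap.toSpanSingleton_apply, one_smul]

theorem IsTorusParam.torusVector_eq {φ : (Fin n → Circle) →* G} (hφ : IsTorusParam d φ)
    (j : Fin n) : torusVector d φ j = torusDifferential φ (Pi.single j 1) := by
  obtain ⟨A, hA, h1⟩ := hφ.exists_hasMFDerivAt (Pi.single j 1)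
  have h2 : (fun s : ℝ => torusExp φ (s • (Pi.single j 1 : Fin n → ℝ))) =
      fun s : ℝ => φ (Pi.mulSingle j (Circle.exp s)) := by
    funext s
    refine congrArg φ (funext fun i => ?_)
    by_cases hij : i = j
    · subst hij
      simp
    · simp [hij]
  rw [h2] at h1
  have h3 := congrArg (fun A : ℝ →L[ℝ] EuclideanSpace ℝ (Fin d) => A 1) h1.mfderiv
  exact h3.trans hA

/-- Injectivity as a homomorphism is turned into injectivity of the differential. A one-parameter
group with zero velocity at the identity has zero velocity everywhere by left translation, so it is
constant; an injective `φ` then forces its direction to vanish. -/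
theorem IsTorusParam.injective_torusDifferential [T2Space G] {φ : (Fin n → Circle) →* G}
    (hφ : IsTorusParam d φ) {v : Fin n → ℝ} (hv : torusDifferential (d := d) φ v = 0) : v = 0 := by
  have hm1 : IsManifold (𝓡 d) 1 G := IsManifold.of_le (n := ∞) (by simp)
  set c : ℝ → G := fun s => torusExp φ (s • v)
  have h0 : HasMFDerivAt 𝓘(ℝ, ℝ) (𝓡 d) c 0 (0 : ℝ →L[ℝ] EuclideanSpace ℝ (Fin d)) := by
    obtain ⟨A, hA, h⟩ := hφ.exists_hasMFDerivAt v
    have hz : A = 0 := by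
      ext1
      rw [hA, hv, zero_apply]
    rw [hz] at h
    exact h
  have hd : ∀ s, HasMFDerivAt 𝓘(ℝ, ℝ) (𝓡 d) c s (0 : ℝ →L[ℝ] EuclideanSpace ℝ (Fin d)) := by
    intro s
    have h1 : HasMFDerivAt 𝓘(ℝ, ℝ) 𝓘(ℝ, ℝ) (fun t : ℝ => t - s) s
        (ContinuousLinearMap.id ℝ ℝ) := ((hasFDerivAt_id s).sub_const s).hasMFDerivAt
    have h2 : HasMFDerivAt 𝓘(ℝ, ℝ) (𝓡 d) c (s - s)
        (0 : ℝ →L[ℝ] EuclideanSpace ℝ (Fin d)) := by rw [sub_self]; exact h0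
    have h3 := HasMFDerivAt.comp (g := c) (f := fun t : ℝ => t - s) s h2 h1
    have h4 : MDifferentiableAt (𝓡 d) (𝓡 d) (fun x : G => c s * x) (c (s - s)) :=
      (contMDiff_mul_left (I := 𝓡 d) (n := ∞)).mdifferentiable (by simp) _
    have h5 := h4.hasMFDerivAt.comp s h3
    have h6 : ((fun x : G => c s * x) ∘ c ∘ fun t : ℝ => t - s) = c := by
      funext t
      change torusExp φ (s • v) * torusExp φ ((t - s) • v) = torusExp φ (t • v)
      rw [← torusExp_add, ← add_smul, add_sub_cancel]
    rw [h6] at h5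
    have h7 : ∀ M : EuclideanSpace ℝ (Fin d) →L[ℝ] EuclideanSpace ℝ (Fin d),
        M.comp ((0 : ℝ →L[ℝ] EuclideanSpace ℝ (Fin d)).comp (ContinuousLinearMap.id ℝ ℝ)) = 0 :=
      fun M => by simp
    exact h5.congr_mfderiv (h7 _)
  have hz : (0 : ℝ →L[ℝ] EuclideanSpace ℝ (Fin d)) = (1 : ℝ →L[ℝ] ℝ).smulRight 0 := by simp
  have hc : c = fun _ => (1 : G) := by
    -- Both curves are integral curves of the zero vector field through `1`, and such curves are
    -- unique.
    refine isMIntegralCurve_Ioo_eq_of_contMDiff_boundaryless (I := 𝓡 d) (t₀ := 0)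
      (v := fun x => (0 : TangentSpace (𝓡 d) x)) ?_ ?_ ?_ ?_
    · exact Bundle.contMDiff_zeroSection ℝ (TangentSpace (𝓡 d) : G → Type _)
    · intro s
      exact (hd s).congr_mfderiv hz
    · intro s
      exact (hasMFDerivAt_const (1 : G) s).congr_mfderiv
        hz
    · change torusExp φ ((0 : ℝ) • v) = 1
      rw [zero_smul, torusExp_zero]
  funext j
  by_contra hj
  have hj' : v j ≠ 0 := hj
  -- At the time `1 / v j` the `j`-th angle is `1`, and `e^i ≠ 1` because `1 < π`.
  have h1 : φ (fun i => Circle.exp (((v j)⁻¹ • v) i)) = φ 1 := by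
    rw [map_one]
    exact congrFun hc (v j)⁻¹
  have h2 : Circle.exp ((v j)⁻¹ * v j) = 1 := congrFun (hφ.injective h1) j
  rw [inv_mul_cancel₀ hj'] at h2
  have h3 := eq_zero_of_circle_exp_eq_one h2 (by rw [abs_one]; linarith [Real.pi_gt_three])
  exact one_ne_zero h3

/-- The form `p vᵀ (q + qᵀ) v` is the square of the vector `∑ vᵢ Xᵢ` for `B`. This vector is nonzero
for `v ≠ 0`, since it is the image of `v` under the injective differential of the torus. -/
theorem posDef_gram [T2Space G] {φ : (Fin n → Circle) →* G} (hφ : IsTorusParam d φ)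
    {B : LinearMap.BilinForm ℝ (torusLieAlgebra d φ)} (hB : ∀ x, x ≠ 0 → 0 < B x x) {p : ℝ}
    (hp : 0 < p) {q : Matrix (Fin n) (Fin n) ℤ}
    (hq : ∀ i j, B (cocharacter d φ i) (cocharacter d φ j) = p * (q i j + q j i)) :
    (gram 1 q).PosDef := by
  refine Matrix.PosDef.of_dotProduct_mulVec_pos (Matrix.ext fun i j => ?_) fun v hv => ?_
  · rw [Matrix.conjTranspose_apply, star_trivial]
    exact gram_symm 1 q j i
  · set x : torusLieAlgebra d φ := ∑ i, v i • cocharacter d φ i with hx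
    have hx0 : x ≠ 0 := by
      intro h0
      refine hv (hφ.injective_torusDifferential ?_)
      have h1 : ∑ i, v i • torusVector d φ i = 0 := by
        have h2 := congrArg (torusLieAlgebra d φ).subtype h0
        rw [hx, map_sum, map_zero] at h2
        simp only [map_smul] at h2
        exact h2
      simp only [hφ.torusVector_eq] at h1
      have h3 : torusDifferential (d := d) φ v =
          ∑ i, v i • torusDifferential (d := d) φ (Pi.single i 1) := by
        conv_lhs => rw [pi_eq_sum_univ' v]
        rw [map_sum]
        refine Finset.sum_congr rfl fun i _ => ?_
        rw [map_smul]
      rw [h3]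
      exact h1
    have h4 := hB x hx0
    have h5 : B x x = p * (star v ⬝ᵥ (gram 1 q).mulVec v) := by
      rw [hx]
      simp only [map_sum, map_smul, LinearMap.sum_apply, LinearMap.smul_apply, hq, smul_eq_mul,
        dotProduct, Matrix.mulVec, Finset.mul_sum, Pi.star_apply, star_trivial, gram, one_mul]
      rw [Finset.sum_comm]
      refine Finset.sum_congr rfl fun i _ => Finset.sum_congr rfl fun j _ => ?_
      ring
    rw [h5] at h4
    exact pos_of_mul_pos_right h4 hp.le

end Torus

end

end

end KacMoody

theorem mainTheorem4 {d : ℕ} {G : Type*} [TopologicalSpace G]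
    [ChartedSpace (EuclideanSpace ℝ (Fin d)) G] [Group G] [LieGroup (𝓡 d) ∞ G]
    [T2Space G] [CompactSpace G] (hG : KacMoody.IsSimpleLieGroup d G)
    -- a maximal torus `T` of `G`, identified with `(S¹)ⁿ`
    (T : Subgroup G) (hT : KacMoody.IsMaximalTorus d T)
    {n : ℕ} (φ : (Fin n → Circle) →* G) (hφ : KacMoody.IsTorusParam d φ) (hφT : φ.range = T)
    -- a Euclidean scalar product on the Lie algebra of `T`, with values in `p ℤ` on the lattice of
    -- cocharacters `λ` and with `⟨λ, λ⟩ = 2 p q(λ)` for an integral quadratic form `q`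
    (B : LinearMap.BilinForm ℝ (KacMoody.torusLieAlgebra d φ))
    (hB_symm : ∀ x y, B x y = B y x) (hB_pos : ∀ x, x ≠ 0 → 0 < B x x)
    (p : ℝ) (hp : 0 < p) (q : Matrix (Fin n) (Fin n) ℤ)
    (hq : ∀ i j, B (KacMoody.cocharacter d φ i) (KacMoody.cocharacter d φ j) =
      p * (q i j + q j i)) :
    KacMoody.IsLoopGroupExtension q ∧
    KacMoody.HasEuclideanKMAlgebra p q ∧
    (∀ x : KacMoody.HatMT q, KacMoody.IsIsometry (KacMoody.hatMetric p q) (Equiv.mulLeft x)) ∧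
    KacMoody.IsEuclideanKacMoodySymmetricSpace (KacMoody.hatMetric p q) := by
  -- The scalar product on the Lie algebra of the torus is converted here into a property of the
  -- integral matrix `q`; the four claims then concern `p` and `q`.
  have hpos := KacMoody.posDef_gram hφ hB_pos hp hq
  exact ⟨KacMoody.isLoopGroupExtension q, KacMoody.hasEuclideanKMAlgebra p q,
    KacMoody.isIsometry_mulLeft p, KacMoody.isEuclideanKacMoodySymmetricSpace_hatMetric hp hpos⟩
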